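/- Let $G=SL^{\pm}(2,\mathbb R)$ be the group of real $2\times 2$ matrices of determinant $\pm1$, and put $k_\theta=\begin{pmatrix}\cos\theta&-\sin\theta\\ \sin\theta&\cos\theta\end{pmatrix}$, $K=\{k_\theta\}$, $M=\{\pm I\}$, $n_x=\begin{pmatrix}1&x\\0&1\end{pmatrix}$, $d_a=\mathrm{diag}(a,|a|^{-1})$ for $a\in\mathbb R\setminus\{0\}$. For $\lambda\in\mathbb R$ let $\mathcal P(i\lambda,+)_e$ be the space of functions $f$ on $G$ with $f(gp)=|p_{11}|^{1+i\lambda}f(g)$ for all lower triangular $p\in G$ and $f|_K\in L^2(K)$, with the $L^2(K)$-topology; a vector is smooth if $f|_K$ is smooth. For $s\in\mathbb C$ let $\mathcal P(2s-1,+)^\infty_e$ be the space of functions $\phi_s$ on $G$ with $\phi_s(gp)=|p_{11}|^{-2s}\phi_s(g)$ for all upper triangular $p\in G$ and with $\phi=\phi_s|_K$ smooth (so $\phi\in C^\infty(K/M)$), with the $C^\infty$-topology of $\phi$. $G$ acts on these spaces by left translation. Write $\tilde f(\theta)=f(k_{\theta-\pi/2})$, that is, $f(n_x)=(1+x^2)^{-\frac{1+i\lambda}2}\tilde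 f(\cot^{-1}x)$, and $\phi(\theta)=\phi(k_\theta)$. For a smooth vector $f$ let $Wh_f(g)=\lim_{R\to\infty}\int_{-R}^R f(gn_x)e^{-2\pi i x}\,dx$, and for smooth vectors $f_1,f_2$ let $$Tr_{\mathbb R}^{RS}(f_1,f_2,\phi_s)=\frac1{2\pi}\int_0^{2\pi}\int_{\mathbb R\setminus\{0\}}Wh_{f_1}(k_\theta d_a)\,\overline{Wh_{f_2}(k_\theta d_a)}\,\phi_s(k_\theta d_a)\,|a|^2\,\frac{da}{|a|}\,d\theta .$$ Let $\lambda_1,\lambda_2\in\mathbb R$, $\Re(s)\in(0,1)$, $u=s-\frac{i\lambda_1-i\lambda_2}2$, $G_0(u)=2(2\pi)^{-u}\Gamma(u)\cos\frac{\pi u}2$, and $$H_{f_1,f_2,\phi}(\theta_1,\theta_2)=\frac1{2\pi}\int_0^{2\pi}\phi(\theta)\,\tilde f_1(\theta_1+\theta)\,\overline{\tilde f_2(\theta_2+\theta)}\,d\theta ,$$ $$T(f_1,f_2,\phi_s)=\frac{G_0(u)}8\int_0^{2\pi}\!\int_0^{2\pi}|\sin(\theta_1-\theta_2)|^{-u}|\sin\theta_1|^{-1+u+i\lambda_1}|\sin\theta_2|^{-1+u-i\lambda_2}H_{f_1,f_2,\phi}(\theta_1,\theta_2)\,d\theta_1\,d\theta_2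 .$$ (1) For all $f_i\in\mathcal P(i\lambda_i,+)_e$ and $\phi_s\in\mathcal P(2s-1,+)^\infty_e$, the integral defining $H$ converges absolutely for every $(\theta_1,\theta_2)$, and the double integral converges absolutely. (2) $T$ is a jointly continuous trilinear form (complex linear in $f_1$ and $\phi_s$, conjugate linear in $f_2$) on $\mathcal P(i\lambda_1,+)_e\times\mathcal P(i\lambda_2,+)_e\times\mathcal P(2s-1,+)^\infty_e$; left translation by $G$ preserves each of the three spaces, and $T$ is $G$-equivariant (invariant under the simultaneous left translation of the three arguments). (3) For smooth $f_1,f_2$ the limits defining $Wh_{f_i}$ exist, the integral $Tr_{\mathbb R}^{RS}(f_1,f_2,\phi_s)$ converges absolutely, and $Tr_{\mathbb R}^{RS}(f_1,f_2,\phi_s)=T(f_1,f_2,\phi_s)$. -/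

import Mathlib

open Real Set Filter Topology MeasureTheory
open scoped ContDiff ComplexConjugate

/-- The group `SL^±(2, ℝ)` of real `2 × 2` matrices of determinant `1` or `-1`. -/
def SLpm : Subgroup (GL (Fin 2) ℝ) where
  carrier := {g | (g : Matrix (Fin 2) (Fin 2) ℝ).det = 1 ∨ (g : Matrix (Fin 2) (Fin 2) ℝ).det = -1}
  mul_mem' := by
    rintro a b (ha | ha) (hb | hb) <;> simp [Matrix.det_mul, ha, hb]
  one_mem' := by simp
  inv_mem' := by
    rintro a (ha | ha) <;> simp [Matrix.det_nonsing_inv, ha, Ring.inverse_eq_inv']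

namespace SLpm

/-- The `(i, j)` entry of an element of `SL^±(2, ℝ)`. -/
def entry (g : SLpm) (i j : Fin 2) : ℝ := (g : GL (Fin 2) ℝ) i j

/-- The element of `SL^±(2, ℝ)` with a given matrix of determinant `±1`. -/
noncomputable def ofMatrix (m : Matrix (Fin 2) (Fin 2) ℝ) (h : m.det = 1 ∨ m.det = -1) : SLpm :=
  ⟨Matrix.GeneralLinearGroup.mkOfDetNeZero m (by rcases h with h | h <;> simp [h]), h⟩

/-- The rotation `k_θ` of `K = SO(2)`. -/
noncomputable def rot (θ : ℝ) : SLpm :=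
  ofMatrix !![cos θ, -sin θ; sin θ, cos θ]
    (Or.inl (by rw [Matrix.det_fin_two_of]; nlinarith [sin_sq_add_cos_sq θ]))

/-- The unipotent element `n_t` of `N`. -/
noncomputable def unip (t : ℝ) : SLpm :=
  ofMatrix !![1, t; 0, 1] (Or.inl (by simp [Matrix.det_fin_two_of]))

open Classical in
/-- The element `diag(a, |a|⁻¹)` of `A^± = A ⊔ I₋A`, where `I₋ = diag(-1, 1)`, with coordinate
`a ∈ ℝ ∖ {0}`; the value at `a = 0` is irrelevant. -/
noncomputable def diag (a : ℝ) : SLpm :=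
  if h : a ≠ 0 then
    ofMatrix !![a, 0; 0, |a|⁻¹] (by
      rw [Matrix.det_fin_two_of]
      rcases lt_or_gt_of_ne h with h' | h'
      · right; rw [abs_of_neg h']; field_simp; ring
      · left; rw [abs_of_pos h']; field_simp; ring)
  else 1

end SLpm

open SLpm

/-- Lebesgue measure `dθ` on one period of the circle `K`. -/
noncomputable def periodMeasure : Measure ℝ := volume.restrict (Ioc 0 (2 * π))

/-- The functions on `G = SL^±(2, ℝ)` in the unitary principal series `𝒫(iℓ, +)_e`, modelled on
`G / P̄` with `P̄` the lower triangular subgroup: `F (g p) = |p₁₁| ^ (iℓ + 1) F g` for `p ∈ P̄`, and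
`F` is square integrable on `K`. The condition for `p = -I` is the parity `+`, and for `p = I₋` it
is the even action `f(x) ↦ f(-x)` of `I₋` in the noncompact picture `f(x) = F(n_x)`. -/
def unitarySeriesSubmodule (l : ℝ) : Submodule ℂ (SLpm → ℂ) where
  carrier := {F | (∀ g p : SLpm, entry p 0 1 = 0 →
      F (g * p) = ((|entry p 0 0| : ℝ) : ℂ) ^ (Complex.I * l + 1) * F g) ∧
    MemLp (fun θ => F (rot θ)) 2 periodMeasure}
  add_mem' := by
    rintro F F' ⟨h, hm⟩ ⟨h', hm'⟩
    exact ⟨fun g p hp => by simp [h g p hp, h' g p hp, mul_add], hm.add hm'⟩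
  zero_mem' := ⟨fun g p _ => by simp, MemLp.zero⟩
  smul_mem' := by
    rintro c F ⟨h, hm⟩
    exact ⟨fun g p hp => by simp [h g p hp, mul_left_comm], hm.const_smul c⟩

/-- The space `𝒫(iℓ, +)_e`. Its elements are functions that are not identified when they agree
almost everywhere; the topology below is that of the Hilbert (semi)norm, so that a continuous
complex valued function on this space is the same thing as one on the Hilbert space. -/
def UnitarySeries (l : ℝ) : Type := unitarySeriesSubmodule l

namespace UnitarySeries

noncomputable instance (l : ℝ) : AddCommGroup (UnitarySeries l) :=
  inferInstanceAs (AddCommGroup (unitarySeriesSubmodule l))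

noncomputable instance (l : ℝ) : Module ℂ (UnitarySeries l) :=
  inferInstanceAs (Module ℂ (unitarySeriesSubmodule l))

instance (l : ℝ) : CoeFun (UnitarySeries l) (fun _ => SLpm → ℂ) := ⟨fun F => F.1⟩

/-- The topology of the Hilbert norm, which is the `L²` norm on `K` up to a constant. -/
noncomputable instance (l : ℝ) : TopologicalSpace (UnitarySeries l) :=
  TopologicalSpace.induced (fun F => (F.2.2.toLp : Lp ℂ 2 periodMeasure)) inferInstance

/-- Smooth vectors: the restriction to `K` is smooth. -/
def IsSmooth {l : ℝ} (F : UnitarySeries l) : Prop := ContDiff ℝ ∞ (fun θ => F (rot θ))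

end UnitarySeries

/-- The functions on `G = SL^±(2, ℝ)` in `𝒫(u, +)_e^∞`, modelled on `G / P` with `P` the upper
triangular subgroup: `Φ (g p) = |p₁₁| ^ (-(u + 1)) Φ g` for `p ∈ P`, and `Φ` is smooth on `K`.
For `u = 2s - 1` these are the functions `φ_s(kan) = φ(k) |a| ^ (-2s)` with `φ ∈ C^∞(K/M)`. -/
def smoothSeriesSubmodule (u : ℂ) : Submodule ℂ (SLpm → ℂ) where
  carrier := {Φ | (∀ g p : SLpm, entry p 1 0 = 0 →
      Φ (g * p) = ((|entry p 0 0| : ℝ) : ℂ) ^ (-(u + 1)) * Φ g) ∧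
    ContDiff ℝ ∞ (fun θ => Φ (rot θ))}
  add_mem' := by
    rintro F F' ⟨h, hm⟩ ⟨h', hm'⟩
    exact ⟨fun g p hp => by simp [h g p hp, h' g p hp, mul_add], hm.add hm'⟩
  zero_mem' := ⟨fun g p _ => by simp, contDiff_const⟩
  smul_mem' := by
    rintro c F ⟨h, hm⟩
    exact ⟨fun g p hp => by simp [h g p hp, mul_left_comm], contDiff_const.smul hm⟩

/-- The space `𝒫(u, +)_e^∞` modelled on `G / P`. -/
def SmoothSeries (u : ℂ) : Type := smoothSeriesSubmodule u

namespace SmoothSeries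

noncomputable instance (u : ℂ) : AddCommGroup (SmoothSeries u) :=
  inferInstanceAs (AddCommGroup (smoothSeriesSubmodule u))

noncomputable instance (u : ℂ) : Module ℂ (SmoothSeries u) :=
  inferInstanceAs (Module ℂ (smoothSeriesSubmodule u))

instance (u : ℂ) : CoeFun (SmoothSeries u) (fun _ => SLpm → ℂ) := ⟨fun F => F.1⟩

/-- The Fréchet topology of `C^∞(K/M)`: uniform convergence on `K` of all derivatives. -/
noncomputable instance (u : ℂ) : TopologicalSpace (SmoothSeries u) :=
  TopologicalSpace.induced
    (fun Φ => fun n : ℕ => UniformFun.ofFun (iteratedDeriv n (fun θ => Φ (rot θ))))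
    (inferInstance : TopologicalSpace (ℕ → UniformFun ℝ ℂ))

end SmoothSeries

/-- The noncompact picture `f(x) = F(n_x)` of a function on `G`. -/
noncomputable def noncompactPicture (F : SLpm → ℂ) (x : ℝ) : ℂ := F (unip x)

/-- The compact picture `f̃`, with the angle normalized by `θ = cot⁻¹ x`: for `F` in `𝒫(iℓ, +)` one
has `F(n_x) = (1 + x²) ^ (-(1 + iℓ)/2) f̃(cot⁻¹ x)`, because `n_{cot θ} ∈ k_{θ - π/2} P̄`. -/
noncomputable def compactPicture (F : SLpm → ℂ) (θ : ℝ) : ℂ := F (rot (θ - π / 2))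

/-- Left translation, the action of `G` on all these function spaces. -/
def leftTranslate (g : SLpm) (F : SLpm → ℂ) : SLpm → ℂ := fun h => F (g⁻¹ * h)

/-- `∫_{-R}^{R} f(x) e^{-2πix} dx` for `f` the noncompact picture of `F`. -/
noncomputable def truncatedWhittaker (F : SLpm → ℂ) (R : ℝ) : ℂ :=
  ∫ x in (-R)..R, noncompactPicture F x * Complex.exp (-2 * π * Complex.I * x)

/-- The pairing of `F` with the Whittaker vector `e^{-2πix}`. The noncompact picture of a smooth
vector decays only like `1 / |x|`, and the integral is an improper one. -/
noncomputable def whittakerFunctional (F : SLpm → ℂ) : ℂ :=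
  limUnder atTop (truncatedWhittaker F)

/-- The Whittaker function `Wh_F(g) = ⟨F, π*(g) ψ⟩ = ⟨π(g)⁻¹ F, ψ⟩`. -/
noncomputable def Wh (F : SLpm → ℂ) (g : SLpm) : ℂ := whittakerFunctional (leftTranslate g⁻¹ F)

/-- The integrand of the Rankin–Selberg integral over `G / N`, in the coordinates `(θ, a)` of
`K × A^±` and with the density of `dk |a|² da/|a|`, `dk = dθ / 2π`. -/
noncomputable def rsIntegrand (F₁ F₂ Φ : SLpm → ℂ) (p : ℝ × ℝ) : ℂ :=
  Wh F₁ (rot p.1 * diag p.2) * conj (Wh F₂ (rot p.1 * diag p.2)) * Φ (rot p.1 * diag p.2) *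
    ((|p.2| ^ 2 / |p.2| / (2 * π) : ℝ) : ℂ)

/-- The coordinate domain of `K A^± ≅ G / N`, up to the null set `a = 0`. -/
def rsDomain : Set (ℝ × ℝ) := Ioc 0 (2 * π) ×ˢ univ

/-- The Archimedean Rankin–Selberg integral of Whittaker functions. -/
noncomputable def rankinSelberg (F₁ F₂ Φ : SLpm → ℂ) : ℂ :=
  ∫ p in rsDomain, rsIntegrand F₁ F₂ Φ p

/-- `G₀(u) = 2 (2π)^{-u} Γ(u) cos(πu/2)`. -/
noncomputable def G₀ (u : ℂ) : ℂ :=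
  2 * (2 * π : ℂ) ^ (-u) * Complex.Gamma u * Complex.cos (π * u / 2)

/-- `u = s - (iℓ₁ - iℓ₂)/2`. -/
noncomputable def uParam (l₁ l₂ : ℝ) (s : ℂ) : ℂ := s - (Complex.I * l₁ - Complex.I * l₂) / 2

/-- The integrand of `H`. -/
noncomputable def convIntegrand (F₁ F₂ Φ : SLpm → ℂ) (θ₁ θ₂ θ : ℝ) : ℂ :=
  Φ (rot θ) * compactPicture F₁ (θ₁ + θ) * conj (compactPicture F₂ (θ₂ + θ))

/-- `H(θ₁, θ₂) = (1/2π) ∫ φ(θ) f̃₁(θ₁ + θ) conj f̃₂(θ₂ + θ) dθ`. -/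
noncomputable def convH (F₁ F₂ Φ : SLpm → ℂ) (θ₁ θ₂ : ℝ) : ℂ :=
  1 / (2 * π) * ∫ θ in (0 : ℝ)..(2 * π), convIntegrand F₁ F₂ Φ θ₁ θ₂ θ

/-- The integrand of the double integral over the circle. -/
noncomputable def circleIntegrand (l₁ l₂ : ℝ) (s : ℂ) (F₁ F₂ Φ : SLpm → ℂ) (θ₁ θ₂ : ℝ) : ℂ :=
  ((|sin (θ₁ - θ₂)| : ℝ) : ℂ) ^ (-uParam l₁ l₂ s) *
    ((|sin θ₁| : ℝ) : ℂ) ^ (-1 + uParam l₁ l₂ s + Complex.I * l₁) *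
    ((|sin θ₂| : ℝ) : ℂ) ^ (-1 + uParam l₁ l₂ s - Complex.I * l₂) *
    convH F₁ F₂ Φ θ₁ θ₂

/-! On `K A` a Whittaker function is a Fourier transform: moving d_a past n_x shows that Wh_f(k_θ
d_a) is a power of |a| times the Fourier transform of x ↦ f(k_θ n_x) at t = 1/(a|a|)
(`LowerHomog.Wh_rot_mul_diag`). Since a takes both signs, t runs over all of ℝ ∖ {0}, and the
a-integral becomes, up to a constant, φ(k_θ) ∫ |t|^(u-1) f̂₁(t) conj f̂₂(t) dt. The Fourier
transform of |t|^(u-1) is G₀(u)|x|^(-u), so this equals G₀(u) times the pairing B of the two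
translated vectors, whose kernel on the line is |x-y|^(-u) (`integral_abs_cpow_mul_limFourier`).
Substituting x = cot θ₁, y = cot θ₂ turns B into the integral over two circles (`circleKernel_cot`),
and Fubini in the three angles gives T.

Convergence and continuity need no smoothness. With σ = Re s the kernel on the circles has modulus
|sin(θ₁-θ₂)|^(-σ) |sin θ₁|^(σ-1) |sin θ₂|^(σ-1). Each exponent is above -1 and their sum is above
-2, so it is integrable even where all three sines vanish (`integrable_kernel_real`). By
Cauchy–Schwarz, H is bounded by a constant times sup|φ| ‖f₁‖ ‖f₂‖, uniformly in the angles.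

For equivariance, g ↦ φ(g) B(g⁻¹f₁, g⁻¹f₂) is a density on G/P (`upperHomog_mul_noncompactPairing`),
T is a constant times its integral over K, and such integrals are invariant under left translation
(`UpperHomog.integral_leftTranslate`). This works directly on L² vectors, with no approximation by
smooth ones.

The delicate point is the Fourier identity, since noncompact pictures decay only like 1/|x|. For
integrable functions, |t|^(u-1) and |x-y|^(-u) are both superpositions of Gaussians, exchanged by
Parseval and τ ↦ 1/τ, with G₀(u) appearing as Γ_ℝ(u)/Γ_ℝ(1-u). Smooth vectors are then reached by
truncation and dominated convergence: an integration by parts bounds all truncated Fourier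
transforms by C_α |t|^(α-1), for every α in [0,1). -/

namespace SLpm

/-! ### Matrix identities and the Iwasawa decomposition. -/

theorem ext_entry {g h : SLpm} (H : ∀ i j, entry g i j = entry h i j) : g = h := by
  apply Subtype.ext
  apply Units.ext
  ext i j
  exact H i j

theorem entry_mul (g h : SLpm) (i j : Fin 2) :
    entry (g * h) i j = entry g i 0 * entry h 0 j + entry g i 1 * entry h 1 j := by
  simp [entry, Matrix.mul_apply, Fin.sum_univ_two]

@[simp] theorem entry_ofMatrix (m : Matrix (Fin 2) (Fin 2) ℝ) (h) (i j : Fin 2) :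
    entry (ofMatrix m h) i j = m i j := rfl

@[simp] theorem entry_one (i j : Fin 2) : entry 1 i j = if i = j then 1 else 0 := by
  simp [entry, Matrix.one_apply]

theorem entry_diag {a : ℝ} (ha : a ≠ 0) (i j : Fin 2) :
    entry (diag a) i j = !![a, 0; 0, |a|⁻¹] i j := by
  simp [diag, ha]

theorem det_entry (g : SLpm) :
    entry g 0 0 * entry g 1 1 - entry g 0 1 * entry g 1 0 = 1 ∨
    entry g 0 0 * entry g 1 1 - entry g 0 1 * entry g 1 0 = -1 := by
  have := g.2
  simpa [SLpm, Matrix.det_fin_two, entry] using this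

theorem rot_add (a b : ℝ) : rot (a + b) = rot a * rot b := by
  apply ext_entry
  intro i j
  fin_cases i <;> fin_cases j <;> simp [entry_mul, rot, cos_add, sin_add] <;> ring

theorem rot_zero : rot 0 = 1 := by
  apply ext_entry
  intro i j
  fin_cases i <;> fin_cases j <;> simp [rot]

theorem rot_neg (a : ℝ) : rot (-a) = (rot a)⁻¹ := by
  rw [eq_inv_iff_mul_eq_one, ← rot_add]; simp [rot_zero]

theorem rot_add_two_pi (a : ℝ) : rot (a + 2 * π) = rot a := by
  apply ext_entry
  intro i j
  fin_cases i <;> fin_cases j <;> simp [rot]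

theorem unip_add (a b : ℝ) : unip (a + b) = unip a * unip b := by
  apply ext_entry
  intro i j
  fin_cases i <;> fin_cases j <;> simp [entry_mul, unip]
  ring

theorem unip_zero : unip 0 = 1 := by
  apply ext_entry
  intro i j
  fin_cases i <;> fin_cases j <;> simp [unip]

theorem unip_neg (a : ℝ) : unip (-a) = (unip a)⁻¹ := by
  rw [eq_inv_iff_mul_eq_one, ← unip_add]; simp [unip_zero]

theorem diag_mul_unip {a : ℝ} (ha : a ≠ 0) (x : ℝ) :
    diag a * unip x = unip (a * |a| * x) * diag a := by
  apply ext_entry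
  have := abs_ne_zero.2 ha
  intro i j
  fin_cases i <;> fin_cases j <;> simp [entry_mul, unip, entry_diag ha]
  field_simp

theorem diag_inv {a : ℝ} (ha : a ≠ 0) : (diag a)⁻¹ = diag a⁻¹ := by
  rw [inv_eq_iff_mul_eq_one]
  apply ext_entry
  have := abs_ne_zero.2 ha
  intro i j
  fin_cases i <;> fin_cases j <;>
    simp [entry_mul, entry_diag ha, entry_diag (inv_ne_zero ha), ha]

/-- The first column of an element of `SL^±(2, ℝ)`, as a complex number. -/
noncomputable def firstCol (g : SLpm) : ℂ := ⟨entry g 0 0, entry g 1 0⟩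

theorem firstCol_ne_zero (g : SLpm) : firstCol g ≠ 0 := by
  intro h
  have h0 : entry g 0 0 = 0 := congrArg Complex.re h
  have h1 : entry g 1 0 = 0 := congrArg Complex.im h
  rcases det_entry g with h | h <;> simp [h0, h1] at h

/-- The Iwasawa decomposition with a prescribed angle. -/
theorem eq_rot_mul_upper (g : SLpm) (r γ : ℝ) (h0 : entry g 0 0 = r * cos γ)
    (h1 : entry g 1 0 = r * sin γ) :
    ∃ p : SLpm, g = rot γ * p ∧ entry p 1 0 = 0 ∧ entry p 0 0 = r := by
  refine ⟨rot (-γ) * g, ?_, ?_, ?_⟩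
  · rw [rot_neg]; group
  · simp [entry_mul, rot, h0, h1]; ring
  · simp [entry_mul, rot, h0, h1]
    linear_combination r * sin_sq_add_cos_sq γ

theorem exists_rot_diag_unip (g : SLpm) : ∃ θ a x : ℝ, a ≠ 0 ∧ g = rot θ * diag a * unip x := by
  set z := firstCol g with hz
  have hz0 : z ≠ 0 := firstCol_ne_zero g
  obtain ⟨p, hp, hp1, hp0⟩ := eq_rot_mul_upper g ‖z‖ z.arg
    (Complex.norm_mul_cos_arg z).symm (Complex.norm_mul_sin_arg z).symm
  have hr : 0 < ‖z‖ := norm_pos_iff.2 hz0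
  set r := ‖z‖
  have hd := det_entry p
  rw [hp1, hp0] at hd
  rcases hd with hd | hd
  · refine ⟨z.arg, r, entry p 0 1 / r, hr.ne', ?_⟩
    rw [hp, mul_assoc]
    congr 1
    apply ext_entry
    intro i j
    fin_cases i <;> fin_cases j <;>
      simp [entry_mul, entry_diag hr.ne', unip, hp0, hp1, abs_of_pos hr]
    · field_simp
    · field_simp; linarith
  -- `diag a` has determinant sign a, so determinant -1 forces a < 0; the shift of the angle by π
  -- restores the sign of the first column.
  · refine ⟨z.arg + π, -r, entry p 0 1 / r, (neg_ne_zero.2 hr.ne'), ?_⟩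
    rw [hp, rot_add, mul_assoc, mul_assoc]
    congr 1
    apply ext_entry
    intro i j
    fin_cases i <;> fin_cases j <;>
      simp [entry_mul, entry_diag (neg_ne_zero.2 hr.ne'), unip, rot, hp0, hp1, abs_of_pos hr]
    · field_simp
    · field_simp; linarith

/-- A property closed under multiplication holds on `SL^±(2, ℝ)` if it holds for the
rotations, the diagonal and the unipotent elements. -/
theorem induction_generators {P : SLpm → Prop} (hmul : ∀ g h, P g → P h → P (g * h))
    (hrot : ∀ θ, P (rot θ)) (hdiag : ∀ a, a ≠ 0 → P (diag a)) (hunip : ∀ x, P (unip x))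
    (g : SLpm) : P g := by
  obtain ⟨θ, a, x, ha, rfl⟩ := exists_rot_diag_unip g
  exact hmul _ _ (hmul _ _ (hrot θ) (hdiag a ha)) (hunip x)

/-- `n_x ∈ k_{-arctan x} P̄`. -/
theorem unip_eq_rot_mul_lower (x : ℝ) :
    ∃ p : SLpm, unip x = rot (-arctan x) * p ∧ entry p 0 1 = 0 ∧
      entry p 0 0 = (√(1 + x ^ 2))⁻¹ := by
  have hx : 0 < √(1 + x ^ 2) := by positivity
  refine ⟨rot (arctan x) * unip x, ?_, ?_, ?_⟩
  · rw [rot_neg]; group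
  · simp [entry_mul, rot, unip, cos_arctan, sin_arctan]; field_simp; ring
  · simp [entry_mul, rot, unip, cos_arctan]

theorem diag_lower {a : ℝ} (ha : a ≠ 0) : entry (diag a) 0 1 = 0 := by simp [entry_diag ha]
theorem diag_upper {a : ℝ} (ha : a ≠ 0) : entry (diag a) 1 0 = 0 := by simp [entry_diag ha]
theorem diag_zero_zero {a : ℝ} (ha : a ≠ 0) : entry (diag a) 0 0 = a := by simp [entry_diag ha]

theorem rot_pi_lower : entry (rot π) 0 1 = 0 := by simp [rot]
theorem rot_pi_zero_zero : entry (rot π) 0 0 = -1 := by simp [rot]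

end SLpm

/-! ### Homogeneous functions on G and smoothness of their translates. -/

@[simp] theorem leftTranslate_apply (g : SLpm) (F : SLpm → ℂ) (h : SLpm) :
    leftTranslate g F h = F (g⁻¹ * h) := rfl

theorem leftTranslate_mul (g h : SLpm) (F : SLpm → ℂ) :
    leftTranslate (g * h) F = leftTranslate g (leftTranslate h F) := by
  funext x; simp [mul_assoc]

/-- `F (g p) = |p₁₁| ^ c F g` for lower triangular `p`. -/
def LowerHomog (c : ℂ) (F : SLpm → ℂ) : Prop :=
  ∀ g p : SLpm, entry p 0 1 = 0 → F (g * p) = ((|entry p 0 0| : ℝ) : ℂ) ^ c * F g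

/-- `F (g p) = |p₁₁| ^ c F g` for upper triangular `p`. -/
def UpperHomog (c : ℂ) (F : SLpm → ℂ) : Prop :=
  ∀ g p : SLpm, entry p 1 0 = 0 → F (g * p) = ((|entry p 0 0| : ℝ) : ℂ) ^ c * F g

theorem LowerHomog.translate {c : ℂ} {F : SLpm → ℂ} (hF : LowerHomog c F) (g : SLpm) :
    LowerHomog c (leftTranslate g F) := fun h p hp => by
  simp [← mul_assoc, hF _ p hp]

theorem UpperHomog.translate {c : ℂ} {F : SLpm → ℂ} (hF : UpperHomog c F) (g : SLpm) :
    UpperHomog c (leftTranslate g F) := fun h p hp => by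
  simp [← mul_assoc, hF _ p hp]

theorem SLpm.entry_weyl_conj (p : SLpm) :
    entry ((rot (π / 2))⁻¹ * p * rot (π / 2)) 0 0 = entry p 1 1 ∧
    entry ((rot (π / 2))⁻¹ * p * rot (π / 2)) 0 1 = -entry p 1 0 ∧
    entry ((rot (π / 2))⁻¹ * p * rot (π / 2)) 1 0 = -entry p 0 1 := by
  rw [← rot_neg]
  refine ⟨?_, ?_, ?_⟩ <;> simp [entry_mul, rot]

theorem SLpm.abs_entry_one_one {p : SLpm} (hp : entry p 0 1 * entry p 1 0 = 0) :
    |entry p 1 1| = |entry p 0 0|⁻¹ := by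
  have hd := det_entry p
  rw [hp, sub_zero] at hd
  have h1 : |entry p 0 0| * |entry p 1 1| = 1 := by
    rw [← abs_mul]; rcases hd with hd | hd <;> simp [hd]
  exact eq_inv_of_mul_eq_one_right h1

theorem Complex.ofReal_inv_cpow {x : ℝ} (hx : 0 ≤ x) (c : ℂ) :
    ((x⁻¹ : ℝ) : ℂ) ^ c = (x : ℂ) ^ (-c) := by
  rw [Complex.ofReal_inv, Complex.inv_cpow, Complex.cpow_neg]
  rw [Complex.arg_ofReal_of_nonneg hx]
  exact pi_pos.ne

/-- Right translation by the Weyl element exchanges the two triangular subgroups. -/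
theorem LowerHomog.upper_weyl {c : ℂ} {F : SLpm → ℂ} (hF : LowerHomog c F) :
    UpperHomog (-c) (fun g => F (g * rot (π / 2))) := by
  intro g p hp
  obtain ⟨h00, h01, -⟩ := entry_weyl_conj p
  have := hF (g * rot (π / 2)) _ (h01.trans (by simp [hp]))
  rw [h00, abs_entry_one_one (by simp [hp]), Complex.ofReal_inv_cpow (abs_nonneg _)] at this
  rw [← this]
  group

theorem UpperHomog.lower_weyl {c : ℂ} {F : SLpm → ℂ} (hF : UpperHomog c F) :
    LowerHomog (-c) (fun g => F (g * rot (π / 2))) := by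
  intro g p hp
  obtain ⟨h00, -, h10⟩ := entry_weyl_conj p
  have := hF (g * rot (π / 2)) _ (h10.trans (by simp [hp]))
  rw [h00, abs_entry_one_one (by simp [hp]), Complex.ofReal_inv_cpow (abs_nonneg _)] at this
  rw [← this]
  group

/-- `rot π` is -I, a lower triangular element with |p₁₁| = 1. -/
theorem LowerHomog.rot_add_pi {c : ℂ} {F : SLpm → ℂ} (hF : LowerHomog c F) (g : SLpm) (θ : ℝ) :
    F (g * rot (θ + π)) = F (g * rot θ) := by
  rw [rot_add, ← mul_assoc, hF _ _ rot_pi_lower, rot_pi_zero_zero]; simp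

theorem LowerHomog.mul_unip {c : ℂ} {F : SLpm → ℂ} (hF : LowerHomog c F) (g : SLpm) (x : ℝ) :
    F (g * unip x) = ((√(1 + x ^ 2) : ℝ) : ℂ) ^ (-c) * F (g * rot (-arctan x)) := by
  obtain ⟨p, hp, hp1, hp0⟩ := unip_eq_rot_mul_lower x
  rw [hp, ← mul_assoc, hF _ _ hp1, hp0]
  congr 1
  rw [abs_of_nonneg (by positivity), Complex.ofReal_inv_cpow (by positivity)]

theorem LowerHomog.mul_diag_unip {c : ℂ} {F : SLpm → ℂ} (hF : LowerHomog c F) (g : SLpm)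
    {a : ℝ} (ha : a ≠ 0) (x : ℝ) :
    F (g * diag a * unip x) = ((|a| : ℝ) : ℂ) ^ c * F (g * unip (a * |a| * x)) := by
  rw [mul_assoc, diag_mul_unip ha, ← mul_assoc, hF _ _ (diag_lower ha), diag_zero_zero ha]

theorem contDiff_entry_mul_rot (g : SLpm) :
    ContDiff ℝ ∞ (fun θ => firstCol (g * rot θ)) := by
  have : (fun θ => firstCol (g * rot θ)) = fun θ =>
      ((entry g 0 0 * cos θ + entry g 0 1 * sin θ : ℝ) : ℂ) +
      ((entry g 1 0 * cos θ + entry g 1 1 * sin θ : ℝ) : ℂ) * Complex.I := by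
    funext θ
    apply Complex.ext <;> simp [firstCol, entry_mul, rot, -Complex.ofReal_add, -Complex.ofReal_mul]
  rw [this]
  exact (Complex.ofRealCLM.contDiff.comp
    (f := fun θ : ℝ => entry g 0 0 * cos θ + entry g 0 1 * sin θ)
    (by fun_prop)).add ((Complex.ofRealCLM.contDiff.comp
    (f := fun θ : ℝ => entry g 1 0 * cos θ + entry g 1 1 * sin θ) (by fun_prop)).mul contDiff_const)

/-- If z(θ) is the first column of `g * rot θ`, then Φ(g k_θ) = ‖z‖^c Φ(k_γ) for any angle γ of z.
The argument of z need not be continuous, so near θ₀ the branch arg z(θ₀) + Im log(z(θ)/z(θ₀)) is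
used: the quotient is 1 at θ₀, where the logarithm is smooth. -/
theorem UpperHomog.contDiff_mul_rot {c : ℂ} {Φ : SLpm → ℂ} (hΦ : UpperHomog c Φ)
    (hs : ContDiff ℝ ∞ (fun θ => Φ (rot θ))) (g : SLpm) :
    ContDiff ℝ ∞ (fun θ => Φ (g * rot θ)) := by
  rw [contDiff_iff_contDiffAt]
  intro θ₀
  set z : ℝ → ℂ := fun θ => firstCol (g * rot θ) with hz
  have hzs : ContDiff ℝ ∞ z := contDiff_entry_mul_rot g
  have hz0 : ∀ θ, z θ ≠ 0 := fun θ => firstCol_ne_zero _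
  have key : ∀ θ, Φ (g * rot θ) =
      Complex.exp ((Real.log ‖z θ‖ : ℂ) * c) *
        Φ (rot ((z θ₀).arg + (Complex.log (z θ / z θ₀)).im)) := by
    intro θ
    have hr : 0 < ‖z θ‖ := norm_pos_iff.2 (hz0 θ)
    have hzz : z θ = ‖z θ‖ * Complex.exp (((z θ₀).arg + (Complex.log (z θ / z θ₀)).im : ℝ) *
        Complex.I) := by
      rw [Complex.log_im]
      push_cast
      rw [add_mul, Complex.exp_add]
      have h1 := Complex.norm_mul_exp_arg_mul_I (z θ₀)
      have h2 := Complex.norm_mul_exp_arg_mul_I (z θ / z θ₀)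
      rw [norm_div] at h2
      have h3 : (‖z θ₀‖ : ℂ) ≠ 0 := by simpa using hz0 θ₀
      calc z θ = z θ₀ * (z θ / z θ₀) := by field_simp [hz0 θ₀]
        _ = _ := by
          have h4 : (‖z θ₀‖ : ℂ) * (‖z θ‖ / ‖z θ₀‖) = ‖z θ‖ := by field_simp
          push_cast at h2
          linear_combination (-(z θ / z θ₀)) * h1 -
            ‖z θ₀‖ * Complex.exp ((z θ₀).arg * Complex.I) * h2 +
            Complex.exp ((z θ₀).arg * Complex.I) *
              Complex.exp ((z θ / z θ₀).arg * Complex.I) * h4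
    obtain ⟨p, hp, hp1, hp0⟩ := eq_rot_mul_upper (g * rot θ) ‖z θ‖
      ((z θ₀).arg + (Complex.log (z θ / z θ₀)).im)
      (by
        have := congrArg Complex.re hzz
        rw [Complex.re_ofReal_mul, Complex.exp_ofReal_mul_I_re] at this
        exact this)
      (by
        have := congrArg Complex.im hzz
        rw [Complex.im_ofReal_mul, Complex.exp_ofReal_mul_I_im] at this
        exact this)
    conv_lhs => rw [hp]
    rw [hΦ _ _ hp1, hp0, abs_of_pos hr, Complex.cpow_def_of_ne_zero (by exact_mod_cast hr.ne'),
      Complex.ofReal_log hr.le]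
  simp_rw [key]
  apply ContDiffAt.mul
  · apply ContDiffAt.cexp
    apply ContDiffAt.mul _ contDiffAt_const
    exact Complex.ofRealCLM.contDiff.contDiffAt.comp θ₀ (f := fun θ => Real.log ‖z θ‖)
      ((hzs.contDiffAt.norm ℝ (hz0 _)).log (norm_ne_zero_iff.2 (hz0 _)))
  · apply hs.contDiffAt.comp θ₀ (f := fun θ => (z θ₀).arg + (Complex.log (z θ / z θ₀)).im)
    apply contDiffAt_const.add
    have : ContDiffAt ℝ ∞ Complex.log (z θ₀ / z θ₀) := by
      apply (Complex.contDiffAt_log (n := ∞) _).restrict_scalars ℝ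
      rw [div_self (hz0 _)]
      exact Complex.one_mem_slitPlane
    exact Complex.imCLM.contDiff.contDiffAt.comp θ₀ (f := fun θ => Complex.log (z θ / z θ₀))
      (ContDiffAt.comp (f := fun θ => z θ / z θ₀) θ₀ this (hzs.contDiffAt.div_const _))

/-- Follows from the upper triangular case: right translation by the Weyl element only shifts θ by
π/2. -/
theorem LowerHomog.contDiff_mul_rot {c : ℂ} {F : SLpm → ℂ} (hF : LowerHomog c F)
    (hs : ContDiff ℝ ∞ (fun θ => F (rot θ))) (g : SLpm) :
    ContDiff ℝ ∞ (fun θ => F (g * rot θ)) := by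
  have h1 : ContDiff ℝ ∞ (fun θ => F (rot θ * rot (π / 2))) := by
    simp_rw [← rot_add]
    exact hs.comp (contDiff_id.add contDiff_const)
  have h2 := (hF.upper_weyl.contDiff_mul_rot h1 g).comp
    (contDiff_id.sub contDiff_const : ContDiff ℝ ∞ (fun θ : ℝ => θ - π / 2))
  have e : (fun θ => F (g * rot θ)) =
      (fun θ => F (g * rot θ * rot (π / 2))) ∘ fun θ : ℝ => θ - π / 2 := by
    funext θ
    simp [mul_assoc, ← rot_add]
  rw [e]
  exact h2

/-! ### Comparison of the compact and noncompact pictures. -/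

theorem measurableEmbedding_neg_arctan : MeasurableEmbedding (fun x : ℝ => -arctan x) :=
  (by fun_prop : Continuous fun x : ℝ => -arctan x).measurableEmbedding
    fun _ _ h => arctan_injective (neg_injective h)

theorem image_neg_arctan : (fun x : ℝ => -arctan x) '' univ = Ioo (-(π / 2)) (π / 2) := by
  have : (fun x : ℝ => -arctan x) = Neg.neg ∘ arctan := rfl
  rw [this, image_comp, image_univ, range_arctan]
  simp

theorem hasDerivWithinAt_neg_arctan (x : ℝ) :
    HasDerivWithinAt (fun x : ℝ => -arctan x) (-(1 / (1 + x ^ 2))) univ x :=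
  (hasDerivAt_arctan x).neg.hasDerivWithinAt

theorem abs_deriv_neg_arctan (x : ℝ) : |-(1 / (1 + x ^ 2))| = (1 + x ^ 2)⁻¹ := by
  rw [abs_neg, one_div, abs_of_pos (by positivity)]

theorem integral_comp_neg_arctan {E : Type*} [NormedAddCommGroup E] [NormedSpace ℝ E] (h : ℝ → E) :
    ∫ θ in -(π / 2)..π / 2, h θ = ∫ x : ℝ, (1 + x ^ 2)⁻¹ • h (-arctan x) := by
  have := integral_image_eq_integral_abs_deriv_smul MeasurableSet.univ
    (fun x _ => hasDerivWithinAt_neg_arctan x) measurableEmbedding_neg_arctan.injective.injOn h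
  rw [image_neg_arctan] at this
  rw [intervalIntegral.integral_of_le (by linarith [pi_pos]), integral_Ioc_eq_integral_Ioo, this]
  simp only [abs_deriv_neg_arctan, Measure.restrict_univ]

theorem integrableOn_comp_neg_arctan {E : Type*} [NormedAddCommGroup E] [NormedSpace ℝ E]
    (h : ℝ → E) : IntegrableOn h (Ioo (-(π / 2)) (π / 2)) ↔
      Integrable (fun x : ℝ => (1 + x ^ 2)⁻¹ • h (-arctan x)) := by
  have := integrableOn_image_iff_integrableOn_abs_deriv_smul MeasurableSet.univ
    (fun x _ => hasDerivWithinAt_neg_arctan x) measurableEmbedding_neg_arctan.injective.injOn h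
  rw [image_neg_arctan] at this
  rw [this, integrableOn_univ]
  simp only [abs_deriv_neg_arctan]

/-- Lebesgue measure on the interval is the image of (1 + x²)⁻¹ dx, whose density is positive, so
both measures on the line have the same null sets. -/
theorem aestronglyMeasurable_comp_neg_arctan {E : Type*} [NormedAddCommGroup E] (h : ℝ → E) :
    AEStronglyMeasurable h (volume.restrict (Ioo (-(π / 2)) (π / 2))) ↔
      AEStronglyMeasurable (fun x : ℝ => h (-arctan x)) := by
  have hmap := map_withDensity_abs_det_fderiv_eq_addHaar volume MeasurableSet.univ.nullMeasurableSet
    (fun x _ => (hasDerivWithinAt_neg_arctan x).hasFDerivWithinAt)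
    measurableEmbedding_neg_arctan.injective.injOn
  rw [image_neg_arctan] at hmap
  rw [← hmap, measurableEmbedding_neg_arctan.aestronglyMeasurable_map_iff]
  simp only [Measure.restrict_univ]
  constructor
  · refine fun H => H.mono_ac (withDensity_absolutelyContinuous' ?_ ?_)
    · apply Measurable.aemeasurable
      simp only [ContinuousLinearMap.det_toSpanSingleton]
      fun_prop
    · refine Eventually.of_forall fun x => ?_
      simp only [ContinuousLinearMap.det_toSpanSingleton, abs_deriv_neg_arctan]
      simp only [ne_eq, ENNReal.ofReal_eq_zero, not_le]
      positivity
  · exact fun H => H.mono_ac (withDensity_absolutelyContinuous _ _)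

/-- A periodic function that is a.e. strongly measurable on a period is so on the line. -/
theorem Function.Periodic.aestronglyMeasurable {E : Type*} [NormedAddCommGroup E] {h : ℝ → E}
    {T : ℝ} (hT : 0 < T) (hp : Function.Periodic h T) {a : ℝ}
    (hm : AEStronglyMeasurable h (volume.restrict (Ioc a (a + T)))) : AEStronglyMeasurable h := by
  rw [← Measure.restrict_univ (μ := volume), ← iUnion_Ioc_add_zsmul hT a]
  rw [aestronglyMeasurable_iUnion_iff]
  intro n
  have h1 : MeasurePreserving (fun x : ℝ => x - n • T)
      (volume.restrict (Ioc (a + n • T) (a + (n + 1) • T))) (volume.restrict (Ioc a (a + T))) := by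
    have := (measurePreserving_sub_right volume (n • T)).restrict_preimage
      (measurableSet_Ioc (a := a) (b := a + T))
    convert this using 2
    ext x
    simp only [mem_Ioc, mem_preimage, add_smul, one_smul]
    constructor <;> rintro ⟨h1, h2⟩ <;> constructor <;> linarith
  have h2 := hm.comp_measurePreserving h1
  refine h2.congr (Eventually.of_forall fun x => ?_)
  exact hp.sub_zsmul_eq n

theorem Function.Periodic.memLp_two_period_iff {h : ℝ → ℂ} (hp : Function.Periodic h π) :
    MemLp h 2 periodMeasure ↔ MemLp h 2 (volume.restrict (Ioo (-(π / 2)) (π / 2))) := by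
  have hp2 : Function.Periodic h (2 * π) := by simpa using hp.nat_mul 2
  have hn : Function.Periodic (fun θ => ‖h θ‖ ^ 2) π := fun θ => by simp [hp θ]
  have hn2 : Function.Periodic (fun θ => ‖h θ‖ ^ 2) (2 * π) := fun θ => by simp [hp2 θ]
  have key : ∀ a b : ℝ, a ≤ b → AEStronglyMeasurable h →
      (∀ s t, IntervalIntegrable (fun θ => ‖h θ‖ ^ 2) volume s t) →
      MemLp h 2 (volume.restrict (Ioc a b)) := by
    intro a b hab hm hi
    rw [memLp_two_iff_integrable_sq_norm hm.restrict]
    exact (intervalIntegrable_iff_integrableOn_Ioc_of_le hab).1 (hi a b)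
  rw [← Measure.restrict_congr_set Ioo_ae_eq_Ioc.symm]
  constructor
  · intro H
    apply key _ _ (by linarith [pi_pos])
    · apply hp2.aestronglyMeasurable two_pi_pos (a := 0)
      simpa [periodMeasure] using H.1
    · intro s t
      apply hn2.intervalIntegrable₀ two_pi_pos.ne'
      rw [intervalIntegrable_iff_integrableOn_Ioc_of_le two_pi_pos.le]
      exact (memLp_two_iff_integrable_sq_norm H.1).1 H
  · intro H
    have e : -(π / 2) + π = π / 2 := by ring
    apply key _ _ (by linarith [pi_pos])
    · apply hp.aestronglyMeasurable pi_pos (a := -(π / 2))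
      rw [e]
      exact H.1
    · intro s t
      apply hn.intervalIntegrable pi_pos.ne' (t := -(π / 2))
      rw [e, intervalIntegrable_iff_integrableOn_Ioc_of_le (by linarith [pi_pos])]
      exact (memLp_two_iff_integrable_sq_norm H.1).1 H

theorem Function.Periodic.integral_two_pi {E : Type*} [NormedAddCommGroup E] [NormedSpace ℝ E]
    {h : ℝ → E} (hp : Function.Periodic h π) :
    ∫ θ in 0..2 * π, h θ = (2 : ℝ) • ∫ x : ℝ, (1 + x ^ 2)⁻¹ • h (-arctan x) := by
  have e : -(π / 2) + π = π / 2 := by ring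
  rw [← integral_comp_neg_arctan]
  by_cases hi : IntervalIntegrable h volume 0 π
  · have hi' := hp.intervalIntegrable₀ pi_pos.ne' hi
    have h1 := hp.intervalIntegral_add_zsmul_eq 2 0 hi'
    have h2 := hp.intervalIntegral_add_eq 0 (-(π / 2))
    rw [e] at h2
    rw [h2] at h1
    simpa [two_smul, two_mul] using h1
  -- Without integrability on one period, neither integral exists and both take the value 0; hence
  -- the lemma needs no integrability hypothesis.
  · rw [intervalIntegral.integral_undef, intervalIntegral.integral_undef, smul_zero]
    · intro h1
      apply hi
      have := hp.intervalIntegrable pi_pos.ne' (t := -(π / 2)) (by rw [e]; exact h1) 0 π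
      exact this
    · intro h1
      apply hi
      refine h1.mono_set ?_
      rw [uIcc_of_le pi_pos.le, uIcc_of_le two_pi_pos.le]
      exact Icc_subset_Icc le_rfl (by linarith [pi_pos])

theorem norm_ofReal_cpow_neg {c : ℂ} (hc : c.re = 1) (x : ℝ) :
    ‖((√(1 + x ^ 2) : ℝ) : ℂ) ^ (-c)‖ = (√(1 + x ^ 2))⁻¹ := by
  rw [Complex.norm_cpow_eq_rpow_re_of_pos (by positivity), Complex.neg_re, hc,
    Real.rpow_neg_one]

theorem continuous_ofReal_sqrt_cpow (c : ℂ) :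
    Continuous (fun x : ℝ => ((√(1 + x ^ 2) : ℝ) : ℂ) ^ c) := by
  rw [continuous_iff_continuousAt]
  intro x
  apply ContinuousAt.cpow (by fun_prop) (by fun_prop)
  left
  simp only [Complex.ofReal_re]
  positivity

/-- The compact and the noncompact `L²` conditions agree. -/
theorem LowerHomog.memLp_iff {c : ℂ} (hc : c.re = 1) {F : SLpm → ℂ} (hF : LowerHomog c F) :
    MemLp (fun θ => F (rot θ)) 2 periodMeasure ↔ MemLp (fun x => F (unip x)) 2 := by
  have hp : Function.Periodic (fun θ => F (rot θ)) π := fun θ => by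
    simpa using hF.rot_add_pi 1 θ
  have hu : ∀ x, F (unip x) = ((√(1 + x ^ 2) : ℝ) : ℂ) ^ (-c) * F (rot (-arctan x)) := fun x => by
    simpa using hF.mul_unip 1 x
  have hne : ∀ x : ℝ, ((√(1 + x ^ 2) : ℝ) : ℂ) ^ (-c) ≠ 0 := fun x => by
    rw [← norm_ne_zero_iff, norm_ofReal_cpow_neg hc]; positivity
  have hm : AEStronglyMeasurable (fun x => F (unip x)) ↔
      AEStronglyMeasurable (fun x => F (rot (-arctan x))) := by
    constructor
    · intro H
      have := ((continuous_ofReal_sqrt_cpow (-c)).inv₀ hne).aestronglyMeasurable (μ := volume).mul H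
      refine this.congr (Eventually.of_forall fun x => ?_)
      simp only [Pi.mul_apply, Pi.inv_apply]
      rw [hu, inv_mul_cancel_left₀ (hne x)]
    · intro H
      simp_rw [hu]
      exact (continuous_ofReal_sqrt_cpow (-c)).aestronglyMeasurable.mul H
  rw [hp.memLp_two_period_iff]
  have hn : ∀ x, ‖F (unip x)‖ ^ 2 = (1 + x ^ 2)⁻¹ • ‖F (rot (-arctan x))‖ ^ 2 := by
    intro x
    rw [hu, norm_mul, norm_ofReal_cpow_neg hc, mul_pow, inv_pow, Real.sq_sqrt (by positivity),
      smul_eq_mul]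
  constructor
  · intro H
    have h1 := hm.2 ((aestronglyMeasurable_comp_neg_arctan _).1 H.1)
    rw [memLp_two_iff_integrable_sq_norm h1]
    simp_rw [hn]
    exact (integrableOn_comp_neg_arctan (fun θ => ‖F (rot θ)‖ ^ 2)).1
      ((memLp_two_iff_integrable_sq_norm H.1).1 H)
  · intro H
    have h1 := (aestronglyMeasurable_comp_neg_arctan (fun θ => F (rot θ))).2 (hm.1 H.1)
    rw [memLp_two_iff_integrable_sq_norm h1]
    have h2 := (memLp_two_iff_integrable_sq_norm H.1).1 H
    simp_rw [hn] at h2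
    exact (integrableOn_comp_neg_arctan (fun θ => ‖F (rot θ)‖ ^ 2)).2 h2

theorem memLp_comp_mul_left {f : ℝ → ℂ} (hf : MemLp f 2) {b : ℝ} (hb : b ≠ 0) :
    MemLp (fun x => f (b * x)) 2 := by
  have h0 : AEStronglyMeasurable (fun x => f (b * x)) := by
    apply hf.1.comp_quasiMeasurePreserving (f := fun x : ℝ => b * x)
    refine ⟨by fun_prop, ?_⟩
    rw [Real.map_volume_mul_left hb]
    exact Measure.smul_absolutelyContinuous
  rw [memLp_two_iff_integrable_sq_norm h0]
  exact ((memLp_two_iff_integrable_sq_norm hf.1).1 hf).comp_mul_left' hb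

/-- It suffices to treat generators. Rotations translate the compact picture; diagonal and unipotent
elements dilate and translate the noncompact one. `F` is quantified inside the induction because the
product step applies the hypothesis to a translate. -/
theorem memLp_leftTranslate {c : ℂ} (hc : c.re = 1) (g : SLpm) : ∀ {F : SLpm → ℂ},
    LowerHomog c F → MemLp (fun θ => F (rot θ)) 2 periodMeasure →
    MemLp (fun θ => leftTranslate g F (rot θ)) 2 periodMeasure := by
  induction g using induction_generators with
  | hmul g h hg hh =>
    intro F hF hm
    rw [leftTranslate_mul]
    exact hg (hF.translate h) (hh hF hm)
  | hrot α =>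
    intro F hF hm
    have hp2 : Function.Periodic (fun θ => F (rot θ)) (2 * π) := fun θ => by
      simp [rot_add_two_pi]
    have hn2 : Function.Periodic (fun θ => ‖F (rot θ)‖ ^ 2) (2 * π) := fun θ => by
      simp [rot_add_two_pi]
    simp only [leftTranslate_apply, ← rot_neg, ← rot_add]
    have h0 : AEStronglyMeasurable (fun θ => F (rot θ)) :=
      hp2.aestronglyMeasurable two_pi_pos (a := 0) (by simpa [periodMeasure] using hm.1)
    have h1 : AEStronglyMeasurable (fun θ => F (rot (-α + θ))) :=
      h0.comp_measurePreserving (measurePreserving_add_left volume (-α))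
    rw [periodMeasure, memLp_two_iff_integrable_sq_norm h1.restrict]
    have h2 : IntervalIntegrable (fun θ => ‖F (rot θ)‖ ^ 2) volume 0 (2 * π) := by
      rw [intervalIntegrable_iff_integrableOn_Ioc_of_le two_pi_pos.le]
      exact (memLp_two_iff_integrable_sq_norm hm.1).1 hm
    have h3 := (hn2.intervalIntegrable₀ two_pi_pos.ne' h2 (-α) (-α + 2 * π)).comp_add_left (c := -α)
    rw [← IntegrableOn, ← intervalIntegrable_iff_integrableOn_Ioc_of_le two_pi_pos.le]
    simpa using h3
  | hdiag a ha =>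
    intro F hF hm
    rw [(hF.translate _).memLp_iff hc]
    have h1 := (hF.memLp_iff hc).1 hm
    have h2 := memLp_comp_mul_left h1 (b := a⁻¹ * |a⁻¹|) (by simp [ha])
    convert h2.const_mul (((|a⁻¹| : ℝ) : ℂ) ^ c) using 1
    funext x
    have := hF.mul_diag_unip 1 (inv_ne_zero ha) x
    simpa [diag_inv ha] using this
  | hunip y =>
    intro F hF hm
    rw [(hF.translate _).memLp_iff hc]
    have h1 := (hF.memLp_iff hc).1 hm
    simp only [leftTranslate_apply, ← unip_neg, ← unip_add]
    exact h1.comp_measurePreserving (measurePreserving_add_left volume (-y))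

/-! ### Invariant integration of densities. -/

/-- The integral over `K` of a function on `G / P̄` that transforms like a density, in the
noncompact picture. -/
theorem LowerHomog.integral_rot {Ψ : SLpm → ℂ} (hΨ : LowerHomog 2 Ψ) :
    ∫ θ in 0..2 * π, Ψ (rot θ) = 2 * ∫ x : ℝ, Ψ (unip x) := by
  have hp : Function.Periodic (fun θ => Ψ (rot θ)) π := fun θ => by
    simpa using hΨ.rot_add_pi 1 θ
  rw [hp.integral_two_pi, Complex.real_smul]
  congr 1
  refine integral_congr_ae (Eventually.of_forall fun x => ?_)
  have := hΨ.mul_unip 1 x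
  simp only [one_mul] at this
  simp only [this, Complex.real_smul]
  congr 1
  rw [Complex.cpow_neg]
  norm_cast
  rw [Real.sq_sqrt (by positivity)]

/-- The degree 2 is what makes the factor |a|⁻² from homogeneity cancel the Jacobian of x ↦
a⁻¹|a⁻¹|x; unipotent elements act by translations of the line and rotations by translations of the
circle. -/
theorem LowerHomog.integral_leftTranslate (g : SLpm) : ∀ {Ψ : SLpm → ℂ}, LowerHomog 2 Ψ →
    ∫ θ in 0..2 * π, leftTranslate g Ψ (rot θ) = ∫ θ in 0..2 * π, Ψ (rot θ) := by
  induction g using induction_generators with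
  | hmul g h hg hh =>
    intro F hF
    rw [leftTranslate_mul, hg (hF.translate h), hh hF]
  | hrot α =>
    intro F hF
    have hp2 : Function.Periodic (fun θ => F (rot θ)) (2 * π) := fun θ => by
      simp [rot_add_two_pi]
    simp only [leftTranslate_apply, ← rot_neg, ← rot_add]
    rw [intervalIntegral.integral_comp_add_left (fun θ => F (rot θ)) (-α), add_zero]
    have := hp2.intervalIntegral_add_eq (-α) 0
    simpa using this
  | hdiag a ha =>
    intro F hF
    rw [(hF.translate _).integral_rot, hF.integral_rot]
    congr 1
    have h1 : ∀ x, leftTranslate (diag a) F (unip x) =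
        ((|a⁻¹| : ℝ) : ℂ) ^ (2 : ℂ) * F (unip (a⁻¹ * |a⁻¹| * x)) := fun x => by
      have := hF.mul_diag_unip 1 (inv_ne_zero ha) x
      simpa [diag_inv ha] using this
    simp_rw [h1]
    rw [integral_const_mul, Measure.integral_comp_mul_left (fun x => F (unip x)), Complex.real_smul,
      ← mul_assoc]
    convert one_mul _
    have := abs_ne_zero.2 ha
    simp only [abs_inv, abs_mul, abs_abs]
    norm_cast
    field_simp
  | hunip y =>
    intro F hF
    rw [(hF.translate _).integral_rot, hF.integral_rot]
    congr 1
    simp only [leftTranslate_apply, ← unip_neg, ← unip_add]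
    exact integral_add_left_eq_self (fun x => F (unip x)) (-y)

/-- Right translation by the Weyl element shifts the circle by π/2, which preserves the integral,
and turns the density on G/P into one on G/P̄. -/
theorem UpperHomog.integral_leftTranslate {Ψ : SLpm → ℂ} (hΨ : UpperHomog (-2) Ψ) (g : SLpm) :
    ∫ θ in 0..2 * π, leftTranslate g Ψ (rot θ) = ∫ θ in 0..2 * π, Ψ (rot θ) := by
  have h : ∀ Ψ' : SLpm → ℂ,
      ∫ θ in 0..2 * π, Ψ' (rot θ) = ∫ θ in 0..2 * π, Ψ' (rot θ * rot (π / 2)) := by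
    intro Ψ'
    have hp2 : Function.Periodic (fun θ => Ψ' (rot θ)) (2 * π) := fun θ => by
      simp [rot_add_two_pi]
    have := hp2.intervalIntegral_add_eq (π / 2) 0
    simp_rw [← rot_add]
    rw [intervalIntegral.integral_comp_add_right (fun θ => Ψ' (rot θ))]
    simp only [zero_add] at this ⊢
    rw [← this, add_comm]
  rw [h, h]
  have := hΨ.lower_weyl
  rw [neg_neg] at this
  rw [← this.integral_leftTranslate g]
  simp [mul_assoc]

/-! ### The representations of G. -/

/-- Left translation as a representation on a subspace that it preserves. -/
def leftTranslateRep (S : Submodule ℂ (SLpm → ℂ)) (hS : ∀ g, ∀ F ∈ S, leftTranslate g F ∈ S) :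
    Representation ℂ SLpm S where
  toFun g :=
    { toFun := fun F => ⟨leftTranslate g F, hS g F F.2⟩
      map_add' := fun _ _ => rfl
      map_smul' := fun _ _ => rfl }
  map_one' := by
    refine LinearMap.ext fun F => Subtype.ext (funext fun x => ?_)
    change F.1 (1⁻¹ * x) = F.1 x
    simp
  map_mul' g h := by
    refine LinearMap.ext fun F => Subtype.ext (funext fun x => ?_)
    change F.1 ((g * h)⁻¹ * x) = F.1 (h⁻¹ * (g⁻¹ * x))
    simp [mul_assoc]

theorem unitarySeries_lowerHomog {l : ℝ} (F : UnitarySeries l) :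
    LowerHomog (Complex.I * l + 1) F.1 := F.2.1

theorem smoothSeries_upperHomog {u : ℂ} (Φ : SmoothSeries u) :
    UpperHomog (-(u + 1)) Φ.1 := Φ.2.1

theorem leftTranslate_mem_unitarySeries {l : ℝ} (g : SLpm) (F : SLpm → ℂ)
    (hF : F ∈ unitarySeriesSubmodule l) : leftTranslate g F ∈ unitarySeriesSubmodule l :=
  ⟨LowerHomog.translate hF.1 g, memLp_leftTranslate (by simp) g hF.1 hF.2⟩

theorem leftTranslate_mem_smoothSeries {u : ℂ} (g : SLpm) (F : SLpm → ℂ)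
    (hF : F ∈ smoothSeriesSubmodule u) : leftTranslate g F ∈ smoothSeriesSubmodule u :=
  ⟨UpperHomog.translate hF.1 g, UpperHomog.contDiff_mul_rot hF.1 hF.2 g⁻¹⟩

/-- The representation of `G` on `𝒫(iℓ, +)_e`. -/
noncomputable def unitaryRep (l : ℝ) : Representation ℂ SLpm (UnitarySeries l) :=
  leftTranslateRep (unitarySeriesSubmodule l) leftTranslate_mem_unitarySeries

/-- The representation of `G` on `𝒫(u, +)_e^∞`. -/
noncomputable def smoothRep (u : ℂ) : Representation ℂ SLpm (SmoothSeries u) :=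
  leftTranslateRep (smoothSeriesSubmodule u) leftTranslate_mem_smoothSeries

instance : IsFiniteMeasure periodMeasure := by unfold periodMeasure; infer_instance

/-! ### Absolute integrability of the kernel on two circles. -/

theorem Function.Periodic.integrable_periodMeasure_comp_add {E : Type*} [NormedAddCommGroup E]
    {f : ℝ → E} (hf : Function.Periodic f (2 * π)) (hi : Integrable f periodMeasure) (a : ℝ) :
    Integrable (fun θ => f (a + θ)) periodMeasure := by
  have h2 : IntervalIntegrable f volume 0 (2 * π) := by
    rwa [intervalIntegrable_iff_integrableOn_Ioc_of_le two_pi_pos.le]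
  have h3 := (hf.intervalIntegrable₀ two_pi_pos.ne' h2 a (a + 2 * π)).comp_add_left (c := a)
  rw [periodMeasure, ← IntegrableOn,
    ← intervalIntegrable_iff_integrableOn_Ioc_of_le two_pi_pos.le]
  simpa using h3

theorem Function.Periodic.exists_norm_le {E : Type*} [NormedAddCommGroup E] {f : ℝ → E} {T : ℝ}
    (hf : Function.Periodic f T) (hT : 0 < T) (hc : Continuous f) :
    ∃ S, 0 ≤ S ∧ ∀ θ, ‖f θ‖ ≤ S := by
  obtain ⟨S, hS⟩ := (isCompact_Icc (a := 0) (b := T)).exists_bound_of_continuousOn hc.continuousOn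
  have hS' : ∀ θ, ‖f θ‖ ≤ S := fun θ => by
    obtain ⟨y, hy, h⟩ := hf.exists_mem_Ico₀ hT θ
    rw [h]
    exact hS y ⟨hy.1, hy.2.le⟩
  exact ⟨S, (norm_nonneg _).trans (hS' 0), hS'⟩

theorem integral_periodMeasure {E : Type*} [NormedAddCommGroup E] [NormedSpace ℝ E] (f : ℝ → E) :
    ∫ θ, f θ ∂periodMeasure = ∫ θ in 0..2 * π, f θ := by
  rw [intervalIntegral.integral_of_le two_pi_pos.le, periodMeasure]

theorem Function.Periodic.integral_periodMeasure_comp_add {E : Type*} [NormedAddCommGroup E]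
    [NormedSpace ℝ E] {f : ℝ → E} (hf : Function.Periodic f (2 * π)) (a : ℝ) :
    ∫ θ, f (a + θ) ∂periodMeasure = ∫ θ, f θ ∂periodMeasure := by
  rw [integral_periodMeasure, integral_periodMeasure, intervalIntegral.integral_comp_add_left]
  simpa using hf.intervalIntegral_add_eq a 0

/-- After a shift to the cosine, θ = -arctan x turns the integrand into (1 + x²)^(-(2-a)/2),
integrable on the line since 2 - a > 1. -/
theorem integrable_abs_sin_rpow {a : ℝ} (ha : a < 1) :
    Integrable (fun θ => |sin θ| ^ (-a)) periodMeasure := by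
  have hper : Function.Periodic (fun θ => |cos θ| ^ (-a)) π := fun θ => by simp
  have hper2 : Function.Periodic (fun θ => |cos θ| ^ (-a)) (2 * π) := fun θ => by simp
  have h1 : IntegrableOn (fun θ => |cos θ| ^ (-a)) (Ioo (-(π / 2)) (π / 2)) := by
    rw [integrableOn_comp_neg_arctan]
    have := integrable_rpow_neg_one_add_norm_sq (E := ℝ) (μ := volume) (r := 2 - a)
      (by simp; linarith)
    refine this.congr (Eventually.of_forall fun x => ?_)
    have hx : 0 < 1 + x ^ 2 := by positivity
    simp only [cos_neg, cos_arctan, norm_eq_abs, sq_abs, smul_eq_mul]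
    rw [abs_of_pos (by positivity), one_div, Real.inv_rpow (by positivity),
      Real.rpow_neg (by positivity), inv_inv, Real.sqrt_eq_rpow, ← Real.rpow_mul hx.le,
      ← Real.rpow_neg_one, ← Real.rpow_add hx]
    congr 1; ring
  have h2 : IntervalIntegrable (fun θ => |cos θ| ^ (-a)) volume (-(π / 2)) (-(π / 2) + π) := by
    rw [show -(π / 2) + π = π / 2 by ring, intervalIntegrable_iff_integrableOn_Ioo_of_le
      (by linarith [pi_pos])]
    exact h1
  have h3 := hper.intervalIntegrable pi_pos.ne' h2 0 (2 * π)
  rw [intervalIntegrable_iff_integrableOn_Ioc_of_le two_pi_pos.le] at h3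
  refine (hper2.integrable_periodMeasure_comp_add h3 (-(π / 2))).congr
    (Eventually.of_forall fun θ => ?_)
  have : cos (-(π / 2) + θ) = sin θ := by
    rw [show -(π / 2) + θ = θ - π / 2 by ring, cos_sub_pi_div_two]
  simp only [this]

/-- Moving part of a negative exponent to a smaller base increases the product: all of e₃ moves from
`M` to `n`, then a - e₁ moves from `n` to `m`. -/
theorem rpow_mul_le_of_ordered {m n M e₁ e₂ e₃ a b : ℝ} (hm : 0 < m) (hmn : m ≤ n) (hnM : n ≤ M)
    (h₃ : 0 ≤ e₃) (ha : e₁ ≤ a) (hsum : e₁ + e₂ + e₃ = a + b) :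
    m ^ (-e₁) * n ^ (-e₂) * M ^ (-e₃) ≤ m ^ (-a) * n ^ (-b) := by
  have hn : 0 < n := hm.trans_le hmn
  have h1 : M ^ (-e₃) ≤ n ^ (-e₃) := Real.rpow_le_rpow_of_nonpos hn hnM (by linarith)
  have h2 : n ^ (-(a - e₁)) ≤ m ^ (-(a - e₁)) :=
    Real.rpow_le_rpow_of_nonpos hm hmn (by linarith)
  calc m ^ (-e₁) * n ^ (-e₂) * M ^ (-e₃) ≤ m ^ (-e₁) * n ^ (-e₂) * n ^ (-e₃) := by gcongr
    _ = m ^ (-e₁) * n ^ (-(a - e₁)) * n ^ (-b) := by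
      rw [mul_assoc, mul_assoc, ← Real.rpow_add hn, ← Real.rpow_add hn]
      congr 2; linarith
    _ ≤ m ^ (-e₁) * m ^ (-(a - e₁)) * n ^ (-b) := by gcongr
    _ = _ := by rw [← Real.rpow_add hm]; congr 2; ring

/-- A product of three negative powers is dominated by products of two, with exponents that can
be prescribed subject to homogeneity. -/
theorem rpow_triple_le {A B C σ a b : ℝ} (hA : 0 ≤ A) (hB : 0 ≤ B) (hC : 0 ≤ C)
    (h0 : 0 < σ) (h1 : σ < 1) (ha : σ ≤ a) (ha' : 1 - σ ≤ a) (hab : a + b = 2 - σ) :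
    A ^ (-σ) * B ^ (-(1 - σ)) * C ^ (-(1 - σ)) ≤
      (A ^ (-a) * B ^ (-b) + B ^ (-a) * A ^ (-b)) + (A ^ (-a) * C ^ (-b) + C ^ (-a) * A ^ (-b)) +
        (B ^ (-a) * C ^ (-b) + C ^ (-a) * B ^ (-b)) := by
  have n1 : 0 ≤ A ^ (-a) * B ^ (-b) := by positivity
  have n2 : 0 ≤ B ^ (-a) * A ^ (-b) := by positivity
  have n3 : 0 ≤ A ^ (-a) * C ^ (-b) := by positivity
  have n4 : 0 ≤ C ^ (-a) * A ^ (-b) := by positivity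
  have n5 : 0 ≤ B ^ (-a) * C ^ (-b) := by positivity
  have n6 : 0 ≤ C ^ (-a) * B ^ (-b) := by positivity
  -- A zero base raised to a nonzero power is 0 by convention, so the left side vanishes.
  rcases hA.eq_or_lt with rfl | hA
  · rw [Real.zero_rpow (by linarith : -σ ≠ 0)]; linarith
  rcases hB.eq_or_lt with rfl | hB
  · rw [Real.zero_rpow (by linarith : -(1 - σ) ≠ 0)]; linarith
  rcases hC.eq_or_lt with rfl | hC
  · rw [Real.zero_rpow (by linarith : -(1 - σ) ≠ 0)]; linarith
  -- In each ordering the smallest base receives the exponent -a, the middle one -b, and the largest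
  -- disappears.
  rcases le_total A B with hAB | hAB <;> rcases le_total B C with hBC | hBC <;>
    rcases le_total A C with hAC | hAC
  · linarith [rpow_mul_le_of_ordered (e₁ := σ) (e₂ := 1 - σ) (e₃ := 1 - σ) (a := a) (b := b)
      hA hAB hBC (by linarith) ha (by linarith)]
  · linarith [rpow_mul_le_of_ordered (e₁ := σ) (e₂ := 1 - σ) (e₃ := 1 - σ) (a := a) (b := b)
      hA hAB hBC (by linarith) ha (by linarith)]
  · linarith [rpow_mul_le_of_ordered (e₁ := σ) (e₂ := 1 - σ) (e₃ := 1 - σ) (a := a) (b := b)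
      hA hAC hBC (by linarith) ha (by linarith)]
  · linarith [rpow_mul_le_of_ordered (e₁ := 1 - σ) (e₂ := σ) (e₃ := 1 - σ) (a := a) (b := b)
      hC hAC hAB (by linarith) ha' (by linarith)]
  · linarith [rpow_mul_le_of_ordered (e₁ := 1 - σ) (e₂ := σ) (e₃ := 1 - σ) (a := a) (b := b)
      hB hAB hAC (by linarith) ha' (by linarith)]
  · linarith [rpow_mul_le_of_ordered (e₁ := 1 - σ) (e₂ := 1 - σ) (e₃ := σ) (a := a) (b := b)
      hB hBC hAC (by linarith) ha' (by linarith)]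
  · linarith [rpow_mul_le_of_ordered (e₁ := 1 - σ) (e₂ := 1 - σ) (e₃ := σ) (a := a) (b := b)
      hC hBC hAB (by linarith) ha' (by linarith)]
  · linarith [rpow_mul_le_of_ordered (e₁ := 1 - σ) (e₂ := 1 - σ) (e₃ := σ) (a := a) (b := b)
      hC hBC hAB (by linarith) ha' (by linarith)]

/-- By periodicity, the integral of |f(x - y)| over y does not depend on x, so Tonelli separates the
variables. -/
theorem integrable_mul_comp_sub {f g : ℝ → ℝ} (hfm : Measurable f)
    (hfp : Function.Periodic f (2 * π)) (hfe : ∀ x, f (-x) = f x)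
    (hf : Integrable f periodMeasure) (hg : Integrable g periodMeasure) :
    Integrable (fun p : ℝ × ℝ => g p.1 * f (p.1 - p.2)) (periodMeasure.prod periodMeasure) := by
  have e : ∀ x y, f (x - y) = f (-x + y) := fun x y => by rw [← hfe]; congr 1; ring
  have hm : AEStronglyMeasurable (fun p : ℝ × ℝ => g p.1 * f (p.1 - p.2))
      (periodMeasure.prod periodMeasure) :=
    hg.1.comp_fst.mul (hfm.comp (measurable_fst.sub measurable_snd)).aestronglyMeasurable
  rw [integrable_prod_iff hm]
  constructor
  · refine Eventually.of_forall fun x => ?_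
    simp only [e]
    exact (hfp.integrable_periodMeasure_comp_add hf (-x)).const_mul _
  · have hfp' : Function.Periodic (fun x => ‖f x‖) (2 * π) := fun x => by simp [hfp x]
    have : ∀ x, ∫ y, ‖g x * f (x - y)‖ ∂periodMeasure = ‖g x‖ * ∫ y, ‖f y‖ ∂periodMeasure := by
      intro x
      simp_rw [norm_mul, integral_const_mul, e]
      rw [hfp'.integral_periodMeasure_comp_add]
    simp only [this]
    exact hg.norm.mul_const _

/-- `rpow_triple_le` trades the threefold singularity for products of two factors, each factor with
an exponent above -1. -/
theorem integrable_kernel_real {σ : ℝ} (h0 : 0 < σ) (h1 : σ < 1) :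
    Integrable (fun p : ℝ × ℝ => |sin (p.1 - p.2)| ^ (-σ) * |sin p.1| ^ (-(1 - σ)) *
      |sin p.2| ^ (-(1 - σ))) (periodMeasure.prod periodMeasure) := by
  obtain ⟨a, b, ha, ha', ha1, hb1, hab⟩ : ∃ a b : ℝ, σ ≤ a ∧ 1 - σ ≤ a ∧ a < 1 ∧ b < 1 ∧
      a + b = 2 - σ := by
    -- For σ ≤ 2/3 the total 2 - σ can be split evenly; beyond that the constraint σ ≤ a forces a
    -- larger `a`, and 2 - 2σ < 1 still holds.
    rcases le_total σ (1 - σ / 2) with h | h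
    · exact ⟨1 - σ / 2, 1 - σ / 2, h, by linarith, by linarith, by linarith, by ring⟩
    · exact ⟨σ, 2 - 2 * σ, le_rfl, by linarith, by linarith, by linarith, by ring⟩
  have hm : ∀ c : ℝ, Measurable (fun θ => |sin θ| ^ (-c)) := fun c => by fun_prop
  have hp : ∀ c : ℝ, Function.Periodic (fun θ => |sin θ| ^ (-c)) (2 * π) := fun c θ => by simp
  have he : ∀ (c : ℝ) (x : ℝ), |sin (-x)| ^ (-c) = |sin x| ^ (-c) := fun c x => by simp
  have hi : ∀ c : ℝ, c < 1 → Integrable (fun θ => |sin θ| ^ (-c)) periodMeasure :=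
    fun c => integrable_abs_sin_rpow
  have i1 : ∀ c d : ℝ, c < 1 → d < 1 → Integrable (fun p : ℝ × ℝ =>
      |sin p.1| ^ (-c) * |sin (p.1 - p.2)| ^ (-d)) (periodMeasure.prod periodMeasure) :=
    fun c d hc hd => integrable_mul_comp_sub (hm d) (hp d) (he d) (hi d hd) (hi c hc)
  have i2 : ∀ c d : ℝ, c < 1 → d < 1 → Integrable (fun p : ℝ × ℝ =>
      |sin p.2| ^ (-c) * |sin (p.1 - p.2)| ^ (-d)) (periodMeasure.prod periodMeasure) := by
    intro c d hc hd
    refine (i1 c d hc hd).swap.congr (Eventually.of_forall fun p => ?_)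
    simp only [Function.comp, Prod.fst_swap, Prod.snd_swap]
    rw [← he d, neg_sub]
  have i3 : ∀ c d : ℝ, c < 1 → d < 1 → Integrable (fun p : ℝ × ℝ =>
      |sin p.1| ^ (-c) * |sin p.2| ^ (-d)) (periodMeasure.prod periodMeasure) :=
    fun c d hc hd => (hi c hc).mul_prod (hi d hd)
  have key := ((i1 b a hb1 ha1).add (i1 a b ha1 hb1)).add ((i2 b a hb1 ha1).add (i2 a b ha1 hb1))
    |>.add ((i3 a b ha1 hb1).add (i3 b a hb1 ha1))
  refine key.mono' ?_ (Eventually.of_forall fun p => ?_)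
  · apply Measurable.aestronglyMeasurable; fun_prop
  · rw [norm_of_nonneg (by positivity)]
    refine (rpow_triple_le (abs_nonneg _) (abs_nonneg _) (abs_nonneg _) h0 h1 ha ha' hab).trans
      (le_of_eq ?_)
    simp only [Pi.add_apply]
    ring

/-- The kernel of the trilinear form on the circle. -/
noncomputable def circleKernel (l₁ l₂ : ℝ) (s : ℂ) (p : ℝ × ℝ) : ℂ :=
  ((|sin (p.1 - p.2)| : ℝ) : ℂ) ^ (-uParam l₁ l₂ s) *
    ((|sin p.1| : ℝ) : ℂ) ^ (-1 + uParam l₁ l₂ s + Complex.I * l₁) *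
    ((|sin p.2| : ℝ) : ℂ) ^ (-1 + uParam l₁ l₂ s - Complex.I * l₂)

theorem uParam_re (l₁ l₂ : ℝ) (s : ℂ) : (uParam l₁ l₂ s).re = s.re := by
  simp [uParam]

theorem norm_circleKernel (l₁ l₂ : ℝ) {s : ℂ} (hs₀ : 0 < s.re) (hs₁ : s.re < 1) (p : ℝ × ℝ) :
    ‖circleKernel l₁ l₂ s p‖ = |sin (p.1 - p.2)| ^ (-s.re) * |sin p.1| ^ (-(1 - s.re)) *
      |sin p.2| ^ (-(1 - s.re)) := by
  have e1 : (-uParam l₁ l₂ s).re = -s.re := by simp [uParam_re]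
  have e2 : (-1 + uParam l₁ l₂ s + Complex.I * l₁).re = -(1 - s.re) := by
    simp [uParam_re]; ring
  have e3 : (-1 + uParam l₁ l₂ s - Complex.I * l₂).re = -(1 - s.re) := by
    simp [uParam_re]; ring
  rw [circleKernel, norm_mul, norm_mul,
    Complex.norm_cpow_eq_rpow_re_of_nonneg (abs_nonneg _) (by rw [e1]; linarith),
    Complex.norm_cpow_eq_rpow_re_of_nonneg (abs_nonneg _) (by rw [e2]; linarith),
    Complex.norm_cpow_eq_rpow_re_of_nonneg (abs_nonneg _) (by rw [e3]; linarith), e1, e2, e3]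

theorem measurable_circleKernel (l₁ l₂ : ℝ) (s : ℂ) : Measurable (circleKernel l₁ l₂ s) := by
  unfold circleKernel
  fun_prop

theorem integrable_circleKernel (l₁ l₂ : ℝ) {s : ℂ} (hs₀ : 0 < s.re) (hs₁ : s.re < 1) :
    Integrable (circleKernel l₁ l₂ s) (periodMeasure.prod periodMeasure) := by
  rw [← integrable_norm_iff (measurable_circleKernel l₁ l₂ s).aestronglyMeasurable]
  simp_rw [norm_circleKernel l₁ l₂ hs₀ hs₁]
  exact integrable_kernel_real hs₀ hs₁

/-! ### Hilbert norms, bounds for H and the triple integral. -/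

namespace UnitarySeries

variable {l : ℝ}

theorem memLp (f : UnitarySeries l) : MemLp (fun θ => f (rot θ)) 2 periodMeasure := f.2.2

theorem periodic_two_pi (F : SLpm → ℂ) : Function.Periodic (fun θ => F (rot θ)) (2 * π) :=
  fun θ => by simp [rot_add_two_pi]

theorem aestronglyMeasurable (f : UnitarySeries l) : AEStronglyMeasurable (fun θ => f (rot θ)) :=
  (periodic_two_pi f.1).aestronglyMeasurable two_pi_pos (a := 0)
    (by simpa [periodMeasure] using f.memLp.1)

theorem memLp_compactPicture (f : UnitarySeries l) (a : ℝ) :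
    MemLp (fun θ => compactPicture f (a + θ)) 2 periodMeasure := by
  convert memLp_leftTranslate (by simp) (rot (π / 2 - a)) (unitarySeries_lowerHomog f) f.memLp
    using 2 with θ
  simp only [compactPicture, leftTranslate_apply, ← rot_neg, ← rot_add]
  ring_nf

/-- The `L²` norm on `K`. -/
noncomputable def hilbertNorm (f : UnitarySeries l) : ℝ :=
  (∫ θ, ‖f (rot θ)‖ ^ (2 : ℝ) ∂periodMeasure) ^ (1 / (2 : ℝ))

theorem hilbertNorm_nonneg (f : UnitarySeries l) : 0 ≤ f.hilbertNorm := by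
  unfold hilbertNorm; positivity

theorem norm_toLp (f : UnitarySeries l) :
    ‖(f.2.2.toLp : Lp ℂ 2 periodMeasure)‖ = f.hilbertNorm := by
  rw [Lp.norm_toLp, f.memLp.eLpNorm_eq_integral_rpow_norm (by simp) (by simp)]
  rw [ENNReal.toReal_ofReal (by positivity)]
  simp [hilbertNorm]

theorem integral_compactPicture (f : UnitarySeries l) (a : ℝ) :
    (∫ θ, ‖compactPicture f (a + θ)‖ ^ (2 : ℝ) ∂periodMeasure) ^ (1 / (2 : ℝ)) =
      f.hilbertNorm := by
  have hp : Function.Periodic (fun θ => ‖f (rot θ)‖ ^ (2 : ℝ)) (2 * π) := fun θ => by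
    simp [rot_add_two_pi]
  rw [hilbertNorm, ← hp.integral_periodMeasure_comp_add (a - π / 2)]
  congr 2
  funext θ
  simp only [compactPicture]
  ring_nf

end UnitarySeries

namespace SmoothSeries

variable {u : ℂ}

theorem continuous_rot (φ : SmoothSeries u) : Continuous (fun θ => φ (rot θ)) := φ.2.2.continuous

theorem exists_bound (φ : SmoothSeries u) : ∃ S, 0 ≤ S ∧ ∀ θ, ‖φ (rot θ)‖ ≤ S :=
  (UnitarySeries.periodic_two_pi φ.1).exists_norm_le two_pi_pos φ.continuous_rot

end SmoothSeries

section Trilinear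

variable {l₁ l₂ : ℝ} {v : ℂ} (f₁ : UnitarySeries l₁) (f₂ : UnitarySeries l₂) (φ : SmoothSeries v)

theorem integrable_convIntegrand (θ₁ θ₂ : ℝ) :
    Integrable (convIntegrand f₁ f₂ φ θ₁ θ₂) periodMeasure := by
  obtain ⟨S, hS0, hS⟩ := φ.exists_bound
  have h1 := (f₁.memLp_compactPicture θ₁).integrable_mul
    (f₂.memLp_compactPicture θ₂).star
  have h2 := h1.bdd_mul φ.continuous_rot.aestronglyMeasurable (Eventually.of_forall hS)
  refine h2.congr (Eventually.of_forall fun θ => ?_)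
  simp [convIntegrand, mul_assoc]

/-- Cauchy–Schwarz, with rotation invariance of the norm. That the bound is free of θ₁ and θ₂ leaves
only the kernel to integrate. -/
theorem integral_norm_convIntegrand_le {S : ℝ} (hS : ∀ θ, ‖φ (rot θ)‖ ≤ S) (θ₁ θ₂ : ℝ) :
    ∫ θ, ‖convIntegrand f₁ f₂ φ θ₁ θ₂ θ‖ ∂periodMeasure ≤
      S * (f₁.hilbertNorm * f₂.hilbertNorm) := by
  have hS0 : 0 ≤ S := (norm_nonneg _).trans (hS 0)
  have h1 := (f₁.memLp_compactPicture θ₁)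
  have h2 := (f₂.memLp_compactPicture θ₂)
  have hpq : Real.HolderConjugate 2 2 := Real.HolderConjugate.two_two
  have h3 := integral_mul_norm_le_Lp_mul_Lq (μ := periodMeasure) hpq
    (f := fun θ => compactPicture f₁ (θ₁ + θ)) (g := fun θ => compactPicture f₂ (θ₂ + θ))
    (by simpa using h1) (by simpa using h2)
  rw [f₁.integral_compactPicture, f₂.integral_compactPicture] at h3
  refine le_trans ?_ (mul_le_mul_of_nonneg_left h3 hS0)
  rw [← integral_const_mul]
  apply integral_mono (integrable_convIntegrand f₁ f₂ φ θ₁ θ₂).norm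
  · refine Integrable.const_mul ?_ _
    exact h1.norm.integrable_mul h2.norm
  · intro θ
    simp only [convIntegrand, norm_mul, RCLike.norm_conj, mul_assoc]
    gcongr
    exact hS θ

/-- The integrand of the trilinear form, on the product of three circles. -/
noncomputable def tripleIntegrand (s : ℂ) (p : (ℝ × ℝ) × ℝ) : ℂ :=
  circleKernel l₁ l₂ s p.1 * convIntegrand f₁ f₂ φ p.1.1 p.1.2 p.2

/-- The shear (x, y) ↦ (x, x + y) preserves Lebesgue measure, so a function known only up to null
sets may be composed with addition. -/
theorem aestronglyMeasurable_compactPicture_add {l : ℝ} (f : UnitarySeries l) :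
    AEStronglyMeasurable (fun p : ℝ × ℝ => compactPicture f (p.1 + p.2))
      (periodMeasure.prod periodMeasure) := by
  have h0 : AEStronglyMeasurable (compactPicture f) :=
    f.aestronglyMeasurable.comp_measurePreserving (measurePreserving_sub_right volume (π / 2))
  have h1 : AEStronglyMeasurable (fun p : ℝ × ℝ => compactPicture f (p.1 + p.2))
      (volume.prod volume) := by
    apply h0.comp_quasiMeasurePreserving (f := fun p : ℝ × ℝ => p.1 + p.2)
    exact (Measure.quasiMeasurePreserving_snd).comp
      (measurePreserving_prod_add volume volume).quasiMeasurePreserving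
  rw [periodMeasure, Measure.prod_restrict]
  exact h1.restrict

theorem aestronglyMeasurable_tripleIntegrand (s : ℂ) :
    AEStronglyMeasurable (tripleIntegrand f₁ f₂ φ s)
      ((periodMeasure.prod periodMeasure).prod periodMeasure) := by
  have m1 : AEStronglyMeasurable (fun p : (ℝ × ℝ) × ℝ => compactPicture f₁ (p.1.1 + p.2))
      ((periodMeasure.prod periodMeasure).prod periodMeasure) :=
    (aestronglyMeasurable_compactPicture_add f₁).comp_quasiMeasurePreserving
      (f := fun p : (ℝ × ℝ) × ℝ => (p.1.1, p.2))
      (QuasiMeasurePreserving.prodMap Measure.quasiMeasurePreserving_fst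
        (Measure.QuasiMeasurePreserving.id _))
  have m2 : AEStronglyMeasurable (fun p : (ℝ × ℝ) × ℝ => compactPicture f₂ (p.1.2 + p.2))
      ((periodMeasure.prod periodMeasure).prod periodMeasure) :=
    (aestronglyMeasurable_compactPicture_add f₂).comp_quasiMeasurePreserving
      (f := fun p : (ℝ × ℝ) × ℝ => (p.1.2, p.2))
      (QuasiMeasurePreserving.prodMap Measure.quasiMeasurePreserving_snd
        (Measure.QuasiMeasurePreserving.id _))
  have m3 : AEStronglyMeasurable (fun p : (ℝ × ℝ) × ℝ => circleKernel l₁ l₂ s p.1)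
      ((periodMeasure.prod periodMeasure).prod periodMeasure) :=
    ((measurable_circleKernel l₁ l₂ s).comp measurable_fst).aestronglyMeasurable
  have m4 : AEStronglyMeasurable (fun p : (ℝ × ℝ) × ℝ => φ (rot p.2))
      ((periodMeasure.prod periodMeasure).prod periodMeasure) :=
    (φ.continuous_rot.comp continuous_snd).aestronglyMeasurable
  exact m3.mul ((m4.mul m1).mul m2.star)

/-- Integrability in the three angles jointly allows φ's angle to be integrated either first, giving
H, or last, giving the invariant pairing. -/
theorem integrable_tripleIntegrand {s : ℂ} (hs₀ : 0 < s.re) (hs₁ : s.re < 1) :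
    Integrable (tripleIntegrand f₁ f₂ φ s)
      ((periodMeasure.prod periodMeasure).prod periodMeasure) := by
  obtain ⟨S, hS0, hS⟩ := φ.exists_bound
  have hm := aestronglyMeasurable_tripleIntegrand f₁ f₂ φ s
  rw [integrable_prod_iff hm]
  refine ⟨Eventually.of_forall fun p =>
    (integrable_convIntegrand f₁ f₂ φ p.1 p.2).const_mul (circleKernel l₁ l₂ s p), ?_⟩
  refine ((integrable_circleKernel l₁ l₂ hs₀ hs₁).norm.mul_const
    (S * (f₁.hilbertNorm * f₂.hilbertNorm))).mono' hm.norm.integral_prod_right'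
    (Eventually.of_forall fun p => ?_)
  rw [norm_of_nonneg (by positivity)]
  simp only [tripleIntegrand, norm_mul, integral_const_mul]
  gcongr
  exact integral_norm_convIntegrand_le f₁ f₂ φ hS _ _

theorem integral_tripleIntegrand_snd (s : ℂ) (p : ℝ × ℝ) :
    ∫ θ, tripleIntegrand f₁ f₂ φ s (p, θ) ∂periodMeasure =
      2 * π * circleIntegrand l₁ l₂ s f₁ f₂ φ p.1 p.2 := by
  have : (π : ℂ) ≠ 0 := by exact_mod_cast pi_ne_zero
  simp only [tripleIntegrand, integral_const_mul, circleIntegrand, convH, integral_periodMeasure,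
    circleKernel]
  field_simp

theorem integrable_circleIntegrand {s : ℂ} (hs₀ : 0 < s.re) (hs₁ : s.re < 1) :
    Integrable (fun p : ℝ × ℝ => circleIntegrand l₁ l₂ s f₁ f₂ φ p.1 p.2)
      (periodMeasure.prod periodMeasure) := by
  have h := (integrable_tripleIntegrand f₁ f₂ φ hs₀ hs₁).integral_prod_left
  simp only [integral_tripleIntegrand_snd] at h
  have hπ : (2 * π : ℂ) ≠ 0 := by exact_mod_cast two_pi_pos.ne'
  refine (h.const_mul (2 * π : ℂ)⁻¹).congr (Eventually.of_forall fun p => ?_)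
  simp only [inv_mul_cancel_left₀ hπ]

theorem integral_tripleIntegrand {s : ℂ} (hs₀ : 0 < s.re) (hs₁ : s.re < 1) :
    ∫ p, tripleIntegrand f₁ f₂ φ s p ∂((periodMeasure.prod periodMeasure).prod periodMeasure) =
      2 * π * ∫ θ₂ in (0 : ℝ)..(2 * π), ∫ θ₁ in (0 : ℝ)..(2 * π),
        circleIntegrand l₁ l₂ s f₁ f₂ φ θ₁ θ₂ := by
  rw [integral_prod _ (integrable_tripleIntegrand f₁ f₂ φ hs₀ hs₁)]
  simp only [integral_tripleIntegrand_snd, integral_const_mul]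
  rw [integral_prod_symm _ (integrable_circleIntegrand f₁ f₂ φ hs₀ hs₁)]
  simp only [integral_periodMeasure]

theorem norm_integral_tripleIntegrand_le {s : ℂ} (hs₀ : 0 < s.re) (hs₁ : s.re < 1) {S : ℝ}
    (hS : ∀ θ, ‖φ (rot θ)‖ ≤ S) :
    ‖∫ p, tripleIntegrand f₁ f₂ φ s p ∂((periodMeasure.prod periodMeasure).prod periodMeasure)‖ ≤
      (∫ p, ‖circleKernel l₁ l₂ s p‖ ∂(periodMeasure.prod periodMeasure)) *
        (f₁.hilbertNorm * f₂.hilbertNorm * S) := by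
  have hi := integrable_tripleIntegrand f₁ f₂ φ hs₀ hs₁
  refine (norm_integral_le_integral_norm _).trans ?_
  rw [integral_prod _ hi.norm, ← integral_mul_const]
  apply integral_mono hi.norm.integral_prod_left
    ((integrable_circleKernel l₁ l₂ hs₀ hs₁).norm.mul_const _)
  intro p
  simp only [tripleIntegrand, norm_mul, integral_const_mul]
  gcongr
  refine (integral_norm_convIntegrand_le f₁ f₂ φ hS _ _).trans (le_of_eq (by ring))

end Trilinear

/-! ### Trilinearity and joint continuity. -/

section TrilinearForm

variable {l₁ l₂ : ℝ} {v s : ℂ}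

/-- The integral over three circles, before normalization. -/
noncomputable def tripleIntegral (s : ℂ) (f₁ : UnitarySeries l₁) (f₂ : UnitarySeries l₂)
    (φ : SmoothSeries v) : ℂ :=
  ∫ p, tripleIntegrand f₁ f₂ φ s p ∂((periodMeasure.prod periodMeasure).prod periodMeasure)

theorem UnitarySeries.coe_add {l : ℝ} (f f' : UnitarySeries l) : (f + f').1 = f.1 + f'.1 := rfl
theorem UnitarySeries.coe_smul {l : ℝ} (c : ℂ) (f : UnitarySeries l) : (c • f).1 = c • f.1 := rfl
theorem SmoothSeries.coe_add (φ φ' : SmoothSeries v) : (φ + φ').1 = φ.1 + φ'.1 := rfl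
theorem SmoothSeries.coe_smul (c : ℂ) (φ : SmoothSeries v) : (c • φ).1 = c • φ.1 := rfl

theorem tripleIntegral_add_left (hs₀ : 0 < s.re) (hs₁ : s.re < 1) (f₁ f₁' : UnitarySeries l₁)
    (f₂ : UnitarySeries l₂) (φ : SmoothSeries v) :
    tripleIntegral s (f₁ + f₁') f₂ φ = tripleIntegral s f₁ f₂ φ + tripleIntegral s f₁' f₂ φ := by
  rw [tripleIntegral, tripleIntegral, tripleIntegral,
    ← integral_add (integrable_tripleIntegrand _ _ _ hs₀ hs₁)
      (integrable_tripleIntegrand _ _ _ hs₀ hs₁)]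
  congr 1; funext p
  simp only [tripleIntegrand, convIntegrand, compactPicture, UnitarySeries.coe_add, Pi.add_apply]
  ring

theorem tripleIntegral_add_mid (hs₀ : 0 < s.re) (hs₁ : s.re < 1) (f₁ : UnitarySeries l₁)
    (f₂ f₂' : UnitarySeries l₂) (φ : SmoothSeries v) :
    tripleIntegral s f₁ (f₂ + f₂') φ = tripleIntegral s f₁ f₂ φ + tripleIntegral s f₁ f₂' φ := by
  rw [tripleIntegral, tripleIntegral, tripleIntegral,
    ← integral_add (integrable_tripleIntegrand _ _ _ hs₀ hs₁)
      (integrable_tripleIntegrand _ _ _ hs₀ hs₁)]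
  congr 1; funext p
  simp only [tripleIntegrand, convIntegrand, compactPicture, UnitarySeries.coe_add, Pi.add_apply,
    map_add]
  ring

theorem tripleIntegral_add_right (hs₀ : 0 < s.re) (hs₁ : s.re < 1) (f₁ : UnitarySeries l₁)
    (f₂ : UnitarySeries l₂) (φ φ' : SmoothSeries v) :
    tripleIntegral s f₁ f₂ (φ + φ') = tripleIntegral s f₁ f₂ φ + tripleIntegral s f₁ f₂ φ' := by
  rw [tripleIntegral, tripleIntegral, tripleIntegral,
    ← integral_add (integrable_tripleIntegrand _ _ _ hs₀ hs₁)
      (integrable_tripleIntegrand _ _ _ hs₀ hs₁)]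
  congr 1; funext p
  simp only [tripleIntegrand, convIntegrand, SmoothSeries.coe_add, Pi.add_apply]
  ring

theorem tripleIntegral_smul_left (c : ℂ) (f₁ : UnitarySeries l₁)
    (f₂ : UnitarySeries l₂) (φ : SmoothSeries v) :
    tripleIntegral s (c • f₁) f₂ φ = c * tripleIntegral s f₁ f₂ φ := by
  rw [tripleIntegral, tripleIntegral, ← integral_const_mul]
  congr 1; funext p
  simp only [tripleIntegrand, convIntegrand, compactPicture, UnitarySeries.coe_smul, Pi.smul_apply,
    smul_eq_mul]
  ring

theorem tripleIntegral_smul_mid (c : ℂ) (f₁ : UnitarySeries l₁)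
    (f₂ : UnitarySeries l₂) (φ : SmoothSeries v) :
    tripleIntegral s f₁ (c • f₂) φ = conj c * tripleIntegral s f₁ f₂ φ := by
  rw [tripleIntegral, tripleIntegral, ← integral_const_mul]
  congr 1; funext p
  simp only [tripleIntegrand, convIntegrand, compactPicture, UnitarySeries.coe_smul, Pi.smul_apply,
    smul_eq_mul, map_mul]
  ring

theorem tripleIntegral_smul_right (c : ℂ) (f₁ : UnitarySeries l₁)
    (f₂ : UnitarySeries l₂) (φ : SmoothSeries v) :
    tripleIntegral s f₁ f₂ (c • φ) = c * tripleIntegral s f₁ f₂ φ := by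
  rw [tripleIntegral, tripleIntegral, ← integral_const_mul]
  congr 1; funext p
  simp only [tripleIntegrand, convIntegrand, SmoothSeries.coe_smul, Pi.smul_apply, smul_eq_mul]
  ring

/-- The normalized trilinear form. -/
noncomputable def trilinearForm (l₁ l₂ : ℝ) (v : ℂ) {s : ℂ} (hs₀ : 0 < s.re) (hs₁ : s.re < 1) :
    UnitarySeries l₁ →ₗ[ℂ] UnitarySeries l₂ →ₗ⋆[ℂ] SmoothSeries v →ₗ[ℂ] ℂ :=
  LinearMap.mk₂'ₛₗ (RingHom.id ℂ) (starRingEnd ℂ)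
    (fun f₁ f₂ =>
      -- Here 16π = 8 · 2π: the triple integral omits the factor 1/2π contained in H.
      { toFun := fun φ => G₀ (uParam l₁ l₂ s) / (16 * π) * tripleIntegral s f₁ f₂ φ
        map_add' := fun φ φ' => by rw [tripleIntegral_add_right hs₀ hs₁, mul_add]
        map_smul' := fun c φ => by
          rw [tripleIntegral_smul_right, RingHom.id_apply, smul_eq_mul, mul_left_comm] })
    (fun f₁ f₁' f₂ => LinearMap.ext fun φ => by
      simp [tripleIntegral_add_left hs₀ hs₁, mul_add])
    (fun c f₁ f₂ => LinearMap.ext fun φ => by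
      simp [tripleIntegral_smul_left, mul_left_comm])
    (fun f₁ f₂ f₂' => LinearMap.ext fun φ => by
      simp [tripleIntegral_add_mid hs₀ hs₁, mul_add])
    (fun c f₁ f₂ => LinearMap.ext fun φ => by
      simp [tripleIntegral_smul_mid, mul_left_comm])

theorem trilinearForm_apply (hs₀ : 0 < s.re) (hs₁ : s.re < 1) (f₁ : UnitarySeries l₁)
    (f₂ : UnitarySeries l₂) (φ : SmoothSeries v) : trilinearForm l₁ l₂ v hs₀ hs₁ f₁ f₂ φ =
      G₀ (uParam l₁ l₂ s) / (16 * π) * tripleIntegral s f₁ f₂ φ := rfl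

theorem trilinearForm_eq (hs₀ : 0 < s.re) (hs₁ : s.re < 1) (f₁ : UnitarySeries l₁)
    (f₂ : UnitarySeries l₂) (φ : SmoothSeries v) : trilinearForm l₁ l₂ v hs₀ hs₁ f₁ f₂ φ =
      G₀ (uParam l₁ l₂ s) / 8 * ∫ θ₂ in (0 : ℝ)..(2 * π), ∫ θ₁ in (0 : ℝ)..(2 * π),
          circleIntegrand l₁ l₂ s f₁ f₂ φ θ₁ θ₂ := by
  have : (π : ℂ) ≠ 0 := by exact_mod_cast pi_ne_zero
  rw [trilinearForm_apply, tripleIntegral, integral_tripleIntegrand f₁ f₂ φ hs₀ hs₁]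
  field_simp
  ring

/-- The trilinear form is bounded by the `L²` norms and the supremum norm. -/
theorem exists_trilinearForm_bound (l₁ l₂ : ℝ) (v : ℂ) (hs₀ : 0 < s.re) (hs₁ : s.re < 1) :
    ∃ C : ℝ, 0 ≤ C ∧ ∀ (f₁ : UnitarySeries l₁) (f₂ : UnitarySeries l₂) (φ : SmoothSeries v) (S : ℝ),
      (∀ θ, ‖φ (rot θ)‖ ≤ S) →
      ‖trilinearForm l₁ l₂ v hs₀ hs₁ f₁ f₂ φ‖ ≤ C * (f₁.hilbertNorm * f₂.hilbertNorm * S) := by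
  refine ⟨‖G₀ (uParam l₁ l₂ s) / (16 * π)‖ *
    ∫ p, ‖circleKernel l₁ l₂ s p‖ ∂(periodMeasure.prod periodMeasure), by positivity,
    fun f₁ f₂ φ S hS => ?_⟩
  rw [trilinearForm_apply, norm_mul, mul_assoc]
  gcongr
  exact norm_integral_tripleIntegrand_le f₁ f₂ φ hs₀ hs₁ hS

theorem UnitarySeries.eventually_hilbertNorm_sub_lt {l : ℝ} (f₀ : UnitarySeries l) {δ : ℝ}
    (hδ : 0 < δ) : ∀ᶠ f in 𝓝 f₀, (f - f₀).hilbertNorm < δ := by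
  have hc : Continuous (fun f : UnitarySeries l => (f.2.2.toLp : Lp ℂ 2 periodMeasure)) :=
    continuous_induced_dom
  have h1 := Metric.tendsto_nhds.1 (hc.tendsto f₀) δ hδ
  filter_upwards [h1] with f hf
  rw [dist_eq_norm] at hf
  rw [← UnitarySeries.norm_toLp]
  exact hf

theorem SmoothSeries.eventually_norm_sub_lt (φ₀ : SmoothSeries v) {δ : ℝ} (hδ : 0 < δ) :
    ∀ᶠ φ in 𝓝 φ₀, ∀ θ, ‖φ (rot θ) - φ₀ (rot θ)‖ < δ := by
  have hc : Continuous (fun φ : SmoothSeries v => fun n : ℕ =>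
      UniformFun.ofFun (iteratedDeriv n (fun θ => φ (rot θ)))) := continuous_induced_dom
  have h0 := ((continuous_apply 0).comp hc).tendsto φ₀
  rw [UniformFun.tendsto_iff_tendstoUniformly] at h0
  have h1 := Metric.tendstoUniformly_iff.1 h0 δ hδ
  filter_upwards [h1] with φ hφ θ
  have := hφ θ
  rw [dist_comm, dist_eq_norm] at this
  simpa using this

/-- Telescoping in the three arguments combined with the norm bound. Of the Fréchet topology only
uniform convergence of φ itself is needed. -/
theorem continuous_trilinearForm (hs₀ : 0 < s.re) (hs₁ : s.re < 1) :
    Continuous (fun p : UnitarySeries l₁ × UnitarySeries l₂ × SmoothSeries v =>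
        trilinearForm l₁ l₂ v hs₀ hs₁ p.1 p.2.1 p.2.2) := by
  set T := trilinearForm l₁ l₂ v hs₀ hs₁
  obtain ⟨C, hC0, hC⟩ := exists_trilinearForm_bound l₁ l₂ v hs₀ hs₁
  rw [continuous_iff_continuousAt]
  rintro ⟨f₁, f₂, φ⟩
  rw [ContinuousAt, Metric.tendsto_nhds]
  intro ε hε
  obtain ⟨S, hS0, hS⟩ := φ.exists_bound
  have n1 := f₁.hilbertNorm_nonneg
  have n2 := f₂.hilbertNorm_nonneg
  -- `D` is the coefficient of δ in the telescoped estimate, once δ ≤ 1 bounds the norms of the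
  -- nearby second and third arguments by those of `f₂` and `φ` plus 1.
  set D := C * ((f₂.hilbertNorm + 1) * (S + 1) + f₁.hilbertNorm * (S + 1) +
    f₁.hilbertNorm * f₂.hilbertNorm) with hD
  have hD0 : 0 ≤ D := by positivity
  set δ := min 1 (ε / (D + 1)) with hδ
  have hδ0 : 0 < δ := by positivity
  have hδ1 : δ ≤ 1 := min_le_left _ _
  have hδε : D * δ < ε := by
    have h1 : δ * (D + 1) ≤ ε := by
      rw [← le_div_iff₀ (by positivity)]; exact min_le_right _ _
    nlinarith
  have e1 : ∀ᶠ p : UnitarySeries l₁ × UnitarySeries l₂ × SmoothSeries v in 𝓝 (f₁, f₂, φ),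
      (p.1 - f₁).hilbertNorm < δ :=
    (continuous_fst.tendsto (f₁, f₂, φ)).eventually (f₁.eventually_hilbertNorm_sub_lt hδ0)
  have e2 : ∀ᶠ p : UnitarySeries l₁ × UnitarySeries l₂ × SmoothSeries v in 𝓝 (f₁, f₂, φ),
      (p.2.1 - f₂).hilbertNorm < δ :=
    ((continuous_fst.comp continuous_snd).tendsto (f₁, f₂, φ)).eventually
      (f₂.eventually_hilbertNorm_sub_lt hδ0)
  have e3 : ∀ᶠ p : UnitarySeries l₁ × UnitarySeries l₂ × SmoothSeries v in 𝓝 (f₁, f₂, φ),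
      ∀ θ, ‖p.2.2 (rot θ) - φ (rot θ)‖ < δ :=
    ((continuous_snd.comp continuous_snd).tendsto (f₁, f₂, φ)).eventually
      (φ.eventually_norm_sub_lt hδ0)
  filter_upwards [e1, e2, e3] with p h1 h2 h3
  obtain ⟨g₁, g₂, ψ⟩ := p
  simp only at h1 h2 h3 ⊢
  have hψ : ∀ θ, ‖ψ (rot θ)‖ ≤ S + 1 := fun θ => by
    have := norm_add_le (ψ (rot θ) - φ (rot θ)) (φ (rot θ))
    rw [sub_add_cancel] at this
    linarith [h3 θ, hS θ]
  have hg2 : g₂.hilbertNorm ≤ f₂.hilbertNorm + 1 := by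
    have : ‖(g₂.2.2.toLp : Lp ℂ 2 periodMeasure)‖ ≤
        ‖((g₂ - f₂).2.2.toLp : Lp ℂ 2 periodMeasure)‖ +
        ‖(f₂.2.2.toLp : Lp ℂ 2 periodMeasure)‖ := by
      refine le_trans (le_of_eq ?_) (norm_add_le _ _)
      rw [← MemLp.toLp_add]
      congr 2
      funext θ
      exact (sub_add_cancel (g₂ (rot θ)) (f₂ (rot θ))).symm
    rw [UnitarySeries.norm_toLp, UnitarySeries.norm_toLp, UnitarySeries.norm_toLp] at this
    linarith
  have hdec : T g₁ g₂ ψ - T f₁ f₂ φ =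
      T (g₁ - f₁) g₂ ψ + T f₁ (g₂ - f₂) ψ + T f₁ f₂ (ψ - φ) := by
    simp only [map_sub, LinearMap.sub_apply]
    ring
  have b1 := hC (g₁ - f₁) g₂ ψ (S + 1) hψ
  have b2 := hC f₁ (g₂ - f₂) ψ (S + 1) hψ
  have b3 := hC f₁ f₂ (ψ - φ) δ (fun θ => (h3 θ).le)
  rw [dist_eq_norm, hdec]
  refine lt_of_le_of_lt (norm_add₃_le.trans (add_le_add (add_le_add b1 b2) b3)) ?_
  have m1 := UnitarySeries.hilbertNorm_nonneg (g₁ - f₁)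
  have m2 := UnitarySeries.hilbertNorm_nonneg (g₂ - f₂)
  have m3 := UnitarySeries.hilbertNorm_nonneg g₂
  calc C * ((g₁ - f₁).hilbertNorm * g₂.hilbertNorm * (S + 1)) +
        C * (f₁.hilbertNorm * (g₂ - f₂).hilbertNorm * (S + 1)) +
        C * (f₁.hilbertNorm * f₂.hilbertNorm * δ)
      ≤ C * (δ * (f₂.hilbertNorm + 1) * (S + 1)) + C * (f₁.hilbertNorm * δ * (S + 1)) +
        C * (f₁.hilbertNorm * f₂.hilbertNorm * δ) := by gcongr
    _ = D * δ := by rw [hD]; ring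
    _ < ε := hδε

end TrilinearForm

/-! ### The pairing on the line and equivariance. -/

/-- The invariant pairing in the noncompact picture. -/
noncomputable def noncompactPairing (u : ℂ) (F₁ F₂ : SLpm → ℂ) : ℂ :=
  ∫ y : ℝ, ∫ x : ℝ, ((|x - y| : ℝ) : ℂ) ^ (-u) * F₁ (unip x) * conj (F₂ (unip y))

theorem Function.Periodic.integral_two_pi_cot {E : Type*} [NormedAddCommGroup E] [NormedSpace ℝ E]
    {h : ℝ → E} (hp : Function.Periodic h π) :
    ∫ θ in 0..2 * π, h θ = (2 : ℝ) • ∫ x : ℝ, (1 + x ^ 2)⁻¹ • h (π / 2 - arctan x) := by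
  have hp' : Function.Periodic (fun θ => h (θ + π / 2)) π := fun θ => by
    change h (θ + π + π / 2) = h (θ + π / 2)
    rw [add_right_comm, hp]
  have hp2 : Function.Periodic h (2 * π) := by simpa using hp.nat_mul 2
  have h1 := hp'.integral_two_pi
  rw [intervalIntegral.integral_comp_add_right] at h1
  have h2 := hp2.intervalIntegral_add_eq 0 (π / 2)
  simp only [zero_add, add_comm (2 * π)] at h1 h2
  rw [h2, h1]
  simp only [neg_add_eq_sub]

theorem Complex.conj_ofReal_cpow {x : ℝ} (hx : 0 ≤ x) (c : ℂ) :
    conj ((x : ℂ) ^ c) = (x : ℂ) ^ conj c := by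
  rw [Complex.cpow_conj, Complex.conj_ofReal]
  rw [Complex.arg_ofReal_of_nonneg hx]
  exact pi_pos.ne

/-- For θ₁ = cot⁻¹ x and θ₂ = cot⁻¹ y one has sin θ₁ = (1+x²)^(-1/2) and |sin(θ₁-θ₂)| = |x-y| sin θ₁
sin θ₂. The Jacobians and the powers of the sines then combine into exactly the weights relating f̃
to the noncompact picture. -/
theorem circleKernel_cot (l₁ l₂ : ℝ) (s : ℂ) (x y : ℝ) :
    (((1 + x ^ 2)⁻¹ : ℝ) : ℂ) * (((1 + y ^ 2)⁻¹ : ℝ) : ℂ) *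
      circleKernel l₁ l₂ s (π / 2 - arctan x, π / 2 - arctan y) =
    ((|x - y| : ℝ) : ℂ) ^ (-uParam l₁ l₂ s) *
      ((√(1 + x ^ 2) : ℝ) : ℂ) ^ (-(Complex.I * l₁ + 1)) *
      conj (((√(1 + y ^ 2) : ℝ) : ℂ) ^ (-(Complex.I * l₂ + 1))) := by
  rw [Complex.conj_ofReal_cpow (by positivity)]
  set X := √(1 + x ^ 2) with hX
  set Y := √(1 + y ^ 2) with hY
  have hX0 : 0 < X := by positivity
  have hY0 : 0 < Y := by positivity
  have hXC : (X : ℂ) ≠ 0 := by exact_mod_cast hX0.ne'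
  have hYC : (Y : ℂ) ≠ 0 := by exact_mod_cast hY0.ne'
  have e1 : sin (π / 2 - arctan x) = X⁻¹ := by rw [sin_pi_div_two_sub, cos_arctan, one_div]
  have e2 : sin (π / 2 - arctan y) = Y⁻¹ := by rw [sin_pi_div_two_sub, cos_arctan, one_div]
  have e3 : |sin (π / 2 - arctan x - (π / 2 - arctan y))| = |x - y| * (X⁻¹ * Y⁻¹) := by
    have : sin (π / 2 - arctan x - (π / 2 - arctan y)) = (y - x) * (X⁻¹ * Y⁻¹) := by
      rw [show π / 2 - arctan x - (π / 2 - arctan y) = arctan y - arctan x by ring, sin_sub,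
        sin_arctan, cos_arctan, sin_arctan, cos_arctan, ← hX, ← hY]
      field_simp
    rw [this, abs_mul, abs_sub_comm, abs_of_pos (by positivity : 0 < X⁻¹ * Y⁻¹)]
  have hx2 : (((1 + x ^ 2)⁻¹ : ℝ) : ℂ) = (X : ℂ) ^ (-2 : ℂ) := by
    have h : 1 + x ^ 2 = X ^ 2 := (Real.sq_sqrt (by positivity)).symm
    rw [h, Complex.cpow_neg]; norm_cast
  have hy2 : (((1 + y ^ 2)⁻¹ : ℝ) : ℂ) = (Y : ℂ) ^ (-2 : ℂ) := by
    have h : 1 + y ^ 2 = Y ^ 2 := (Real.sq_sqrt (by positivity)).symm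
    rw [h, Complex.cpow_neg]; norm_cast
  simp only [circleKernel, e1, e2, e3]
  rw [abs_of_pos (inv_pos.2 hX0), abs_of_pos (inv_pos.2 hY0), hx2, hy2, Complex.ofReal_mul,
    Complex.mul_cpow_ofReal_nonneg (abs_nonneg _) (by positivity), Complex.ofReal_mul,
    Complex.mul_cpow_ofReal_nonneg (by positivity) (by positivity)]
  simp only [Complex.ofReal_inv_cpow hX0.le, Complex.ofReal_inv_cpow hY0.le]
  have eX : (X : ℂ) ^ (-(Complex.I * l₁ + 1)) = (X : ℂ) ^ (-2 : ℂ) *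
      (X : ℂ) ^ (- -uParam l₁ l₂ s) *
      (X : ℂ) ^ (-(-1 + uParam l₁ l₂ s + Complex.I * l₁)) := by
    rw [← Complex.cpow_add _ _ hXC, ← Complex.cpow_add _ _ hXC]; congr 1; ring
  have eY : (Y : ℂ) ^ (conj (-(Complex.I * l₂ + 1))) = (Y : ℂ) ^ (-2 : ℂ) *
      (Y : ℂ) ^ (- -uParam l₁ l₂ s) *
      (Y : ℂ) ^ (-(-1 + uParam l₁ l₂ s - Complex.I * l₂)) := by
    rw [← Complex.cpow_add _ _ hYC, ← Complex.cpow_add _ _ hYC]; congr 1; simp; ring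
  rw [eX, eY]
  ring

theorem LowerHomog.compactPicture_add_pi {c : ℂ} {F : SLpm → ℂ} (hF : LowerHomog c F) (θ : ℝ) :
    compactPicture F (θ + π) = compactPicture F θ := by
  have := hF.rot_add_pi 1 (θ - π / 2)
  simp only [one_mul] at this
  rw [compactPicture, compactPicture, ← this]
  ring_nf

/-- The integral over two circles is the pairing in the noncompact picture. -/
theorem integral_circle_eq_noncompactPairing {l₁ l₂ : ℝ} (s : ℂ) {F₁ F₂ : SLpm → ℂ}
    (h₁ : LowerHomog (Complex.I * l₁ + 1) F₁) (h₂ : LowerHomog (Complex.I * l₂ + 1) F₂) (θ : ℝ) :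
    ∫ θ₂ in 0..2 * π, ∫ θ₁ in 0..2 * π, circleKernel l₁ l₂ s (θ₁, θ₂) *
      (compactPicture F₁ (θ₁ + θ) * conj (compactPicture F₂ (θ₂ + θ))) =
    4 * noncompactPairing (uParam l₁ l₂ s) (leftTranslate (rot θ)⁻¹ F₁)
      (leftTranslate (rot θ)⁻¹ F₂) := by
  have hk1 : ∀ θ₁ θ₂, circleKernel l₁ l₂ s (θ₁ + π, θ₂) = circleKernel l₁ l₂ s (θ₁, θ₂) := by
    intro θ₁ θ₂
    simp only [circleKernel, add_sub_right_comm, sin_add_pi, abs_neg]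
  have hk2 : ∀ θ₁ θ₂, circleKernel l₁ l₂ s (θ₁, θ₂ + π) = circleKernel l₁ l₂ s (θ₁, θ₂) := by
    intro θ₁ θ₂
    simp only [circleKernel, ← sub_sub, sin_sub_pi, sin_add_pi, abs_neg]
  have hp1 : ∀ θ₂, Function.Periodic (fun θ₁ => circleKernel l₁ l₂ s (θ₁, θ₂) *
      (compactPicture F₁ (θ₁ + θ) * conj (compactPicture F₂ (θ₂ + θ)))) π := by
    intro θ₂ θ₁
    simp only [hk1]
    rw [add_right_comm, h₁.compactPicture_add_pi]
  have hp2 : Function.Periodic (fun θ₂ => ∫ θ₁ in 0..2 * π, circleKernel l₁ l₂ s (θ₁, θ₂) *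
      (compactPicture F₁ (θ₁ + θ) * conj (compactPicture F₂ (θ₂ + θ)))) π := by
    intro θ₂
    simp only [hk2]
    rw [add_right_comm, h₂.compactPicture_add_pi]
  -- Each circle covers the line twice, whence the factor 4. The substitutions hold for arbitrary
  -- integrands, so no convergence is required at the given θ.
  rw [hp2.integral_two_pi_cot]
  simp only [(hp1 _).integral_two_pi_cot]
  rw [noncompactPairing, ← integral_const_mul, ← integral_smul]
  refine integral_congr_ae (Eventually.of_forall fun y => ?_)
  simp only
  rw [smul_smul, smul_smul, ← integral_smul, ← integral_const_mul]
  refine integral_congr_ae (Eventually.of_forall fun x => ?_)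
  have hc : ∀ (F : SLpm → ℂ) (x : ℝ), compactPicture F (π / 2 - arctan x + θ) =
      F (rot θ * rot (-arctan x)) := fun F x => by
    rw [compactPicture, ← rot_add]; ring_nf
  simp only [leftTranslate_apply, inv_inv, hc, h₁.mul_unip, h₂.mul_unip, map_mul]
  have := circleKernel_cot l₁ l₂ s x y
  simp only [Complex.real_smul]
  push_cast at this ⊢
  linear_combination 4 * F₁ (rot θ * rot (-arctan x)) * conj (F₂ (rot θ * rot (-arctan y))) * this

/-- Fubini with θ outermost. The form becomes an integral over K of a function defined on all of G,
which makes its equivariance visible. -/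
theorem tripleIntegral_eq_integral_pairing {l₁ l₂ : ℝ} {v s : ℂ} (hs₀ : 0 < s.re) (hs₁ : s.re < 1)
    (f₁ : UnitarySeries l₁) (f₂ : UnitarySeries l₂) (φ : SmoothSeries v) :
    tripleIntegral s f₁ f₂ φ = 4 * ∫ θ in 0..2 * π, φ (rot θ) *
      noncompactPairing (uParam l₁ l₂ s) (leftTranslate (rot θ)⁻¹ f₁)
        (leftTranslate (rot θ)⁻¹ f₂) := by
  have hi := integrable_tripleIntegrand f₁ f₂ φ hs₀ hs₁
  rw [tripleIntegral, integral_prod_symm _ hi, ← integral_periodMeasure, ← integral_const_mul]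
  refine integral_congr_ae ?_
  filter_upwards [hi.prod_left_ae] with θ hθ
  rw [integral_prod_symm _ hθ]
  rw [mul_left_comm, ← integral_circle_eq_noncompactPairing s (unitarySeries_lowerHomog f₁)
    (unitarySeries_lowerHomog f₂) θ, integral_periodMeasure, ← intervalIntegral.integral_const_mul]
  congr 1; funext θ₂
  rw [integral_periodMeasure, ← intervalIntegral.integral_const_mul]
  congr 1; funext θ₁
  simp only [tripleIntegrand, convIntegrand]
  ring

theorem integral_comp_affine (f : ℝ → ℂ) (α β : ℝ) :
    ∫ x, f (α * x + β) = ((|α|⁻¹ : ℝ) : ℂ) * ∫ x, f x := by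
  rw [Measure.integral_comp_mul_left (fun x => f (x + β)), integral_add_right_eq_self f,
    Complex.real_smul, abs_inv]

/-- P acts on the line by affine maps: `p * unip x` is upper triangular, and taking off `unip t` on
the left leaves a diagonal matrix. -/
theorem LowerHomog.mul_upper_unip {c : ℂ} {F : SLpm → ℂ} (hF : LowerHomog c F) (g : SLpm)
    {p : SLpm} (hp : entry p 1 0 = 0) (x : ℝ) :
    F (g * p * unip x) = ((|entry p 0 0| : ℝ) : ℂ) ^ c *
      F (g * unip (entry p 0 0 / entry p 1 1 * x + entry p 0 1 / entry p 1 1)) := by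
  have hd := det_entry p
  have h1 : entry p 1 1 ≠ 0 := fun h => by simp [hp, h] at hd
  set t := entry p 0 0 / entry p 1 1 * x + entry p 0 1 / entry p 1 1 with ht
  have hq : entry ((unip t)⁻¹ * p * unip x) 0 1 = 0 := by
    rw [← unip_neg]
    simp [entry_mul, unip, hp, ht]
    field_simp
    ring
  have hq0 : entry ((unip t)⁻¹ * p * unip x) 0 0 = entry p 0 0 := by
    rw [← unip_neg]
    simp [entry_mul, unip, hp]
  rw [← hq0, ← hF _ _ hq]
  congr 1
  group

/-- The density on `G / P` whose integral over `K` is the trilinear form. -/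
theorem upperHomog_mul_noncompactPairing {l₁ l₂ : ℝ} {s : ℂ} {F₁ F₂ Φ : SLpm → ℂ}
    (h₁ : LowerHomog (Complex.I * l₁ + 1) F₁) (h₂ : LowerHomog (Complex.I * l₂ + 1) F₂)
    (hΦ : UpperHomog (-(2 * s - 1 + 1)) Φ) :
    UpperHomog (-2) (fun g => Φ g * noncompactPairing (uParam l₁ l₂ s) (leftTranslate g⁻¹ F₁)
      (leftTranslate g⁻¹ F₂)) := by
  intro g p hp
  set u := uParam l₁ l₂ s with hu
  have hd := det_entry p
  have h00 : entry p 0 0 ≠ 0 := fun h => by simp [hp, h] at hd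
  set a := entry p 0 0 with ha
  have ha0 : 0 < |a| := abs_pos.2 h00
  have haC : ((|a| : ℝ) : ℂ) ≠ 0 := by exact_mod_cast ha0.ne'
  set α := a / entry p 1 1 with hα
  set β := entry p 0 1 / entry p 1 1 with hβ
  have hαa : |α| = |a| ^ 2 := by
    rw [hα, abs_div, abs_entry_one_one (by simp [hp]), ← ha]
    field_simp
  -- Exponents of |a|: 2u from the kernel, 2 + iλ₁ - iλ₂ from the vectors and -2 from each Jacobian,
  -- adding up to 2s - 2. Affine substitution needs no integrability, so the identity holds at every
  -- g, even where the pairing diverges and has a default value.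
  have key : noncompactPairing u (leftTranslate (g * p)⁻¹ F₁) (leftTranslate (g * p)⁻¹ F₂) =
      ((|a| : ℝ) : ℂ) ^ (2 * s - 2) *
        noncompactPairing u (leftTranslate g⁻¹ F₁) (leftTranslate g⁻¹ F₂) := by
    simp only [noncompactPairing, leftTranslate_apply, inv_inv, h₁.mul_upper_unip g hp,
      h₂.mul_upper_unip g hp]
    simp only [← ha, ← hα, ← hβ]
    set C : ℂ := ((|a| : ℝ) : ℂ) ^ (2 * u) * ((|a| : ℝ) : ℂ) ^ (Complex.I * l₁ + 1) *
      conj (((|a| : ℝ) : ℂ) ^ (Complex.I * l₂ + 1)) with hC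
    have e : ∀ x y : ℝ, ((|x - y| : ℝ) : ℂ) ^ (-u) =
        ((|a| : ℝ) : ℂ) ^ (2 * u) * ((|(α * x + β) - (α * y + β)| : ℝ) : ℂ) ^ (-u) := by
      intro x y
      rw [show (α * x + β) - (α * y + β) = α * (x - y) by ring, abs_mul, hαa, Complex.ofReal_mul,
        Complex.mul_cpow_ofReal_nonneg (by positivity) (abs_nonneg _), ← mul_assoc]
      rw [pow_two, Complex.ofReal_mul, Complex.mul_cpow_ofReal_nonneg ha0.le ha0.le,
        ← Complex.cpow_add _ _ haC, ← Complex.cpow_add _ _ haC]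
      rw [show 2 * u + (-u + -u) = 0 by ring, Complex.cpow_zero, one_mul]
    have e2 : ∀ y : ℝ, (∫ x : ℝ, ((|x - y| : ℝ) : ℂ) ^ (-u) *
        (((|a| : ℝ) : ℂ) ^ (Complex.I * l₁ + 1) * F₁ (g * unip (α * x + β))) *
        conj (((|a| : ℝ) : ℂ) ^ (Complex.I * l₂ + 1) * F₂ (g * unip (α * y + β)))) =
        C * (((|α|⁻¹ : ℝ) : ℂ) * ∫ x, ((|x - (α * y + β)| : ℝ) : ℂ) ^ (-u) * F₁ (g * unip x) *
          conj (F₂ (g * unip (α * y + β)))) := by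
      intro y
      rw [← integral_comp_affine (fun x => ((|x - (α * y + β)| : ℝ) : ℂ) ^ (-u) *
        F₁ (g * unip x) * conj (F₂ (g * unip (α * y + β)))) α β, ← integral_const_mul]
      congr 1; funext x
      rw [e x y, map_mul, hC]
      ring
    simp only [e2]
    rw [integral_const_mul, integral_const_mul, integral_comp_affine (fun y =>
      ∫ x, ((|x - y| : ℝ) : ℂ) ^ (-u) * F₁ (g * unip x) * conj (F₂ (g * unip y))) α β]
    rw [← mul_assoc, ← mul_assoc]
    congr 1
    rw [hC, Complex.conj_ofReal_cpow ha0.le, hαa]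
    have e3 : (((|a| ^ 2)⁻¹ : ℝ) : ℂ) = ((|a| : ℝ) : ℂ) ^ (-2 : ℂ) := by
      rw [Complex.cpow_neg]; norm_cast
    rw [e3]
    simp only [← Complex.cpow_add _ _ haC]
    congr 1
    simp [hu, uParam]
    ring
  simp only [key, hΦ g p hp]
  rw [← ha, show (-2 : ℂ) = -(2 * s - 1 + 1) + (2 * s - 2) by ring, Complex.cpow_add _ _ haC]
  ring

/-- Translating all three arguments by g translates the density on G/P by g, which does not change
its integral over K. -/
theorem tripleIntegral_equivariant {l₁ l₂ : ℝ} {s : ℂ} (hs₀ : 0 < s.re) (hs₁ : s.re < 1) (g : SLpm)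
    (f₁ : UnitarySeries l₁) (f₂ : UnitarySeries l₂) (φ : SmoothSeries (2 * s - 1)) :
    tripleIntegral s (unitaryRep l₁ g f₁) (unitaryRep l₂ g f₂) (smoothRep (2 * s - 1) g φ) =
      tripleIntegral s f₁ f₂ φ := by
  rw [tripleIntegral_eq_integral_pairing hs₀ hs₁, tripleIntegral_eq_integral_pairing hs₀ hs₁]
  congr 1
  rw [← (upperHomog_mul_noncompactPairing (unitarySeries_lowerHomog f₁)
    (unitarySeries_lowerHomog f₂) (smoothSeries_upperHomog φ)).integral_leftTranslate g]
  have e : ∀ (h : SLpm) (F : SLpm → ℂ), leftTranslate h⁻¹ (leftTranslate g F) =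
      leftTranslate (g⁻¹ * h)⁻¹ F := fun h F => by
    rw [← leftTranslate_mul]; simp
  simp only [leftTranslate_apply, ← e]
  rfl

/-! ### The Fourier transform of |t|^(u-1) tested on integrable functions. -/

/-- This is the form in which the constant arises, since Γ_ℝ(z)|d|^(-z) is a Mellin transform of
Gaussians. -/
theorem G₀_eq_Gammaℝ_div {u : ℂ} (h0 : 0 < u.re) :
    G₀ u = Complex.Gammaℝ u / Complex.Gammaℝ (1 - u) := by
  rw [Complex.Gammaℝ_div_Gammaℝ_one_sub, G₀, Complex.Gammaℂ_def]
  intro n h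
  rw [h] at h0
  simp at h0
  linarith [Nat.cast_nonneg (α := ℝ) n]

theorem integral_cpow_mul_gaussian {z : ℂ} (hz : 0 < z.re) {d : ℝ} (hd : d ≠ 0) :
    ∫ τ : ℝ in Ioi 0, (τ : ℂ) ^ (z / 2 - 1) * Complex.exp (-((π * d ^ 2 : ℝ) * τ)) =
      Complex.Gammaℝ z * ((|d| : ℝ) : ℂ) ^ (-z) := by
  have hr : 0 < π * d ^ 2 := by positivity
  have hd' : 0 < |d| := abs_pos.2 hd
  rw [Complex.integral_cpow_mul_exp_neg_mul_Ioi (by simpa using hz) hr, Complex.Gammaℝ_def]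
  have : (1 / ((π * d ^ 2 : ℝ) : ℂ)) ^ (z / 2) =
      (π : ℂ) ^ (-z / 2) * ((|d| : ℝ) : ℂ) ^ (-z) := by
    rw [one_div, ← Complex.ofReal_inv, Complex.ofReal_inv_cpow hr.le, ← sq_abs, pow_two,
      Complex.ofReal_mul, Complex.mul_cpow_ofReal_nonneg pi_pos.le (by positivity),
      Complex.ofReal_mul, Complex.mul_cpow_ofReal_nonneg hd'.le hd'.le,
      ← Complex.cpow_add _ _ (by exact_mod_cast hd'.ne')]
    congr 2 <;> ring
  rw [this]
  ring

theorem norm_cpow_mul_gaussian (z : ℂ) (d : ℝ) {τ : ℝ} (hτ : 0 < τ) :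
    ‖(τ : ℂ) ^ (z / 2 - 1) * Complex.exp (-((π * d ^ 2 : ℝ) * τ))‖ =
      τ ^ (z.re / 2 - 1) * exp (-(π * d ^ 2 * τ)) := by
  rw [norm_mul, Complex.norm_cpow_eq_rpow_re_of_pos hτ, Complex.norm_exp]
  rw [← Complex.ofReal_mul, ← Complex.ofReal_neg, Complex.ofReal_re]
  simp

theorem measurable_cpow_mul_gaussian (z : ℂ) : Measurable (fun p : ℝ × ℝ =>
    (p.2 : ℂ) ^ (z / 2 - 1) * Complex.exp (-((π * p.1 ^ 2 : ℝ) * p.2))) := by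
  fun_prop

/-- Write a negative power of a function as a superposition of Gaussians and interchange the
order of integration. -/
theorem integral_abs_cpow_eq_gaussian {X : Type*} [MeasurableSpace X] {ν : Measure X} [SFinite ν]
    {z : ℂ} (hz : 0 < z.re) {d : X → ℝ} (hd : Measurable d) (hd0 : ∀ᵐ x ∂ν, d x ≠ 0) {A : X → ℂ}
    (hA : AEStronglyMeasurable A ν)
    (hi : Integrable (fun x => ((|d x| : ℝ) : ℂ) ^ (-z) * A x) ν) :
    Complex.Gammaℝ z * ∫ x, ((|d x| : ℝ) : ℂ) ^ (-z) * A x ∂ν =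
      ∫ τ : ℝ in Ioi 0, (τ : ℂ) ^ (z / 2 - 1) *
        ∫ x, Complex.exp (-((π * d x ^ 2 : ℝ) * τ)) * A x ∂ν := by
  set J : X × ℝ → ℂ := fun p =>
    (p.2 : ℂ) ^ (z / 2 - 1) * Complex.exp (-((π * d p.1 ^ 2 : ℝ) * p.2)) * A p.1 with hJ
  have hJm : AEStronglyMeasurable J (ν.prod (volume.restrict (Ioi 0))) := by
    refine AEStronglyMeasurable.mul ?_ hA.comp_fst
    exact ((measurable_cpow_mul_gaussian z).comp
      ((hd.comp measurable_fst).prodMk measurable_snd)).aestronglyMeasurable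
  have hreal : ∀ x, d x ≠ 0 → ∫ τ in Ioi (0 : ℝ), τ ^ (z.re / 2 - 1) * exp (-(π * d x ^ 2 * τ)) =
      π ^ (-z.re / 2) * Gamma (z.re / 2) * |d x| ^ (-z.re) := by
    intro x hx
    have hr : 0 < π * d x ^ 2 := by positivity
    rw [Real.integral_rpow_mul_exp_neg_mul_Ioi (by positivity) hr, one_div, ← sq_abs,
      Real.inv_rpow (by positivity), Real.mul_rpow pi_pos.le (by positivity), mul_inv,
      ← Real.rpow_neg pi_pos.le, ← Real.rpow_neg (by positivity), ← Real.rpow_natCast,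
      ← Real.rpow_mul (abs_nonneg _)]
    rw [show ((2 : ℕ) : ℝ) * -(z.re / 2) = -z.re by push_cast; ring,
      show -(z.re / 2) = -z.re / 2 by ring]
    ring
  have hJi : Integrable J (ν.prod (volume.restrict (Ioi 0))) := by
    rw [integrable_prod_iff hJm]
    constructor
    · filter_upwards [hd0] with x hx
      have hr : 0 < π * d x ^ 2 := by positivity
      suffices h : Integrable (fun τ : ℝ => (τ : ℂ) ^ (z / 2 - 1) *
          Complex.exp (-((π * d x ^ 2 : ℝ) * τ))) (volume.restrict (Ioi 0)) from h.mul_const (A x)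
      -- A nonintegrable function has integral 0 by convention, while the known value of this
      -- integral is nonzero.
      by_contra hni
      have h1 := integral_cpow_mul_gaussian hz hx
      rw [integral_undef hni] at h1
      refine mul_ne_zero (Complex.Gammaℝ_ne_zero_of_re_pos hz) ?_ h1.symm
      rw [Complex.cpow_ne_zero_iff]
      left
      simpa using hx
    · have h2 := hi.norm.const_mul (π ^ (-z.re / 2) * Gamma (z.re / 2))
      refine h2.congr ?_
      filter_upwards [hd0] with x hx
      simp only [hJ, norm_mul _ (A x), integral_mul_const]
      rw [setIntegral_congr_fun measurableSet_Ioi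
        (fun τ hτ => norm_cpow_mul_gaussian z (d x) hτ), hreal x hx,
        Complex.norm_cpow_eq_rpow_re_of_pos (abs_pos.2 hx), Complex.neg_re, ← mul_assoc]
  rw [← integral_const_mul]
  calc ∫ x, Complex.Gammaℝ z * (((|d x| : ℝ) : ℂ) ^ (-z) * A x) ∂ν
      = ∫ x, (∫ τ in Ioi (0 : ℝ), J (x, τ)) ∂ν := by
        refine integral_congr_ae ?_
        filter_upwards [hd0] with x hx
        simp only [hJ, integral_mul_const]
        rw [integral_cpow_mul_gaussian hz hx, mul_assoc]
    _ = ∫ τ in Ioi (0 : ℝ), ∫ x, J (x, τ) ∂ν := integral_integral_swap hJi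
    _ = _ := by
        congr 1; funext τ
        simp only [hJ, mul_assoc, integral_const_mul]

/-- The Fourier transform with the character `e^{-2πitx}`. -/
noncomputable def fourierT (f : ℝ → ℂ) (t : ℝ) : ℂ :=
  ∫ x : ℝ, f x * Complex.exp (-2 * π * Complex.I * (t * x))

theorem norm_fourier_char (y : ℝ) : ‖Complex.exp (-2 * π * Complex.I * y)‖ = 1 := by
  rw [show (-2 * π * Complex.I * y : ℂ) = ((-2 * π * y : ℝ) : ℂ) * Complex.I by push_cast; ring,
    Complex.norm_exp_ofReal_mul_I]

theorem conj_fourier_char (y : ℝ) : conj (Complex.exp (-2 * π * Complex.I * y)) =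
    Complex.exp (2 * π * Complex.I * y) := by
  rw [← Complex.exp_conj]; simp [Complex.conj_ofNat]

theorem continuous_fourierT {f : ℝ → ℂ} (hf : Integrable f) : Continuous (fourierT f) := by
  refine continuous_of_dominated (bound := fun x => ‖f x‖) ?_ ?_ hf.norm ?_
  · intro t
    exact hf.1.mul (by fun_prop : Continuous _).aestronglyMeasurable
  · refine fun t => Eventually.of_forall fun x => ?_
    rw [norm_mul]
    have := norm_fourier_char (t * x)
    push_cast at this
    rw [this, mul_one]
  · exact Eventually.of_forall fun x => by fun_prop

theorem integral_gaussian_mul_char {τ : ℝ} (hτ : 0 < τ) (d : ℝ) :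
    ∫ t : ℝ, Complex.exp (-((π * t ^ 2 : ℝ) * τ)) * Complex.exp (-2 * π * Complex.I * (t * d)) =
      ((τ ^ (-(1 / 2 : ℝ)) : ℝ) : ℂ) * Complex.exp (-((π * d ^ 2 : ℝ) * (τ⁻¹ : ℝ))) := by
  have h := fourierIntegral_gaussian (b := ((π * τ : ℝ) : ℂ))
    (by rw [Complex.ofReal_re]; positivity) (-2 * π * d)
  have e : ∀ t : ℝ, Complex.exp (-((π * t ^ 2 : ℝ) * τ)) *
      Complex.exp (-2 * π * Complex.I * (t * d)) =
      Complex.exp (Complex.I * (-2 * π * d) * t) *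
        Complex.exp (-((π * τ : ℝ) : ℂ) * t ^ 2) := by
    intro t
    rw [← Complex.exp_add, ← Complex.exp_add]
    congr 1; push_cast; ring
  have hπ : (π : ℂ) ≠ 0 := by exact_mod_cast pi_ne_zero
  have hτ' : (τ : ℂ) ≠ 0 := by exact_mod_cast hτ.ne'
  simp_rw [e]
  rw [h]
  congr 1
  · rw [Complex.ofReal_cpow hτ.le, show ((-(1 / 2 : ℝ) : ℝ) : ℂ) = -(1 / 2 : ℂ) by push_cast; ring,
      ← Complex.ofReal_inv_cpow hτ.le]
    congr 1
    push_cast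
    field_simp
  · congr 1
    push_cast
    field_simp
    ring

/-- Parseval with a Gaussian weight. The weight makes the integrand integrable in t and both space
variables together, so Fubini applies, and the t-integral is the Fourier transform of a Gaussian. -/
theorem integral_gaussian_mul_fourierT {f₁ f₂ : ℝ → ℂ} (h₁ : Integrable f₁) (h₂ : Integrable f₂)
    {τ : ℝ} (hτ : 0 < τ) :
    ∫ t : ℝ, Complex.exp (-((π * t ^ 2 : ℝ) * τ)) * (fourierT f₁ t * conj (fourierT f₂ t)) =
      ((τ ^ (-(1 / 2 : ℝ)) : ℝ) : ℂ) * ∫ p : ℝ × ℝ,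
        Complex.exp (-((π * (p.1 - p.2) ^ 2 : ℝ) * (τ⁻¹ : ℝ))) * (f₁ p.1 * conj (f₂ p.2)) := by
  have hg : Integrable (fun t : ℝ => Complex.exp (-((π * t ^ 2 : ℝ) * τ))) := by
    have := integrable_cexp_neg_mul_sq (b := ((π * τ : ℝ) : ℂ))
      (by rw [Complex.ofReal_re]; positivity)
    refine this.congr (Eventually.of_forall fun t => ?_)
    simp only; congr 1; push_cast; ring
  have hp : Integrable (fun p : ℝ × ℝ => f₁ p.1 * conj (f₂ p.2)) :=
    h₁.mul_prod (Complex.conjCLE.integrable_comp_iff.2 h₂)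
  have hft : ∀ t : ℝ, fourierT f₁ t * conj (fourierT f₂ t) = ∫ p : ℝ × ℝ,
      (f₁ p.1 * conj (f₂ p.2)) * Complex.exp (-2 * π * Complex.I * (t * (p.1 - p.2 : ℝ))) := by
    intro t
    rw [fourierT, fourierT, ← integral_conj, ← integral_prod_mul]
    congr 1; funext p
    have := conj_fourier_char (t * p.2)
    push_cast at this
    rw [map_mul, this, mul_mul_mul_comm, ← Complex.exp_add]
    congr 2; push_cast; ring
  set J : ℝ × (ℝ × ℝ) → ℂ := fun q => Complex.exp (-((π * q.1 ^ 2 : ℝ) * τ)) *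
    (f₁ q.2.1 * conj (f₂ q.2.2)) *
      Complex.exp (-2 * π * Complex.I * (q.1 * (q.2.1 - q.2.2 : ℝ))) with hJ
  have hJi : Integrable J (volume.prod volume) := by
    refine (hg.mul_prod hp).mul_bdd (c := 1) ?_ ?_
    · exact (by fun_prop : Continuous _).aestronglyMeasurable
    · refine Eventually.of_forall fun q => ?_
      have := norm_fourier_char (q.1 * (q.2.1 - q.2.2))
      push_cast at this ⊢
      rw [this]
  calc _ = ∫ t : ℝ, ∫ p : ℝ × ℝ, J (t, p) := by
        congr 1; funext t
        rw [hft, ← integral_const_mul]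
        simp only [hJ, mul_assoc]
    _ = ∫ p : ℝ × ℝ, ∫ t : ℝ, J (t, p) := integral_integral_swap hJi
    _ = _ := by
        rw [← integral_const_mul]
        congr 1; funext p
        have : ∀ t : ℝ, J (t, p) = (f₁ p.1 * conj (f₂ p.2)) *
            (Complex.exp (-((π * t ^ 2 : ℝ) * τ)) *
              Complex.exp (-2 * π * Complex.I * (t * (p.1 - p.2 : ℝ)))) := fun t => by
          simp only [hJ]; ring
        simp only [this]
        rw [integral_const_mul, integral_gaussian_mul_char hτ]
        ring

theorem ae_sub_ne_zero : ∀ᵐ p : ℝ × ℝ, p.1 - p.2 ≠ 0 := by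
  rw [Measure.volume_eq_prod]
  refine Measure.ae_prod_mem_iff_ae_ae_mem (s := {p : ℝ × ℝ | p.1 - p.2 ≠ 0}) ?_ |>.2 ?_
  · exact (measurableSet_eq_fun (measurable_fst.sub measurable_snd) measurable_const).compl
  · refine Eventually.of_forall fun x => ?_
    filter_upwards [Measure.ae_ne volume x] with y hy
    simpa [sub_eq_zero] using Ne.symm hy

/-- The Fourier transform of `|t| ^ (u - 1)` is `G₀(u) |x| ^ (-u)`, tested against a product. -/
theorem integral_abs_cpow_mul_fourierT {u : ℂ} (h0 : 0 < u.re) (h1 : u.re < 1) {f₁ f₂ : ℝ → ℂ}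
    (h₁ : Integrable f₁) (h₂ : Integrable f₂)
    (hI : Integrable (fun t : ℝ => ((|t| : ℝ) : ℂ) ^ (u - 1) *
      (fourierT f₁ t * conj (fourierT f₂ t))))
    (hJ : Integrable (fun p : ℝ × ℝ => ((|p.1 - p.2| : ℝ) : ℂ) ^ (-u) *
      (f₁ p.1 * conj (f₂ p.2)))) :
    ∫ t : ℝ, ((|t| : ℝ) : ℂ) ^ (u - 1) * (fourierT f₁ t * conj (fourierT f₂ t)) =
      G₀ u * ∫ p : ℝ × ℝ, ((|p.1 - p.2| : ℝ) : ℂ) ^ (-u) * (f₁ p.1 * conj (f₂ p.2)) := by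
  have hz : 0 < (1 - u).re := by simp; linarith
  have hne : Complex.Gammaℝ (1 - u) ≠ 0 := Complex.Gammaℝ_ne_zero_of_re_pos hz
  rw [G₀_eq_Gammaℝ_div h0, div_mul_eq_mul_div, eq_div_iff hne, mul_comm _ (Complex.Gammaℝ (1 - u))]
  have hA : AEStronglyMeasurable (fun t => fourierT f₁ t * conj (fourierT f₂ t)) :=
    ((continuous_fourierT h₁).mul
      (Complex.continuous_conj.comp (continuous_fourierT h₂))).aestronglyMeasurable
  have hB : AEStronglyMeasurable (fun p : ℝ × ℝ => f₁ p.1 * conj (f₂ p.2)) :=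
    (h₁.mul_prod (Complex.conjCLE.integrable_comp_iff.2 h₂)).1
  have k1 := integral_abs_cpow_eq_gaussian (ν := volume) hz (d := fun t : ℝ => t) measurable_id
    (Measure.ae_ne volume 0) hA (by simpa [neg_sub] using hI)
  have k2 := integral_abs_cpow_eq_gaussian (ν := volume) h0 (d := fun p : ℝ × ℝ => p.1 - p.2)
    (measurable_fst.sub measurable_snd) ae_sub_ne_zero hB hJ
  rw [neg_sub] at k1
  -- The substitution τ ↦ τ⁻¹ identifies the two superpositions: with the Jacobian τ⁻² on one side
  -- and τ^(-1/2) from the Gaussian on the other, both carry the power τ^(-u/2 - 1).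
  rw [k2, ← integral_comp_rpow_Ioi _ (p := -1) (by norm_num), k1]
  refine setIntegral_congr_fun measurableSet_Ioi fun τ hτ => ?_
  have hτ : 0 < τ := hτ
  have hτC : (τ : ℂ) ≠ 0 := by exact_mod_cast hτ.ne'
  rw [integral_gaussian_mul_fourierT h₁ h₂ hτ, ← mul_assoc, Real.rpow_neg_one, Complex.real_smul,
    ← mul_assoc]
  congr 1
  rw [Complex.ofReal_inv_cpow hτ.le, abs_neg, abs_one, one_mul, Complex.ofReal_cpow hτ.le,
    Complex.ofReal_cpow hτ.le, ← Complex.cpow_add _ _ hτC, ← Complex.cpow_add _ _ hτC]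
  congr 1
  push_cast
  ring

/-! ### Extension to functions decaying like 1/|x|. -/

theorem integrable_rpow_piecewise {p q : ℝ} (hp : -1 < p) (hq : q < -1) :
    Integrable (fun t : ℝ => if |t| ≤ 1 then |t| ^ p else |t| ^ q) := by
  set f : ℝ → ℝ := fun t => if |t| ≤ 1 then |t| ^ p else |t| ^ q with hf
  have h1 : IntegrableOn f (Ioc 0 1) := by
    have := (intervalIntegrable_iff_integrableOn_Ioc_of_le zero_le_one).1
      (intervalIntegral.intervalIntegrable_rpow' (a := 0) (b := 1) hp)
    refine this.congr_fun (fun t ht => ?_) measurableSet_Ioc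
    simp only [hf]
    rw [abs_of_pos ht.1, if_pos ht.2]
  have h2 : IntegrableOn f (Ioi 1) := by
    have := integrableOn_Ioi_rpow_of_lt hq zero_lt_one
    refine this.congr_fun (fun t ht => ?_) measurableSet_Ioi
    have ht : 1 < t := ht
    simp only [hf]
    rw [abs_of_pos (by linarith), if_neg (by linarith)]
  have h3 : Integrable ((Ioi 0).indicator f) := by
    rw [integrable_indicator_iff measurableSet_Ioi, ← Ioc_union_Ioi_eq_Ioi zero_le_one]
    exact h1.union h2
  refine (h3.add h3.comp_neg).congr ?_
  filter_upwards [Measure.ae_ne volume 0] with t ht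
  rcases lt_or_gt_of_ne ht with h | h
  · simp [indicator, not_lt.2 h.le, h, hf]
  · simp [indicator, not_lt.2 h.le, h, hf]

theorem lintegral_comp_cot_angle (h : ℝ → ENNReal) :
    ∫⁻ θ in Ioo 0 π, h θ = ∫⁻ x : ℝ, ENNReal.ofReal (1 + x ^ 2)⁻¹ * h (π / 2 - arctan x) := by
  have himg : (fun x : ℝ => π / 2 - arctan x) '' univ = Ioo 0 π := by
    have : (fun x : ℝ => π / 2 - arctan x) = (fun y => π / 2 - y) ∘ arctan := rfl
    rw [this, image_comp, image_univ, range_arctan, image_const_sub_Ioo]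
    congr 1 <;> ring
  have := lintegral_image_eq_lintegral_abs_deriv_mul MeasurableSet.univ
    (fun x _ => ((hasDerivAt_arctan x).const_sub (π / 2)).hasDerivWithinAt)
    (fun x _ y _ hxy => arctan_injective (by simpa using hxy)) h
  rw [himg] at this
  rw [this]
  simp only [abs_deriv_neg_arctan, Measure.restrict_univ]

/-- The kernel of the pairing is integrable against the spherical vectors. -/
theorem integrable_line_kernel {σ : ℝ} (h0 : 0 < σ) (h1 : σ < 1) :
    Integrable (fun p : ℝ × ℝ => |p.1 - p.2| ^ (-σ) *
      ((√(1 + p.1 ^ 2))⁻¹ * (√(1 + p.2 ^ 2))⁻¹)) := by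
  have hs0 : 0 < (σ : ℂ).re := h0
  have hs1 : (σ : ℂ).re < 1 := h1
  have hm : Measurable (fun p : ℝ × ℝ => |p.1 - p.2| ^ (-σ) *
      ((√(1 + p.1 ^ 2))⁻¹ * (√(1 + p.2 ^ 2))⁻¹)) := by fun_prop
  -- Taking absolute values in `circleKernel_cot` with both spectral parameters 0 gives exactly this
  -- function, so its integral is that of the circle kernel over (0, π) × (0, π).
  have hK := integrable_circleKernel 0 0 hs0 hs1
  have hKm := measurable_circleKernel 0 0 σ
  refine ⟨hm.aestronglyMeasurable, ?_⟩
  have hpt : ∀ x y : ℝ, ‖|x - y| ^ (-σ) * ((√(1 + x ^ 2))⁻¹ * (√(1 + y ^ 2))⁻¹)‖ₑ =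
      ENNReal.ofReal (1 + x ^ 2)⁻¹ * (ENNReal.ofReal (1 + y ^ 2)⁻¹ *
        ‖circleKernel 0 0 σ (π / 2 - arctan x, π / 2 - arctan y)‖ₑ) := by
    intro x y
    have h := congrArg norm (circleKernel_cot 0 0 σ x y)
    have hu : (-uParam 0 0 σ).re = -σ := by simp [uParam_re]
    rw [norm_mul, norm_mul, norm_mul, norm_mul, RCLike.norm_conj, norm_ofReal_cpow_neg (by simp),
      norm_ofReal_cpow_neg (by simp), Complex.norm_cpow_eq_rpow_re_of_nonneg (abs_nonneg _)
      (by rw [hu]; linarith), hu] at h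
    rw [← mul_assoc, ← ofReal_norm, ← ofReal_norm, ← ENNReal.ofReal_mul (by positivity),
      ← ENNReal.ofReal_mul (by positivity)]
    congr 1
    rw [Complex.norm_real, Complex.norm_real, norm_of_nonneg (by positivity : 0 ≤ (1 + x ^ 2)⁻¹),
      norm_of_nonneg (by positivity : 0 ≤ (1 + y ^ 2)⁻¹)] at h
    rw [norm_of_nonneg (by positivity), ← mul_assoc, h]
  rw [HasFiniteIntegral, Measure.volume_eq_prod, lintegral_prod _ (by fun_prop)]
  simp only [hpt]
  have e1 : ∀ x : ℝ, (∫⁻ y : ℝ, ENNReal.ofReal (1 + x ^ 2)⁻¹ * (ENNReal.ofReal (1 + y ^ 2)⁻¹ *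
      ‖circleKernel 0 0 σ (π / 2 - arctan x, π / 2 - arctan y)‖ₑ)) =
      ENNReal.ofReal (1 + x ^ 2)⁻¹ *
        ∫⁻ θ in Ioo 0 π, ‖circleKernel 0 0 σ (π / 2 - arctan x, θ)‖ₑ := by
    intro x
    rw [lintegral_const_mul' _ _ ENNReal.ofReal_ne_top, lintegral_comp_cot_angle]
  simp only [e1]
  rw [← lintegral_comp_cot_angle (fun α => ∫⁻ θ in Ioo 0 π, ‖circleKernel 0 0 σ (α, θ)‖ₑ)]
  have hsub : volume.restrict (Ioo 0 π) ≤ periodMeasure :=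
    Measure.restrict_mono (s' := Ioc 0 (2 * π))
      (fun x hx => mem_Ioc.2 ⟨hx.1, by linarith [hx.2, pi_pos]⟩) le_rfl
  refine lt_of_le_of_lt ?_ hK.2
  rw [lintegral_prod _ hKm.enorm.aemeasurable]
  exact lintegral_mono' hsub fun α => lintegral_mono' hsub fun θ => le_rfl

/-- `f` is `C¹` with the decay of the noncompact picture of a smooth vector. -/
structure HasDecay (f f' : ℝ → ℂ) (C : ℝ) : Prop where
  hasDerivAt : ∀ x, HasDerivAt f (f' x) x
  continuous_deriv : Continuous f'
  bound : ∀ x, ‖f x‖ ≤ C * (√(1 + x ^ 2))⁻¹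
  bound_deriv : ∀ x, ‖f' x‖ ≤ C * (1 + x ^ 2)⁻¹

/-- The truncated Fourier transform. -/
noncomputable def truncFourier (f : ℝ → ℂ) (R t : ℝ) : ℂ :=
  ∫ x in (-R)..R, f x * Complex.exp (-2 * π * Complex.I * (t * x))

/-- The Fourier transform as an improper integral. -/
noncomputable def limFourier (f : ℝ → ℂ) (t : ℝ) : ℂ :=
  limUnder atTop (fun R => truncFourier f R t)

/-- The antiderivative of the character that vanishes at the origin. -/
noncomputable def charPrimitive (t x : ℝ) : ℂ :=
  (Complex.exp (-2 * π * Complex.I * (t * x)) - 1) / (-2 * π * Complex.I * t)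

theorem hasDerivAt_charPrimitive {t : ℝ} (ht : t ≠ 0) (x : ℝ) :
    HasDerivAt (charPrimitive t) (Complex.exp (-2 * π * Complex.I * (t * x))) x := by
  have hc : (-2 * π * Complex.I * t : ℂ) ≠ 0 := by
    simp [pi_ne_zero, ht]
  have h1 : HasDerivAt (fun x : ℝ => (-2 * π * Complex.I * (t * x) : ℂ))
      (-2 * π * Complex.I * t) x := by
    have := (Complex.ofRealCLM.hasDerivAt (x := x)).const_mul (-2 * π * Complex.I * t : ℂ)
    simp only [Complex.ofRealCLM_apply, Complex.ofReal_one, mul_one] at this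
    refine this.congr_of_eventuallyEq (Eventually.of_forall fun y => ?_)
    simp only; ring
  have h2 := (h1.cexp.sub_const 1).div_const (-2 * π * Complex.I * t : ℂ)
  rw [mul_div_cancel_right₀ _ hc] at h2
  exact h2

theorem continuous_charPrimitive (t : ℝ) : Continuous (charPrimitive t) := by
  unfold charPrimitive
  fun_prop

/-- Interpolates between the bounds by |x| and by 1/|t|, through |e^(iy) - 1| ≤ 2|y|^α. The first
relies on the primitive vanishing at the origin. -/
theorem norm_charPrimitive_le {t : ℝ} (ht : t ≠ 0) (x : ℝ) {α : ℝ} (h0 : 0 ≤ α) (h1 : α ≤ 1) :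
    ‖charPrimitive t x‖ ≤ 2 * |t| ^ (α - 1) * |x| ^ α := by
  have ht' : 0 < |t| := abs_pos.2 ht
  set y : ℝ := -2 * π * (t * x) with hy
  have e : (-2 * π * Complex.I * (t * x) : ℂ) = Complex.I * (y : ℂ) := by
    rw [hy]; push_cast; ring
  have hnum : ‖Complex.exp (Complex.I * (y : ℂ)) - 1‖ ≤ 2 * |y| ^ α := by
    rcases le_or_gt |y| 1 with h | h
    · refine Real.norm_exp_I_mul_ofReal_sub_one_le.trans ?_
      rw [norm_eq_abs]
      have : |y| ≤ |y| ^ α := by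
        rcases (abs_nonneg y).eq_or_lt with h' | h'
        · rw [← h']; positivity
        · calc |y| = |y| ^ (1 : ℝ) := (Real.rpow_one _).symm
            _ ≤ |y| ^ α := Real.rpow_le_rpow_of_exponent_ge h' h h1
      have : 0 ≤ |y| ^ α := by positivity
      linarith
    · have h2 : ‖Complex.exp (Complex.I * (y : ℂ)) - 1‖ ≤ 2 := by
        refine (norm_sub_le _ _).trans ?_
        rw [mul_comm, Complex.norm_exp_ofReal_mul_I, norm_one]
        norm_num
      have : 1 ≤ |y| ^ α := Real.one_le_rpow h.le h0
      linarith
  have hden : ‖(-2 * π * Complex.I * t : ℂ)‖ = 2 * π * |t| := by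
    simp [abs_of_pos pi_pos]
  rw [charPrimitive, e, norm_div, hden, div_le_iff₀ (by positivity)]
  refine hnum.trans ?_
  have hy' : |y| = 2 * π * (|t| * |x|) := by
    rw [hy, abs_mul, abs_mul, abs_mul, abs_neg, abs_of_pos pi_pos]
    norm_num
  have hπ : (2 * π) ^ α ≤ 2 * π := by
    calc (2 * π) ^ α ≤ (2 * π) ^ (1 : ℝ) :=
          Real.rpow_le_rpow_of_exponent_le (by linarith [pi_gt_three]) h1
      _ = 2 * π := Real.rpow_one _
  have htα : |t| ^ (α - 1) * |t| = |t| ^ α := by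
    rw [Real.rpow_sub_one ht'.ne']; field_simp
  rw [hy', Real.mul_rpow (by positivity) (by positivity), Real.mul_rpow ht'.le (abs_nonneg _)]
  calc 2 * ((2 * π) ^ α * (|t| ^ α * |x| ^ α)) ≤ 2 * (2 * π * (|t| ^ α * |x| ^ α)) := by gcongr
    _ = 2 * |t| ^ (α - 1) * |x| ^ α * (2 * π * |t|) := by rw [← htα]; ring

/-- A constant that bounds the truncated Fourier transforms. -/
noncomputable def fourierConst (α : ℝ) : ℝ := 4 + 2 * ∫ x : ℝ, (1 + x ^ 2) ^ (-(2 - α) / 2)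

theorem fourierConst_nonneg (α : ℝ) : 0 ≤ fourierConst α := by
  unfold fourierConst
  have : 0 ≤ ∫ x : ℝ, (1 + x ^ 2) ^ (-(2 - α) / 2) := integral_nonneg fun x => by positivity
  positivity

namespace HasDecay

variable {f f' : ℝ → ℂ} {C : ℝ}

theorem nonneg (h : HasDecay f f' C) : 0 ≤ C := by
  simpa using (norm_nonneg _).trans (h.bound 0)

theorem continuous (h : HasDecay f f' C) : Continuous f :=
  continuous_iff_continuousAt.2 fun x => (h.hasDerivAt x).continuousAt

theorem truncFourier_eq (h : HasDecay f f' C) {t : ℝ} (ht : t ≠ 0) (R : ℝ) :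
    truncFourier f R t = f R * charPrimitive t R - f (-R) * charPrimitive t (-R) -
      ∫ x in (-R)..R, f' x * charPrimitive t x := by
  unfold truncFourier
  refine intervalIntegral.integral_mul_deriv_eq_deriv_mul (fun x _ => h.hasDerivAt x)
    (fun x _ => hasDerivAt_charPrimitive ht x) (h.continuous_deriv.intervalIntegrable _ _) ?_
  exact (by fun_prop : Continuous _).intervalIntegrable _ _

theorem abs_rpow_le (x : ℝ) {α : ℝ} (h0 : 0 ≤ α) : |x| ^ α ≤ (1 + x ^ 2) ^ (α / 2) := by
  have : |x| ^ α = (x ^ 2) ^ (α / 2) := by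
    rw [← sq_abs, ← Real.rpow_natCast, ← Real.rpow_mul (abs_nonneg _)]
    congr 1; push_cast; ring
  rw [this]
  exact Real.rpow_le_rpow (sq_nonneg _) (by linarith) (by positivity)

theorem norm_mul_charPrimitive_le (h : HasDecay f f' C) {t : ℝ} (ht : t ≠ 0) {α : ℝ}
    (h0 : 0 ≤ α) (h1 : α < 1) (x : ℝ) :
    ‖f x * charPrimitive t x‖ ≤ C * (2 * |t| ^ (α - 1)) := by
  have hx : 0 < 1 + x ^ 2 := by positivity
  have hC := h.nonneg
  rw [norm_mul]
  calc ‖f x‖ * ‖charPrimitive t x‖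
      ≤ (C * (√(1 + x ^ 2))⁻¹) * (2 * |t| ^ (α - 1) * |x| ^ α) := by
        gcongr
        · exact h.bound x
        · exact norm_charPrimitive_le ht x h0 h1.le
    _ ≤ (C * (√(1 + x ^ 2))⁻¹) * (2 * |t| ^ (α - 1) * √(1 + x ^ 2)) := by
        gcongr
        refine (abs_rpow_le x h0).trans ?_
        rw [Real.sqrt_eq_rpow]
        exact Real.rpow_le_rpow_of_exponent_le (by nlinarith [sq_nonneg x]) (by linarith)
    _ = C * (2 * |t| ^ (α - 1)) := by
        have : √(1 + x ^ 2) ≠ 0 := by positivity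
        field_simp

theorem norm_deriv_mul_charPrimitive_le (h : HasDecay f f' C) {t : ℝ} (ht : t ≠ 0) {α : ℝ}
    (h0 : 0 ≤ α) (h1 : α < 1) (x : ℝ) :
    ‖f' x * charPrimitive t x‖ ≤ C * (2 * |t| ^ (α - 1)) * (1 + x ^ 2) ^ (-(2 - α) / 2) := by
  have hx : 0 < 1 + x ^ 2 := by positivity
  have hC := h.nonneg
  rw [norm_mul]
  calc ‖f' x‖ * ‖charPrimitive t x‖
      ≤ (C * (1 + x ^ 2)⁻¹) * (2 * |t| ^ (α - 1) * (1 + x ^ 2) ^ (α / 2)) := by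
        gcongr
        · exact h.bound_deriv x
        · refine (norm_charPrimitive_le ht x h0 h1.le).trans ?_
          gcongr
          exact abs_rpow_le x h0
    _ = _ := by
        rw [show -(2 - α) / 2 = -1 + α / 2 by ring, Real.rpow_add hx, Real.rpow_neg_one]
        ring

theorem integrable_weight {α : ℝ} (h1 : α < 1) :
    Integrable (fun x : ℝ => (1 + x ^ 2) ^ (-(2 - α) / 2)) := by
  simpa using integrable_rpow_neg_one_add_norm_sq (E := ℝ) (μ := volume) (r := 2 - α)
      (by simp; linarith)

theorem integrable_deriv_mul_charPrimitive (h : HasDecay f f' C) {t : ℝ} (ht : t ≠ 0) :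
    Integrable (fun x => f' x * charPrimitive t x) := by
  refine ((integrable_weight (α := 0) (by norm_num)).const_mul
    (C * (2 * |t| ^ ((0 : ℝ) - 1)))).mono' ?_ ?_
  · exact (h.continuous_deriv.mul (continuous_charPrimitive t)).aestronglyMeasurable
  · exact Eventually.of_forall fun x =>
      h.norm_deriv_mul_charPrimitive_le ht le_rfl (by norm_num) x

/-- The truncated Fourier transforms are uniformly bounded by a power of the frequency. -/
theorem norm_truncFourier_le (h : HasDecay f f' C) {t : ℝ} (ht : t ≠ 0) {α : ℝ}
    (h0 : 0 ≤ α) (h1 : α < 1) {R : ℝ} (hR : 0 ≤ R) :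
    ‖truncFourier f R t‖ ≤ C * fourierConst α * |t| ^ (α - 1) := by
  rw [h.truncFourier_eq ht]
  -- The boundary terms of the integration by parts account for the 4 in `fourierConst`, and the
  -- integral of f' for the rest. The condition α < 1 keeps the weight integrable.
  have b1 := h.norm_mul_charPrimitive_le ht h0 h1 R
  have b2 := h.norm_mul_charPrimitive_le ht h0 h1 (-R)
  have hw := (integrable_weight h1).const_mul (C * (2 * |t| ^ (α - 1)))
  have b3 : ‖∫ x in (-R)..R, f' x * charPrimitive t x‖ ≤
      ∫ x : ℝ, C * (2 * |t| ^ (α - 1)) * (1 + x ^ 2) ^ (-(2 - α) / 2) := by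
    rw [intervalIntegral.integral_of_le (by linarith)]
    refine (norm_integral_le_of_norm_le hw.integrableOn (Eventually.of_forall fun x =>
      h.norm_deriv_mul_charPrimitive_le ht h0 h1 x)).trans ?_
    refine setIntegral_le_integral hw (Eventually.of_forall fun x => ?_)
    have := h.nonneg
    simp only [Pi.zero_apply]
    positivity
  rw [integral_const_mul] at b3
  refine (norm_sub_le _ _).trans ?_
  have := norm_sub_le (f R * charPrimitive t R) (f (-R) * charPrimitive t (-R))
  refine (add_le_add (this.trans (add_le_add b1 b2)) b3).trans (le_of_eq ?_)
  rw [fourierConst]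
  ring

/-- After integration by parts the boundary terms tend to 0, because f does and the primitive is
bounded, and the remaining integral converges absolutely. -/
theorem tendsto_truncFourier (h : HasDecay f f' C) {t : ℝ} (ht : t ≠ 0) :
    Tendsto (fun R => truncFourier f R t) atTop (𝓝 (limFourier f t)) := by
  suffices H : Tendsto (fun R => truncFourier f R t) atTop
      (𝓝 (0 - ∫ x, f' x * charPrimitive t x)) by
    rw [limFourier, H.limUnder_eq]; exact H
  simp only [h.truncFourier_eq ht]
  refine Tendsto.sub ?_ (intervalIntegral_tendsto_integral (h.integrable_deriv_mul_charPrimitive ht)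
    tendsto_neg_atTop_atBot tendsto_id)
  have hsq : Tendsto (fun R : ℝ => (√(1 + R ^ 2))⁻¹) atTop (𝓝 0) := by
    refine tendsto_inv_atTop_zero.comp ?_
    refine tendsto_atTop_mono (fun R => ?_) tendsto_id
    exact Real.le_sqrt_of_sq_le (by simp)
  have hb : Tendsto (fun R : ℝ => 2 * (C * (√(1 + R ^ 2))⁻¹ * (2 * |t| ^ ((0 : ℝ) - 1)))) atTop
      (𝓝 0) := by
    simpa using ((hsq.const_mul C).mul_const (2 * |t| ^ ((0 : ℝ) - 1))).const_mul 2
  refine squeeze_zero_norm (fun R => ?_) hb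
  have hc : ∀ x, ‖charPrimitive t x‖ ≤ 2 * |t| ^ ((0 : ℝ) - 1) := fun x => by
    simpa using norm_charPrimitive_le ht x le_rfl zero_le_one
  have hC := h.nonneg
  refine (norm_sub_le _ _).trans ?_
  rw [norm_mul, norm_mul, two_mul]
  have h2 := h.bound (-R)
  rw [neg_sq] at h2
  exact add_le_add (mul_le_mul (h.bound R) (hc R) (norm_nonneg _) (by positivity))
    (mul_le_mul h2 (hc (-R)) (norm_nonneg _) (by positivity))

theorem norm_limFourier_le (h : HasDecay f f' C) {t : ℝ} (ht : t ≠ 0) {α : ℝ}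
    (h0 : 0 ≤ α) (h1 : α < 1) : ‖limFourier f t‖ ≤ C * fourierConst α * |t| ^ (α - 1) :=
  le_of_tendsto (h.tendsto_truncFourier ht).norm
    ((eventually_ge_atTop 0).mono fun _ hR => h.norm_truncFourier_le ht h0 h1 hR)

end HasDecay

theorem truncFourier_eq_fourierT (f : ℝ → ℂ) {R : ℝ} (hR : 0 ≤ R) (t : ℝ) :
    truncFourier f R t = fourierT ((Ioc (-R) R).indicator f) t := by
  rw [truncFourier, fourierT, intervalIntegral.integral_of_le (by linarith),
    ← integral_indicator measurableSet_Ioc]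
  congr 1; funext x
  rw [indicator_mul_left]

/-- Domination of the product of two Fourier transforms of functions with decay. -/
theorem norm_abs_cpow_mul_le {u : ℂ} (h0 : 0 < u.re) (h1 : u.re < 1) {t : ℝ} (ht : t ≠ 0)
    {A B : ℂ} {C₁ C₂ : ℝ} (hC₁ : 0 ≤ C₁) (hC₂ : 0 ≤ C₂)
    (hA : ∀ α : ℝ, 0 ≤ α → α < 1 → ‖A‖ ≤ C₁ * fourierConst α * |t| ^ (α - 1))
    (hB : ∀ α : ℝ, 0 ≤ α → α < 1 → ‖B‖ ≤ C₂ * fourierConst α * |t| ^ (α - 1)) :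
    ‖((|t| : ℝ) : ℂ) ^ (u - 1) * (A * B)‖ ≤
      C₁ * C₂ * (fourierConst 0 ^ 2 + fourierConst (1 - u.re / 4) ^ 2) *
        (if |t| ≤ 1 then |t| ^ (u.re / 2 - 1) else |t| ^ (u.re - 3)) := by
  have ht' : 0 < |t| := abs_pos.2 ht
  have key : ∀ α : ℝ, 0 ≤ α → α < 1 → ‖((|t| : ℝ) : ℂ) ^ (u - 1) * (A * B)‖ ≤
      C₁ * C₂ * fourierConst α ^ 2 * |t| ^ (u.re - 1 + 2 * (α - 1)) := by
    intro α hα0 hα1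
    have n := fourierConst_nonneg α
    rw [norm_mul, norm_mul, Complex.norm_cpow_eq_rpow_re_of_pos ht', Complex.sub_re,
      Complex.one_re]
    calc |t| ^ (u.re - 1) * (‖A‖ * ‖B‖) ≤ |t| ^ (u.re - 1) *
          ((C₁ * fourierConst α * |t| ^ (α - 1)) * (C₂ * fourierConst α * |t| ^ (α - 1))) := by
          have := hA α hα0 hα1
          have := hB α hα0 hα1
          gcongr
      _ = _ := by
          rw [two_mul, Real.rpow_add ht', Real.rpow_add ht']; ring
  -- Near 0 the choice α = 1 - Re(u)/4 gives the exponent Re(u)/2 - 1 > -1; for |t| > 1 the choice α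
  -- = 0 gives Re(u) - 3 < -1.
  split_ifs with h
  · refine (key (1 - u.re / 4) (by linarith) (by linarith)).trans ?_
    rw [show u.re - 1 + 2 * (1 - u.re / 4 - 1) = u.re / 2 - 1 by ring]
    gcongr
    nlinarith [sq_nonneg (fourierConst 0)]
  · refine (key 0 le_rfl (by linarith)).trans ?_
    rw [show u.re - 1 + 2 * ((0 : ℝ) - 1) = u.re - 3 by ring]
    gcongr
    nlinarith [sq_nonneg (fourierConst (1 - u.re / 4))]

/-- The Fourier transform of `|t| ^ (u - 1)`, tested against functions with decay. -/
theorem integral_abs_cpow_mul_limFourier {u : ℂ} (h0 : 0 < u.re) (h1 : u.re < 1)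
    {f₁ f₁' f₂ f₂' : ℝ → ℂ} {C₁ C₂ : ℝ} (h₁ : HasDecay f₁ f₁' C₁) (h₂ : HasDecay f₂ f₂' C₂) :
    ∫ t : ℝ, ((|t| : ℝ) : ℂ) ^ (u - 1) * (limFourier f₁ t * conj (limFourier f₂ t)) =
      G₀ u * ∫ y : ℝ, ∫ x : ℝ, ((|x - y| : ℝ) : ℂ) ^ (-u) * f₁ x * conj (f₂ y) := by
  have hu : (-u).re ≠ 0 := by simp; linarith
  -- Truncation produces integrable functions, to which the Gaussian argument applies; both sides
  -- then pass to the limit by domination.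
  set g₁ : ℕ → ℝ → ℂ := fun n => (Ioc (-(n : ℝ)) n).indicator f₁ with hg₁
  set g₂ : ℕ → ℝ → ℂ := fun n => (Ioc (-(n : ℝ)) n).indicator f₂ with hg₂
  have i₁ : ∀ n, Integrable (g₁ n) := fun n =>
    (integrable_indicator_iff measurableSet_Ioc).2
      (h₁.continuous.integrableOn_Icc.mono_set Ioc_subset_Icc_self)
  have i₂ : ∀ n, Integrable (g₂ n) := fun n =>
    (integrable_indicator_iff measurableSet_Ioc).2
      (h₂.continuous.integrableOn_Icc.mono_set Ioc_subset_Icc_self)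
  have t₁ : ∀ n : ℕ, ∀ t, fourierT (g₁ n) t = truncFourier f₁ n t := fun n t =>
    (truncFourier_eq_fourierT f₁ n.cast_nonneg t).symm
  have t₂ : ∀ n : ℕ, ∀ t, fourierT (g₂ n) t = truncFourier f₂ n t := fun n t =>
    (truncFourier_eq_fourierT f₂ n.cast_nonneg t).symm
  have hdom : Integrable (fun t : ℝ =>
      C₁ * C₂ * (fourierConst 0 ^ 2 + fourierConst (1 - u.re / 4) ^ 2) *
        (if |t| ≤ 1 then |t| ^ (u.re / 2 - 1) else |t| ^ (u.re - 3))) :=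
    (integrable_rpow_piecewise (by linarith) (by linarith)).const_mul _
  have hb : ∀ n : ℕ, ∀ᵐ t : ℝ, ‖((|t| : ℝ) : ℂ) ^ (u - 1) *
      (fourierT (g₁ n) t * conj (fourierT (g₂ n) t))‖ ≤
      C₁ * C₂ * (fourierConst 0 ^ 2 + fourierConst (1 - u.re / 4) ^ 2) *
        (if |t| ≤ 1 then |t| ^ (u.re / 2 - 1) else |t| ^ (u.re - 3)) := by
    intro n
    filter_upwards [Measure.ae_ne volume 0] with t ht
    rw [t₁, t₂]
    refine norm_abs_cpow_mul_le h0 h1 ht h₁.nonneg h₂.nonneg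
      (fun α ha hb => h₁.norm_truncFourier_le ht ha hb n.cast_nonneg) (fun α ha hb => ?_)
    rw [RCLike.norm_conj]
    exact h₂.norm_truncFourier_le ht ha hb n.cast_nonneg
  have hm : ∀ n : ℕ, AEStronglyMeasurable (fun t : ℝ => ((|t| : ℝ) : ℂ) ^ (u - 1) *
      (fourierT (g₁ n) t * conj (fourierT (g₂ n) t))) := fun n =>
    (by fun_prop : Measurable fun t : ℝ => ((|t| : ℝ) : ℂ) ^ (u - 1)).aestronglyMeasurable.mul
      ((continuous_fourierT (i₁ n)).mul (Complex.continuous_conj.comp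
        (continuous_fourierT (i₂ n)))).aestronglyMeasurable
  have hkm : Measurable (fun p : ℝ × ℝ => ((|p.1 - p.2| : ℝ) : ℂ) ^ (-u)) := by fun_prop
  have hdom2 : Integrable (fun p : ℝ × ℝ => C₁ * C₂ * (|p.1 - p.2| ^ (-u.re) *
      ((√(1 + p.1 ^ 2))⁻¹ * (√(1 + p.2 ^ 2))⁻¹))) := (integrable_line_kernel h0 h1).const_mul _
  have hb2' : ∀ p : ℝ × ℝ, ∀ a b : ℂ, ‖a‖ ≤ ‖f₁ p.1‖ → ‖b‖ ≤ ‖f₂ p.2‖ →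
      ‖((|p.1 - p.2| : ℝ) : ℂ) ^ (-u) * (a * conj b)‖ ≤
      C₁ * C₂ * (|p.1 - p.2| ^ (-u.re) * ((√(1 + p.1 ^ 2))⁻¹ * (√(1 + p.2 ^ 2))⁻¹)) := by
    intro p a b ha hb
    rw [norm_mul, norm_mul, RCLike.norm_conj,
      Complex.norm_cpow_eq_rpow_re_of_nonneg (abs_nonneg _) hu, Complex.neg_re]
    have c1 := h₁.nonneg
    have c2 := h₂.nonneg
    calc |p.1 - p.2| ^ (-u.re) * (‖a‖ * ‖b‖) ≤ |p.1 - p.2| ^ (-u.re) *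
        ((C₁ * (√(1 + p.1 ^ 2))⁻¹) * (C₂ * (√(1 + p.2 ^ 2))⁻¹)) := by
          have := ha.trans (h₁.bound p.1)
          have := hb.trans (h₂.bound p.2)
          gcongr
      _ = _ := by ring
  have hb2 : ∀ n : ℕ, ∀ p : ℝ × ℝ, ‖((|p.1 - p.2| : ℝ) : ℂ) ^ (-u) *
      (g₁ n p.1 * conj (g₂ n p.2))‖ ≤
      C₁ * C₂ * (|p.1 - p.2| ^ (-u.re) * ((√(1 + p.1 ^ 2))⁻¹ * (√(1 + p.2 ^ 2))⁻¹)) := fun n p =>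
    hb2' p _ _ (norm_indicator_le_norm_self _ _) (norm_indicator_le_norm_self _ _)
  have hm2 : ∀ n : ℕ, AEStronglyMeasurable (fun p : ℝ × ℝ => ((|p.1 - p.2| : ℝ) : ℂ) ^ (-u) *
      (g₁ n p.1 * conj (g₂ n p.2))) := fun n =>
    hkm.aestronglyMeasurable.mul
      ((i₁ n).mul_prod (Complex.conjCLE.integrable_comp_iff.2 (i₂ n))).1
  have hfull : Integrable (fun p : ℝ × ℝ => ((|p.1 - p.2| : ℝ) : ℂ) ^ (-u) *
      (f₁ p.1 * conj (f₂ p.2))) := by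
    refine hdom2.mono' ?_ (Eventually.of_forall fun p => hb2' p _ _ le_rfl le_rfl)
    exact hkm.aestronglyMeasurable.mul ((h₁.continuous.comp continuous_fst).mul
      (Complex.continuous_conj.comp (h₂.continuous.comp continuous_snd))).aestronglyMeasurable
  have heq : ∀ n : ℕ, ∫ t : ℝ, ((|t| : ℝ) : ℂ) ^ (u - 1) *
      (fourierT (g₁ n) t * conj (fourierT (g₂ n) t)) = G₀ u * ∫ p : ℝ × ℝ,
        ((|p.1 - p.2| : ℝ) : ℂ) ^ (-u) * (g₁ n p.1 * conj (g₂ n p.2)) := fun n =>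
    integral_abs_cpow_mul_fourierT h0 h1 (i₁ n) (i₂ n) (hdom.mono' (hm n) (hb n))
      (hdom2.mono' (hm2 n) (Eventually.of_forall (hb2 n)))
  have hL := tendsto_integral_of_dominated_convergence
    (f := fun t : ℝ => ((|t| : ℝ) : ℂ) ^ (u - 1) * (limFourier f₁ t * conj (limFourier f₂ t)))
    _ hm hdom hb (by
      filter_upwards [Measure.ae_ne volume 0] with t ht
      simp only [t₁, t₂]
      refine Tendsto.const_mul _ (Tendsto.mul ?_ ?_)
      · exact (h₁.tendsto_truncFourier ht).comp tendsto_natCast_atTop_atTop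
      · exact (Complex.continuous_conj.tendsto _).comp
          ((h₂.tendsto_truncFourier ht).comp tendsto_natCast_atTop_atTop))
  have hind : ∀ (f : ℝ → ℂ) (x : ℝ),
      Tendsto (fun n : ℕ => (Ioc (-(n : ℝ)) n).indicator f x) atTop (𝓝 (f x)) := by
    intro f x
    refine tendsto_const_nhds.congr' ?_
    filter_upwards [tendsto_natCast_atTop_atTop.eventually (eventually_gt_atTop |x|)] with n hn
    rw [indicator_of_mem]
    exact ⟨(abs_lt.1 hn).1, (abs_lt.1 hn).2.le⟩
  have hR := (tendsto_integral_of_dominated_convergence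
    (f := fun p : ℝ × ℝ => ((|p.1 - p.2| : ℝ) : ℂ) ^ (-u) * (f₁ p.1 * conj (f₂ p.2)))
    _ hm2 hdom2 (fun n => Eventually.of_forall (hb2 n)) (Eventually.of_forall fun p => by
      refine Tendsto.const_mul _ (Tendsto.mul (hind f₁ p.1) ?_)
      exact (Complex.continuous_conj.tendsto _).comp (hind f₂ p.2))).const_mul (G₀ u)
  simp only [heq] at hL
  rw [tendsto_nhds_unique hL hR]
  congr 1
  rw [Measure.volume_eq_prod, integral_prod_symm _ hfull]
  simp only [mul_assoc]

/-! ### Smooth vectors and their Whittaker functions. -/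

theorem hasDerivAt_sqrt_cpow (c : ℂ) (x : ℝ) :
    HasDerivAt (fun x : ℝ => ((√(1 + x ^ 2) : ℝ) : ℂ) ^ c)
      (((√(1 + x ^ 2) : ℝ) : ℂ) ^ c * (c * x * ((1 + x ^ 2)⁻¹ : ℝ))) x := by
  have e : ∀ x : ℝ, ((√(1 + x ^ 2) : ℝ) : ℂ) ^ c =
      Complex.exp (((Real.log (1 + x ^ 2) / 2 : ℝ) : ℂ) * c) := fun x => by
    have h : 0 < √(1 + x ^ 2) := by positivity
    rw [Complex.cpow_def_of_ne_zero (by exact_mod_cast h.ne'), ← Complex.ofReal_log h.le,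
      Real.log_sqrt (by positivity)]
  simp only [e]
  have h1 : HasDerivAt (fun x : ℝ => Real.log (1 + x ^ 2) / 2) (x * (1 + x ^ 2)⁻¹) x := by
    have h2 : HasDerivAt (fun x : ℝ => 1 + x ^ 2) (2 * x) x := by
      simpa using (hasDerivAt_pow 2 x).const_add 1
    have h3 := (h2.log (by positivity)).div_const 2
    exact h3.congr_deriv (by field_simp)
  have h4 := (h1.ofReal_comp.mul_const c).cexp
  refine h4.congr_deriv ?_
  push_cast
  ring

theorem UnitarySeries.periodic_deriv (F : SLpm → ℂ) :
    Function.Periodic (deriv fun θ => F (rot θ)) (2 * π) := fun θ => by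
  have h : (fun θ => F (rot (θ + 2 * π))) = fun θ => F (rot θ) := by
    funext θ; rw [rot_add_two_pi]
  rw [← deriv_comp_add_const, h]

/-- The noncompact pictures of the translates of a smooth vector under `K` decay uniformly. -/
theorem LowerHomog.exists_hasDecay {c : ℂ} (hc : c.re = 1) {F : SLpm → ℂ} (hF : LowerHomog c F)
    (hs : ContDiff ℝ ∞ (fun θ => F (rot θ))) :
    ∃ C, ∀ θ, ∃ f', HasDecay (fun x => F (rot θ * unip x)) f' C := by
  obtain ⟨H₀, hH₀, b₀⟩ := (UnitarySeries.periodic_two_pi F).exists_norm_le two_pi_pos hs.continuous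
  have hcd : Continuous (deriv fun θ => F (rot θ)) := hs.continuous_deriv (by simp)
  obtain ⟨H₁, hH₁, b₁⟩ := (UnitarySeries.periodic_deriv F).exists_norm_le two_pi_pos hcd
  -- `H₀` bounds the function; in the derivative, ‖c‖ `H₀` comes from the weight (1+x²)^(-c/2) and
  -- `H₁` from the chain rule. Being suprema over the circle, they serve every θ.
  refine ⟨H₀ + (‖c‖ * H₀ + H₁), fun θ => ?_⟩
  set h : ℝ → ℂ := fun θ => F (rot θ) with hh
  have hu : ∀ x, F (rot θ * unip x) =
      ((√(1 + x ^ 2) : ℝ) : ℂ) ^ (-c) * h (θ - arctan x) := fun x => by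
    rw [hF.mul_unip, ← rot_add, ← sub_eq_add_neg]
  refine ⟨fun x => ((√(1 + x ^ 2) : ℝ) : ℂ) ^ (-c) * ((1 + x ^ 2)⁻¹ : ℝ) *
    (-c * x * h (θ - arctan x) - deriv h (θ - arctan x)), ?_, ?_, ?_, ?_⟩
  · intro x
    simp only [hu]
    have hd : HasDerivAt h (deriv h (θ - arctan x)) (θ - arctan x) :=
      (hs.differentiable (by simp) _).hasDerivAt
    have h1 := hd.scomp x ((hasDerivAt_arctan x).const_sub θ)
    have h2 := (hasDerivAt_sqrt_cpow (-c) x).mul h1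
    refine h2.congr_deriv ?_
    simp only [Function.comp, Complex.real_smul]
    push_cast
    ring
  · have c1 := continuous_ofReal_sqrt_cpow (-c)
    have c2 : Continuous (fun x : ℝ => (1 + x ^ 2)⁻¹) :=
      Continuous.inv₀ (by fun_prop) fun x => by positivity
    have c3 : Continuous (fun x : ℝ => θ - arctan x) := by fun_prop
    have c4 : Continuous (fun x : ℝ => h (θ - arctan x)) := hs.continuous.comp c3
    have c5 : Continuous (fun x : ℝ => deriv h (θ - arctan x)) := hcd.comp c3
    have c6 : Continuous (fun x : ℝ => (((1 + x ^ 2)⁻¹ : ℝ) : ℂ)) :=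
      Complex.continuous_ofReal.comp c2
    exact (c1.mul c6).mul (((continuous_const.mul Complex.continuous_ofReal).mul c4).sub c5)
  · intro x
    rw [hu, norm_mul, norm_ofReal_cpow_neg hc, mul_comm]
    gcongr
    exact (b₀ _).trans (by nlinarith [norm_nonneg c])
  · intro x
    set X := √(1 + x ^ 2) with hX
    have hX1 : 1 ≤ X := Real.one_le_sqrt.2 (by nlinarith [sq_nonneg x])
    have hxX : |x| ≤ X := Real.le_sqrt_of_sq_le (by rw [sq_abs]; linarith)
    have hX0 : 0 < X := by linarith
    rw [norm_mul, norm_mul, norm_ofReal_cpow_neg hc, Complex.norm_real,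
      norm_of_nonneg (by positivity : 0 ≤ (1 + x ^ 2)⁻¹), ← hX]
    have hb : ‖-c * x * h (θ - arctan x) - deriv h (θ - arctan x)‖ ≤ (‖c‖ * H₀ + H₁) * X := by
      refine (norm_sub_le _ _).trans ?_
      rw [norm_mul, norm_mul, norm_neg, Complex.norm_real, norm_eq_abs]
      have e1 : ‖c‖ * |x| * ‖h (θ - arctan x)‖ ≤ ‖c‖ * X * H₀ := by
        gcongr
        exact b₀ _
      have e2 : ‖deriv h (θ - arctan x)‖ ≤ H₁ * X :=
        (b₁ _).trans (le_mul_of_one_le_right hH₁ hX1)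
      linarith
    calc X⁻¹ * (1 + x ^ 2)⁻¹ * ‖-c * x * h (θ - arctan x) - deriv h (θ - arctan x)‖
        ≤ X⁻¹ * (1 + x ^ 2)⁻¹ * ((‖c‖ * H₀ + H₁) * X) := by gcongr
      _ = (‖c‖ * H₀ + H₁) * (1 + x ^ 2)⁻¹ := by field_simp
      _ ≤ _ := mul_le_mul_of_nonneg_right (by linarith) (by positivity)

/-- The improper integral that defines the Whittaker function of a smooth vector converges. -/
theorem LowerHomog.tendsto_truncatedWhittaker {c : ℂ} (hc : c.re = 1) {F : SLpm → ℂ}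
    (hF : LowerHomog c F) (hs : ContDiff ℝ ∞ (fun θ => F (rot θ))) (g : SLpm) :
    Tendsto (truncatedWhittaker (leftTranslate g⁻¹ F)) atTop (𝓝 (Wh F g)) := by
  have hs' : ContDiff ℝ ∞ (fun θ => leftTranslate g⁻¹ F (rot θ)) := by
    simpa using hF.contDiff_mul_rot hs g
  obtain ⟨C, hC⟩ := (hF.translate g⁻¹).exists_hasDecay hc hs'
  obtain ⟨f', hf'⟩ := hC 0
  have e : (fun R => truncFourier (fun x => leftTranslate g⁻¹ F (rot 0 * unip x)) R 1) =
      truncatedWhittaker (leftTranslate g⁻¹ F) := by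
    funext R
    simp only [truncFourier, truncatedWhittaker, noncompactPicture, rot_zero, one_mul,
      Complex.ofReal_one]
  have h := hf'.tendsto_truncFourier one_ne_zero
  rw [limFourier, e] at h
  exact h

theorem truncFourier_scale (f : ℝ → ℂ) {b : ℝ} (hb : b ≠ 0) (R : ℝ) :
    ∫ x in (-R)..R, f (b * x) * Complex.exp (-2 * π * Complex.I * x) =
      ((|b|⁻¹ : ℝ) : ℂ) * truncFourier f (|b| * R) b⁻¹ := by
  have hbC : (b : ℂ) ≠ 0 := by exact_mod_cast hb
  have h := intervalIntegral.integral_comp_mul_left (a := -R) (b := R)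
    (fun y : ℝ => f y * Complex.exp (-2 * π * Complex.I * ((b⁻¹ : ℝ) * y))) hb
  have e : ∀ x : ℝ, f (b * x) * Complex.exp (-2 * π * Complex.I * ((b⁻¹ : ℝ) * (b * x : ℝ))) =
      f (b * x) * Complex.exp (-2 * π * Complex.I * x) := fun x => by
    congr 3; push_cast; field_simp
  simp only [e] at h
  rw [h, truncFourier, Complex.real_smul]
  rcases lt_or_gt_of_ne hb with hb' | hb'
  · rw [abs_of_neg hb', intervalIntegral.integral_symm, show -(-b * R) = b * R by ring,
      show -b * R = b * -R by ring, inv_neg, Complex.ofReal_neg]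
    ring
  · rw [abs_of_pos hb', mul_neg]

/-- Moving d_a past n_x contributes |a|^c and dilates x by a|a|. Undoing the dilation changes the
frequency from 1 to (a|a|)⁻¹ and costs a Jacobian |a|⁻². The computation is made on truncated
integrals, since the full ones converge only conditionally. -/
theorem LowerHomog.Wh_rot_mul_diag {c : ℂ} (hc : c.re = 1) {F : SLpm → ℂ}
    (hF : LowerHomog c F) (hs : ContDiff ℝ ∞ (fun θ => F (rot θ))) (θ : ℝ) {a : ℝ} (ha : a ≠ 0) :
    Wh F (rot θ * diag a) = ((|a| : ℝ) : ℂ) ^ (c - 2) *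
      limFourier (fun x => F (rot θ * unip x)) (a * |a|)⁻¹ := by
  have ha' : 0 < |a| := abs_pos.2 ha
  have haC : ((|a| : ℝ) : ℂ) ≠ 0 := by exact_mod_cast ha'.ne'
  have hb : a * |a| ≠ 0 := mul_ne_zero ha ha'.ne'
  have hbabs : abs (a * |a|) = |a| ^ 2 := by rw [abs_mul, abs_abs, sq]
  obtain ⟨C, hC⟩ := hF.exists_hasDecay hc hs
  obtain ⟨f', hf'⟩ := hC θ
  have h1 := hF.tendsto_truncatedWhittaker hc hs (rot θ * diag a)
  have h2 : Tendsto (fun R => abs (a * |a|) * R) atTop atTop :=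
    tendsto_id.const_mul_atTop (abs_pos.2 hb)
  have h3 := ((hf'.tendsto_truncFourier (inv_ne_zero hb)).comp h2).const_mul
    (((|a| : ℝ) : ℂ) ^ (c - 2))
  refine tendsto_nhds_unique h1 (h3.congr fun R => ?_)
  have h4 := truncFourier_scale (fun x => F (rot θ * unip x)) hb R
  have h5 : truncatedWhittaker (leftTranslate (rot θ * diag a)⁻¹ F) R = ((|a| : ℝ) : ℂ) ^ c *
      ∫ x in (-R)..R, F (rot θ * unip (a * |a| * x)) * Complex.exp (-2 * π * Complex.I * x) := by
    rw [← intervalIntegral.integral_const_mul, truncatedWhittaker]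
    congr 1; funext x
    rw [noncompactPicture, leftTranslate_apply, inv_inv, hF.mul_diag_unip (rot θ) ha, mul_assoc]
  rw [h5, h4, ← mul_assoc, Function.comp, hbabs, Complex.cpow_sub _ _ haC, div_eq_mul_inv]
  congr 2
  norm_cast

theorem continuous_truncFourier {c : ℂ} {F : SLpm → ℂ}
    (hF : LowerHomog c F) (hs : ContDiff ℝ ∞ (fun θ => F (rot θ))) (R : ℝ) :
    Continuous (fun p : ℝ × ℝ => truncFourier (fun x => F (rot p.1 * unip x)) R p.2) := by
  unfold truncFourier
  apply intervalIntegral.continuous_parametric_intervalIntegral_of_continuous'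
  have e : ∀ θ x, F (rot θ * unip x) = ((√(1 + x ^ 2) : ℝ) : ℂ) ^ (-c) *
      (fun θ => F (rot θ)) (θ - arctan x) := fun θ x => by
    rw [hF.mul_unip, ← rot_add, ← sub_eq_add_neg]
  simp only [e]
  have c1 := (continuous_ofReal_sqrt_cpow (-c)).comp
    (continuous_snd : Continuous fun q : (ℝ × ℝ) × ℝ => q.2)
  have c2 : Continuous (fun q : (ℝ × ℝ) × ℝ => (fun θ => F (rot θ)) (q.1.1 - arctan q.2)) :=
    hs.continuous.comp (by fun_prop : Continuous fun q : (ℝ × ℝ) × ℝ => q.1.1 - arctan q.2)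
  exact (c1.mul c2).mul (by fun_prop)

/-- `Wh` is defined by a limit; its measurability comes from the truncated transforms, which are
jointly continuous in angle and frequency. -/
theorem aestronglyMeasurable_Wh {c : ℂ} (hc : c.re = 1) {F : SLpm → ℂ}
    (hF : LowerHomog c F) (hs : ContDiff ℝ ∞ (fun θ => F (rot θ))) (μ : Measure ℝ) [SFinite μ] :
    AEStronglyMeasurable (fun p : ℝ × ℝ => Wh F (rot p.1 * diag p.2)) (μ.prod volume) := by
  refine aestronglyMeasurable_of_tendsto_ae atTop (f := fun (n : ℕ) (p : ℝ × ℝ) =>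
    ((|p.2| : ℝ) : ℂ) ^ (c - 2) *
      truncFourier (fun x => F (rot p.1 * unip x)) n (p.2 * |p.2|)⁻¹) (fun n => ?_) ?_
  · have m1 : Measurable (fun p : ℝ × ℝ => ((|p.2| : ℝ) : ℂ) ^ (c - 2)) := by fun_prop
    have m2 : Measurable (fun p : ℝ × ℝ => (p.1, (p.2 * |p.2|)⁻¹)) := by fun_prop
    exact (m1.mul ((continuous_truncFourier hF hs n).measurable.comp m2)).aestronglyMeasurable
  · have h0 : ∀ᵐ p : ℝ × ℝ ∂(μ.prod volume), p.2 ≠ 0 :=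
      Measure.quasiMeasurePreserving_snd.ae (Measure.ae_ne volume 0)
    filter_upwards [h0] with p hp
    obtain ⟨C, hC⟩ := hF.exists_hasDecay hc hs
    obtain ⟨f', hf'⟩ := hC p.1
    rw [hF.Wh_rot_mul_diag hc hs p.1 hp]
    exact ((hf'.tendsto_truncFourier (inv_ne_zero (mul_ne_zero hp (abs_ne_zero.2 hp)))).comp
      tendsto_natCast_atTop_atTop).const_mul _

/-! ### The substitution t = 1/(a|a|) and the Rankin–Selberg integral. -/

theorem hasDerivAt_inv_mul_abs {a : ℝ} (ha : a ≠ 0) :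
    HasDerivAt (fun a : ℝ => (a * |a|)⁻¹) (-(2 * |a|) / (a * |a|) ^ 2) a := by
  have h1 := (hasDerivAt_id a).mul (hasDerivAt_abs ha)
  have h2 := h1.inv (mul_ne_zero ha (abs_ne_zero.2 ha))
  refine h2.congr_deriv ?_
  simp only [id, one_mul]
  rw [self_mul_sign, two_mul]
  rfl

theorem abs_deriv_inv_mul_abs {a : ℝ} (ha : a ≠ 0) :
    |-(2 * |a|) / (a * |a|) ^ 2| = 2 * (|a| ^ 3)⁻¹ := by
  have := abs_ne_zero.2 ha
  rw [abs_div, abs_neg, abs_mul, abs_abs, abs_pow, abs_mul, abs_abs, abs_two]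
  field_simp

theorem injOn_inv_mul_abs : InjOn (fun a : ℝ => (a * |a|)⁻¹) {0}ᶜ := by
  intro a ha b hb h
  have h : a * |a| = b * |b| := inv_injective h
  have ha : a ≠ 0 := ha
  have hb : b ≠ 0 := hb
  rcases lt_or_gt_of_ne ha with h1 | h1 <;> rcases lt_or_gt_of_ne hb with h2 | h2
  · rw [abs_of_neg h1, abs_of_neg h2] at h; nlinarith
  · rw [abs_of_neg h1, abs_of_pos h2] at h; nlinarith
  · rw [abs_of_pos h1, abs_of_neg h2] at h; nlinarith
  · rw [abs_of_pos h1, abs_of_pos h2] at h; nlinarith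

theorem image_inv_mul_abs : (fun a : ℝ => (a * |a|)⁻¹) '' {0}ᶜ = {0}ᶜ := by
  ext t
  constructor
  · rintro ⟨a, ha, rfl⟩
    exact inv_ne_zero (mul_ne_zero ha (abs_ne_zero.2 ha))
  · intro ht
    have ht : t ≠ 0 := ht
    rcases lt_or_gt_of_ne ht with h | h
    · have hp : 0 < -t := by linarith
      have hs : 0 < √(-t) := by positivity
      refine ⟨-(√(-t))⁻¹, by simp [hs.ne'], ?_⟩
      simp only [abs_neg, abs_inv, abs_of_pos hs]
      rw [neg_mul, ← mul_inv, Real.mul_self_sqrt hp.le]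
      simp
    · have hs : 0 < √t := by positivity
      refine ⟨(√t)⁻¹, by simp [hs.ne'], ?_⟩
      simp only [abs_inv, abs_of_pos hs]
      rw [← mul_inv, Real.mul_self_sqrt h.le, inv_inv]

theorem restrict_compl_zero : (volume : Measure ℝ).restrict {0}ᶜ = volume :=
  Measure.restrict_eq_self_of_ae_mem (Measure.ae_ne volume 0)

/-- The signed map a ↦ (a|a|)⁻¹ is a bijection of ℝ ∖ {0} with Jacobian 2|a|⁻³, hence the factor
1/2. -/
theorem integral_comp_inv_mul_abs (Q : ℝ → ℂ) :
    ∫ a : ℝ, (((|a| ^ 3)⁻¹ : ℝ) : ℂ) * Q (a * |a|)⁻¹ = 1 / 2 * ∫ t, Q t := by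
  have h := integral_image_eq_integral_abs_deriv_smul (measurableSet_singleton (0 : ℝ)).compl
    (fun a ha => (hasDerivAt_inv_mul_abs ha).hasDerivWithinAt) injOn_inv_mul_abs Q
  have h2 : ∫ a in {0}ᶜ, |-(2 * |a|) / (a * |a|) ^ 2| • Q (a * |a|)⁻¹ =
      ∫ a in {0}ᶜ, (2 : ℂ) * ((((|a| ^ 3)⁻¹ : ℝ) : ℂ) * Q (a * |a|)⁻¹) :=
    setIntegral_congr_fun (measurableSet_singleton (0 : ℝ)).compl fun a ha => by
      simp only [abs_deriv_inv_mul_abs ha, Complex.real_smul]; push_cast; ring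
  rw [image_inv_mul_abs, h2, restrict_compl_zero, integral_const_mul] at h
  rw [h]
  ring

theorem integrable_comp_inv_mul_abs {Q : ℝ → ℝ} (hQ : Integrable Q) :
    Integrable (fun a : ℝ => (|a| ^ 3)⁻¹ * Q (a * |a|)⁻¹) := by
  have h := integrableOn_image_iff_integrableOn_abs_deriv_smul
    (measurableSet_singleton (0 : ℝ)).compl
    (fun a ha => (hasDerivAt_inv_mul_abs ha).hasDerivWithinAt) injOn_inv_mul_abs Q
  rw [image_inv_mul_abs] at h
  have h2 := (h.1 hQ.integrableOn).congr_fun (g := fun a => 2 * ((|a| ^ 3)⁻¹ * Q (a * |a|)⁻¹))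
    (fun a ha => by simp only [abs_deriv_inv_mul_abs ha, smul_eq_mul]; ring)
    (measurableSet_singleton (0 : ℝ)).compl
  rw [IntegrableOn, restrict_compl_zero] at h2
  refine (h2.const_mul (1 / 2)).congr (Eventually.of_forall fun a => ?_)
  simp only
  ring

section RankinSelberg

variable {l₁ l₂ : ℝ} {s : ℂ} {F₁ F₂ Φ : SLpm → ℂ}

/-- The Rankin–Selberg integrand in terms of Fourier transforms at `t = (a|a|)⁻¹`. -/
theorem rsIntegrand_eq (h₁ : LowerHomog (Complex.I * l₁ + 1) F₁)
    (h₂ : LowerHomog (Complex.I * l₂ + 1) F₂) (hΦ : UpperHomog (-(2 * s - 1 + 1)) Φ)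
    (s₁ : ContDiff ℝ ∞ (fun θ => F₁ (rot θ))) (s₂ : ContDiff ℝ ∞ (fun θ => F₂ (rot θ)))
    (θ : ℝ) {a : ℝ} (ha : a ≠ 0) :
    rsIntegrand F₁ F₂ Φ (θ, a) = Φ (rot θ) / (2 * π) * ((((|a| ^ 3)⁻¹ : ℝ) : ℂ) *
      (((|(a * |a|)⁻¹| : ℝ) : ℂ) ^ (uParam l₁ l₂ s - 1) *
        (limFourier (fun x => F₁ (rot θ * unip x)) (a * |a|)⁻¹ *
          conj (limFourier (fun x => F₂ (rot θ * unip x)) (a * |a|)⁻¹)))) := by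
  have ha' : 0 < |a| := abs_pos.2 ha
  have haC : ((|a| : ℝ) : ℂ) ≠ 0 := by exact_mod_cast ha'.ne'
  rw [rsIntegrand, h₁.Wh_rot_mul_diag (by simp) s₁ θ ha, h₂.Wh_rot_mul_diag (by simp) s₂ θ ha,
    map_mul, Complex.conj_ofReal_cpow ha'.le, hΦ _ _ (diag_upper ha), diag_zero_zero ha]
  have e1 : ((|(a * |a|)⁻¹| : ℝ) : ℂ) ^ (uParam l₁ l₂ s - 1) =
      ((|a| : ℝ) : ℂ) ^ (-(uParam l₁ l₂ s - 1) + -(uParam l₁ l₂ s - 1)) := by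
    rw [abs_inv, abs_mul, abs_abs, Complex.ofReal_inv_cpow (by positivity), Complex.ofReal_mul,
      Complex.mul_cpow_ofReal_nonneg ha'.le ha'.le, ← Complex.cpow_add _ _ haC]
  have e2 : (((|a| ^ 3)⁻¹ : ℝ) : ℂ) = ((|a| : ℝ) : ℂ) ^ (-3 : ℂ) := by
    rw [Complex.cpow_neg]; norm_cast
  have e3 : ((|a| ^ 2 / |a| / (2 * π) : ℝ) : ℂ) = ((|a| : ℝ) : ℂ) ^ (1 : ℂ) / (2 * π) := by
    rw [Complex.cpow_one]; push_cast; field_simp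
  -- Both sides have exponent -1 - 2u: the left is (iλ₁ - 1) + (-iλ₂ - 1) - 2s + 1, the right -3 -
  -- 2(u - 1).
  have e4 : ((|a| : ℝ) : ℂ) ^ (Complex.I * l₁ + 1 - 2) *
      ((|a| : ℝ) : ℂ) ^ conj (Complex.I * l₂ + 1 - 2) * ((|a| : ℝ) : ℂ) ^ (-(2 * s - 1 + 1)) *
      ((|a| : ℝ) : ℂ) ^ (1 : ℂ) = ((|a| : ℝ) : ℂ) ^ (-3 : ℂ) *
      ((|a| : ℝ) : ℂ) ^ (-(uParam l₁ l₂ s - 1) + -(uParam l₁ l₂ s - 1)) := by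
    simp only [← Complex.cpow_add _ _ haC]
    congr 1
    simp [uParam, Complex.conj_ofNat]
    ring
  simp only [e1, e2, e3]
  linear_combination Φ (rot θ) / (2 * π) *
    (limFourier (fun x => F₁ (rot θ * unip x)) (a * |a|)⁻¹ *
          conj (limFourier (fun x => F₂ (rot θ * unip x)) (a * |a|)⁻¹)) * e4

/-- The decay constants are uniform in θ, so a single integrable function of a dominates the
integrand over the whole circle. -/
theorem integrable_rsIntegrand (hs₀ : 0 < s.re) (hs₁ : s.re < 1)
    (h₁ : LowerHomog (Complex.I * l₁ + 1) F₁)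
    (h₂ : LowerHomog (Complex.I * l₂ + 1) F₂) (hΦ : UpperHomog (-(2 * s - 1 + 1)) Φ)
    (s₁ : ContDiff ℝ ∞ (fun θ => F₁ (rot θ))) (s₂ : ContDiff ℝ ∞ (fun θ => F₂ (rot θ)))
    (cΦ : Continuous (fun θ => Φ (rot θ))) :
    Integrable (rsIntegrand F₁ F₂ Φ) (periodMeasure.prod volume) := by
  set u := uParam l₁ l₂ s with hu
  have hu0 : 0 < u.re := by rw [hu, uParam_re]; exact hs₀
  have hu1 : u.re < 1 := by rw [hu, uParam_re]; exact hs₁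
  obtain ⟨S, hS0, hS⟩ := (UnitarySeries.periodic_two_pi Φ).exists_norm_le two_pi_pos cΦ
  obtain ⟨C₁, hC₁⟩ := h₁.exists_hasDecay (by simp) s₁
  obtain ⟨C₂, hC₂⟩ := h₂.exists_hasDecay (by simp) s₂
  have h0 : ∀ᵐ p : ℝ × ℝ ∂(periodMeasure.prod volume), p.2 ≠ 0 :=
    Measure.quasiMeasurePreserving_snd.ae (Measure.ae_ne volume 0)
  have hm : AEStronglyMeasurable (rsIntegrand F₁ F₂ Φ) (periodMeasure.prod volume) := by
    have m1 := aestronglyMeasurable_Wh (by simp) h₁ s₁ periodMeasure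
    have m2 := aestronglyMeasurable_Wh (by simp) h₂ s₂ periodMeasure
    have m3 : AEStronglyMeasurable (fun p : ℝ × ℝ => Φ (rot p.1 * diag p.2))
        (periodMeasure.prod volume) := by
      have m4 : Measurable (fun p : ℝ × ℝ => ((|p.2| : ℝ) : ℂ) ^ (-(2 * s - 1 + 1))) := by
        fun_prop
      refine (m4.aestronglyMeasurable.mul
        (cΦ.comp continuous_fst).aestronglyMeasurable).congr ?_
      filter_upwards [h0] with p hp
      simp only [Pi.mul_apply, Function.comp]
      rw [hΦ _ _ (diag_upper hp), diag_zero_zero hp]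
    have m5 : Measurable (fun p : ℝ × ℝ => ((|p.2| ^ 2 / |p.2| / (2 * π) : ℝ) : ℂ)) := by
      fun_prop
    exact ((m1.mul m2.star).mul m3).mul m5.aestronglyMeasurable
  set D : ℝ → ℝ := fun t =>
      C₁ * C₂ * (fourierConst 0 ^ 2 + fourierConst (1 - u.re / 4) ^ 2) *
        (if |t| ≤ 1 then |t| ^ (u.re / 2 - 1) else |t| ^ (u.re - 3)) with hD
  have hDi : Integrable D :=
    (integrable_rpow_piecewise (by linarith) (by linarith)).const_mul _
  have hdom : Integrable (fun p : ℝ × ℝ => S / (2 * π) * ((|p.2| ^ 3)⁻¹ * D (p.2 * |p.2|)⁻¹))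
      (periodMeasure.prod volume) :=
    ((integrable_comp_inv_mul_abs hDi).comp_snd periodMeasure).const_mul _
  refine hdom.mono' hm ?_
  filter_upwards [h0] with p hp
  obtain ⟨θ, a⟩ := p
  have hp : a ≠ 0 := hp
  obtain ⟨f₁', hf₁⟩ := hC₁ θ
  obtain ⟨f₂', hf₂⟩ := hC₂ θ
  have ht : (a * |a|)⁻¹ ≠ 0 := inv_ne_zero (mul_ne_zero hp (abs_ne_zero.2 hp))
  rw [rsIntegrand_eq h₁ h₂ hΦ s₁ s₂ θ hp, norm_mul, norm_mul, Complex.norm_real,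
    norm_of_nonneg (by positivity : 0 ≤ (|a| ^ 3)⁻¹), norm_div]
  have hπ : ‖(2 * π : ℂ)‖ = 2 * π := by simp [abs_of_pos pi_pos]
  rw [hπ]
  gcongr
  · exact hS θ
  · refine norm_abs_cpow_mul_le hu0 hu1 ht hf₁.nonneg hf₂.nonneg
      (fun α ha hb => hf₁.norm_limFourier_le ht ha hb) (fun α ha hb => ?_)
    rw [RCLike.norm_conj]
    exact hf₂.norm_limFourier_le ht ha hb

/-- The 4π combines 1/2π from the measure on K with 1/2 from the change of variable. -/
theorem integral_rsIntegrand (hs₀ : 0 < s.re) (hs₁ : s.re < 1)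
    (h₁ : LowerHomog (Complex.I * l₁ + 1) F₁)
    (h₂ : LowerHomog (Complex.I * l₂ + 1) F₂) (hΦ : UpperHomog (-(2 * s - 1 + 1)) Φ)
    (s₁ : ContDiff ℝ ∞ (fun θ => F₁ (rot θ))) (s₂ : ContDiff ℝ ∞ (fun θ => F₂ (rot θ))) (θ : ℝ) :
    ∫ a, rsIntegrand F₁ F₂ Φ (θ, a) = G₀ (uParam l₁ l₂ s) / (4 * π) * (Φ (rot θ) *
      noncompactPairing (uParam l₁ l₂ s) (leftTranslate (rot θ)⁻¹ F₁)
        (leftTranslate (rot θ)⁻¹ F₂)) := by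
  obtain ⟨C₁, hC₁⟩ := h₁.exists_hasDecay (by simp) s₁
  obtain ⟨C₂, hC₂⟩ := h₂.exists_hasDecay (by simp) s₂
  obtain ⟨f₁', hf₁⟩ := hC₁ θ
  obtain ⟨f₂', hf₂⟩ := hC₂ θ
  have hπ : (π : ℂ) ≠ 0 := by exact_mod_cast pi_ne_zero
  have h := integral_congr_ae ((Measure.ae_ne volume (0 : ℝ)).mono fun a ha =>
    rsIntegrand_eq h₁ h₂ hΦ s₁ s₂ θ ha)
  rw [h, integral_const_mul, integral_comp_inv_mul_abs (fun t =>
    ((|t| : ℝ) : ℂ) ^ (uParam l₁ l₂ s - 1) * (limFourier (fun x => F₁ (rot θ * unip x)) t *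
      conj (limFourier (fun x => F₂ (rot θ * unip x)) t))),
    integral_abs_cpow_mul_limFourier (by rwa [uParam_re]) (by rwa [uParam_re]) hf₁ hf₂]
  simp only [noncompactPairing, leftTranslate_apply, inv_inv]
  field_simp
  ring

end RankinSelberg

/-! ### Conclusion. -/

theorem restrict_rsDomain : (volume : Measure (ℝ × ℝ)).restrict rsDomain =
    periodMeasure.prod volume := by
  rw [rsDomain, Measure.volume_eq_prod, ← Measure.prod_restrict, Measure.restrict_univ]
  rfl

/-- Both sides are multiples of the same integral of φ times the pairing over K, and G₀/(4π) = 4 ·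
G₀/(16π). -/
theorem rankinSelberg_eq_trilinearForm {l₁ l₂ : ℝ} {s : ℂ} (hs₀ : 0 < s.re) (hs₁ : s.re < 1)
    (f₁ : UnitarySeries l₁) (f₂ : UnitarySeries l₂) (φ : SmoothSeries (2 * s - 1))
    (s₁ : f₁.IsSmooth) (s₂ : f₂.IsSmooth) :
    rankinSelberg f₁ f₂ φ = trilinearForm l₁ l₂ (2 * s - 1) hs₀ hs₁ f₁ f₂ φ := by
  have hi := integrable_rsIntegrand hs₀ hs₁ (unitarySeries_lowerHomog f₁)
    (unitarySeries_lowerHomog f₂) (smoothSeries_upperHomog φ) s₁ s₂ φ.continuous_rot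
  have hπ : (π : ℂ) ≠ 0 := by exact_mod_cast pi_ne_zero
  rw [rankinSelberg, restrict_rsDomain, integral_prod _ hi]
  simp only [integral_rsIntegrand hs₀ hs₁ (unitarySeries_lowerHomog f₁)
    (unitarySeries_lowerHomog f₂) (smoothSeries_upperHomog φ) s₁ s₂]
  rw [integral_const_mul, integral_periodMeasure, trilinearForm_apply,
    tripleIntegral_eq_integral_pairing hs₀ hs₁]
  field_simp
  ring

theorem mainTheorem8 (l₁ l₂ : ℝ) (s : ℂ) (hs₀ : 0 < s.re) (hs₁ : s.re < 1) :
    -- absolute convergence for all `L²` vectors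
    (∀ (f₁ : UnitarySeries l₁) (f₂ : UnitarySeries l₂) (φ : SmoothSeries (2 * s - 1)),
      (∀ θ₁ θ₂ : ℝ, IntegrableOn (convIntegrand f₁ f₂ φ θ₁ θ₂) (Ioc 0 (2 * π))) ∧
      IntegrableOn (fun p : ℝ × ℝ => circleIntegrand l₁ l₂ s f₁ f₂ φ p.1 p.2)
        (Ioc 0 (2 * π) ×ˢ Ioc 0 (2 * π))) ∧
    -- the representations of `G` by left translation and the continuous equivariant form
    ∃ (ρ₁ : Representation ℂ SLpm (UnitarySeries l₁))
      (ρ₂ : Representation ℂ SLpm (UnitarySeries l₂))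
      (σ : Representation ℂ SLpm (SmoothSeries (2 * s - 1)))
      (T : UnitarySeries l₁ →ₗ[ℂ] UnitarySeries l₂ →ₗ⋆[ℂ] SmoothSeries (2 * s - 1) →ₗ[ℂ] ℂ),
      (∀ g f, (ρ₁ g f : SLpm → ℂ) = leftTranslate g f) ∧
      (∀ g f, (ρ₂ g f : SLpm → ℂ) = leftTranslate g f) ∧
      (∀ g φ, (σ g φ : SLpm → ℂ) = leftTranslate g φ) ∧
      -- the explicit formula
      (∀ f₁ f₂ φ, T f₁ f₂ φ = G₀ (uParam l₁ l₂ s) / 8 *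
        ∫ θ₂ in (0 : ℝ)..(2 * π), ∫ θ₁ in (0 : ℝ)..(2 * π),
          circleIntegrand l₁ l₂ s f₁ f₂ φ θ₁ θ₂) ∧
      Continuous (fun p : UnitarySeries l₁ × UnitarySeries l₂ × SmoothSeries (2 * s - 1) =>
        T p.1 p.2.1 p.2.2) ∧
      (∀ g f₁ f₂ φ, T (ρ₁ g f₁) (ρ₂ g f₂) (σ g φ) = T f₁ f₂ φ) ∧
      -- on smooth vectors the form is the Rankin–Selberg integral of Whittaker functions
      (∀ (f₁ : UnitarySeries l₁) (f₂ : UnitarySeries l₂) (φ : SmoothSeries (2 * s - 1)),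
        f₁.IsSmooth → f₂.IsSmooth →
        (∀ g, Tendsto (truncatedWhittaker (leftTranslate g⁻¹ f₁)) atTop (𝓝 (Wh f₁ g))) ∧
        (∀ g, Tendsto (truncatedWhittaker (leftTranslate g⁻¹ f₂)) atTop (𝓝 (Wh f₂ g))) ∧
        IntegrableOn (rsIntegrand f₁ f₂ φ) rsDomain ∧
        rankinSelberg f₁ f₂ φ = T f₁ f₂ φ) := by
  refine ⟨fun f₁ f₂ φ => ⟨fun θ₁ θ₂ => integrable_convIntegrand f₁ f₂ φ θ₁ θ₂, ?_⟩,
    unitaryRep l₁, unitaryRep l₂, smoothRep (2 * s - 1), trilinearForm l₁ l₂ _ hs₀ hs₁,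
    fun _ _ => rfl, fun _ _ => rfl, fun _ _ => rfl, trilinearForm_eq hs₀ hs₁,
    continuous_trilinearForm hs₀ hs₁, fun g f₁ f₂ φ => ?_, fun f₁ f₂ φ s₁ s₂ => ⟨?_, ?_, ?_, ?_⟩⟩
  · have h := integrable_circleIntegrand f₁ f₂ φ hs₀ hs₁
    rwa [periodMeasure, Measure.prod_restrict, ← Measure.volume_eq_prod] at h
  · rw [trilinearForm_apply, trilinearForm_apply, tripleIntegral_equivariant hs₀ hs₁]
  · exact (unitarySeries_lowerHomog f₁).tendsto_truncatedWhittaker (by simp) s₁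
  · exact (unitarySeries_lowerHomog f₂).tendsto_truncatedWhittaker (by simp) s₂
  · rw [IntegrableOn, restrict_rsDomain]
    exact integrable_rsIntegrand hs₀ hs₁ (unitarySeries_lowerHomog f₁)
      (unitarySeries_lowerHomog f₂) (smoothSeries_upperHomog φ) s₁ s₂ φ.continuous_rot
  · exact rankinSelberg_eq_trilinearForm hs₀ hs₁ f₁ f₂ φ s₁ s₂
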